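/- **Theorem 2.** Let $0<\tau_0<1/4$, $\Theta=[-\tau_0,\tau_0]$, and let $\rho,C_0,L>0$ and $\beta\ge 2$. For a function $f$ put $f_k=\sqrt2\int_{-1/2}^{1/2}f(t)\cos(2\pi kt)\,dt$, $k\ge 1$. All functions below are 1-periodic, symmetric and equal to their cosine series, $f(t)=\sqrt2\sum_{k\ge1}f_k\cos(2\pi kt)$, with convergence for every $t$. Write $$\|f\|^2=\sum_{k\ge1}f_k^2,\qquad \|f'\|^2=\sum_{k\ge1}(2\pi k)^2f_k^2,\qquad \|f''\|^2=\sum_{k\ge1}(2\pi k)^4f_k^2,$$ $$F(\rho,C_0)=\{f: f_1^2\ge\rho,\ \|f''\|^2\le C_0\},\qquad \mathcal W(\beta,L)=\Big\{f:\sum_{k\ge1}(2\pi k)^{2\beta}f_k^2\le L\Big\}.$$ For $0<\varepsilon<1$ one observes $\mathbf X^\varepsilon=\{x^\varepsilon(t)=f(t-\theta)+\varepsilon n(t),\ t\in[-1/2,1/2]\}$, where $n$ is standard Gaussian white noise on $[-1/2,1/2]$ and $\theta\in\Theta$ and $f$ are unknown; $\mathbf E_{\theta,f}$ is the corresponding expectation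 and $I^\varepsilon(f)=\varepsilon^{-2}\int_{-1/2}^{1/2}f'(t)^2\,dt$ is the Fisher information. Let $W_\varepsilon$ satisfy $$W_\varepsilon=(1+o(1))\left(\frac{L(\beta+2)(2\beta+1)}{\varepsilon^2(2\pi)^{2\beta}(\beta-1)}\right)^{1/(2\beta+1)}\qquad(\varepsilon\to0),$$ and let $$r^\varepsilon=\inf_{h\in\ell_2}\ \sup_{f\in\mathcal W(\beta,L)}\ \sum_{k\ge1}(2\pi k)^2\big[(1-h_k)^2f_k^2+\varepsilon^2h_k^2\big].$$ Fix $\bar f\in F(\rho,C_0)$ and, for $\delta>0$, let $F_\delta(\bar f)=\{\bar f+v:\ v\in\mathcal W(\beta,L),\ \|v\|\le\delta\}$. Let $\delta_\varepsilon>0$ be such that $\lim_{\varepsilon\to0}\delta_\varepsilon=0$ and $\lim_{\varepsilon\to0}\delta_\varepsilon^2/(\varepsilon^2W_\varepsilon^{1+\alpha})=\infty$ for some $\alpha>0$. Then, as $\varepsilon\to0$, $$\inf_{\hat\theta_\varepsilon}\ \sup_{\theta\in\Theta,\ f\in F_{\delta_\varepsilon}(\bar f)}\mathbf E_{\theta,f}\big[(\hat\theta_\varepsilon-\theta)^2I^\varepsilon(f)\big]\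 \ge\ 1+(1+o(1))\,\frac{r^\varepsilon}{\|\bar f'\|^2},$$ where the infimum is over all estimators $\hat\theta_\varepsilon$ based on the observation $\mathbf X^\varepsilon$. -/

import Mathlib

open MeasureTheory ProbabilityTheory Filter Set
open scoped Topology ENNReal

noncomputable section

/-! ### Symmetric periodic signals and their cosine coefficients

A signal on `[-1/2, 1/2]` is represented by its `1`-periodic extension `f : ℝ → ℝ`. -/

/-- The Fourier coefficient `f_k = √2 ∫_{-1/2}^{1/2} f(t) cos(2πkt) dt`. -/
def cosCoeff (f : ℝ → ℝ) (k : ℕ) : ℝ :=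
  √2 * ∫ t in (-1 / 2 : ℝ)..(1 / 2), f t * Real.cos (2 * Real.pi * k * t)

/-- `f(t) = √2 ∑_{k ≥ 1} f_k cos(2πkt)`, where the series converges for all `t`.
In particular `f` is even and `1`-periodic. -/
def HasCosineExpansion (f : ℝ → ℝ) : Prop :=
  ∀ t : ℝ, Tendsto
    (fun n : ℕ => √2 * ∑ k ∈ Finset.Icc 1 n, cosCoeff f k * Real.cos (2 * Real.pi * k * t))
    atTop (𝓝 (f t))

/-- The weighted sum `∑_{k ≥ 1} (2πk)^{2s} f_k²`, with values in `[0, ∞]`; for `s = 0, 1, 2` it is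
`‖f‖²`, `‖f'‖²`, `‖f''‖²`. -/
def sobolevSq (f : ℝ → ℝ) (s : ℝ) : ℝ≥0∞ :=
  ∑' k : ℕ+, ENNReal.ofReal ((2 * Real.pi * (k : ℕ)) ^ (2 * s) * cosCoeff f k ^ 2)

/-- The class `F(ρ, C₀)`: signals with `f_1² ≥ ρ` and `‖f''‖² ≤ C₀`. -/
def signalClass (ρ C₀ : ℝ) : Set (ℝ → ℝ) :=
  {f | HasCosineExpansion f ∧ ρ ≤ cosCoeff f 1 ^ 2 ∧ sobolevSq f 2 ≤ ENNReal.ofReal C₀}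

/-- The Sobolev ball `W(β, L)`. -/
def sobolevBall (β L : ℝ) : Set (ℝ → ℝ) :=
  {f | HasCosineExpansion f ∧ sobolevSq f β ≤ ENNReal.ofReal L}

/-- The vicinity `F_δ(f₀) = {f₀ + v : ‖v‖ ≤ δ, v ∈ W(β, L)}` of `f₀`, for `δ > 0`. -/
def vicinity (β L : ℝ) (f₀ : ℝ → ℝ) (δ : ℝ) : Set (ℝ → ℝ) :=
  {f | ∃ v ∈ sobolevBall β L, sobolevSq v 0 ≤ ENNReal.ofReal (δ ^ 2) ∧ f = f₀ + v}

/-- The Fisher information `I^ε(f) = ε⁻² ∫_{-1/2}^{1/2} f'(t)² dt` of the shift parameter. -/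
def fisherInfo (ε : ℝ) (f : ℝ → ℝ) : ℝ :=
  (ε ^ 2)⁻¹ * ∫ t in (-1 / 2 : ℝ)..(1 / 2), deriv f t ^ 2

/-! ### The minimax value of the problem of estimating the derivative -/

/-- The functional `R^ε[f, h] = ∑_{k ≥ 1} (2πk)² [(1 - h_k)² f_k² + ε² h_k²]`, with values in
`[0, ∞]`. -/
def quadRisk (ε : ℝ) (f : ℝ → ℝ) (h : ℕ+ → ℝ) : ℝ≥0∞ :=
  ∑' k : ℕ+, ENNReal.ofReal
    ((2 * Real.pi * (k : ℕ)) ^ 2 * ((1 - h k) ^ 2 * cosCoeff f k ^ 2 + ε ^ 2 * h k ^ 2))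

/-- The minimax value `r^ε = inf_{h ∈ ℓ²} sup_{f ∈ W(β, L)} R^ε[f, h]`. -/
def pinskerValue (β L ε : ℝ) : ℝ≥0∞ :=
  ⨅ (h : ℕ+ → ℝ) (_ : Memℓp h 2), ⨆ f ∈ sobolevBall β L, quadRisk ε f h

/-! ### The Gaussian white noise model -/

/-- Lebesgue measure on `[-1/2, 1/2]`. -/
abbrev unitVolume : Measure ℝ := volume.restrict (Icc (-1 / 2) (1 / 2))

/-- The test functions: the real Hilbert space `L²[-1/2, 1/2]`. -/
abbrev TestFun : Type := Lp ℝ 2 unitVolume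

/-- Standard Gaussian white noise on `[-1/2, 1/2]`: a centred Gaussian process `N` indexed by
`L²[-1/2, 1/2]`, where `N φ` stands for `∫ φ(t) n(t) dt`, with covariance
`E[N φ N ψ] = ∫ φ ψ`. -/
structure IsWhiteNoise {Ω : Type*} [MeasurableSpace Ω] (N : TestFun → Ω → ℝ) (P : Measure Ω) :
    Prop where
  measurable : ∀ φ, Measurable (N φ)
  gaussian : IsGaussianProcess N P
  mean_zero : ∀ φ, ∫ ω, N φ ω ∂P = 0
  covariance : ∀ φ ψ, cov[N φ, N ψ; P] = inner ℝ φ ψ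

/-- The observation `x^ε(t) = f(t - θ) + ε n(t)`, `t ∈ [-1/2, 1/2]`, given by its integrals
`∫ φ(t) x^ε(t) dt = ∫ φ(t) f(t - θ) dt + ε N(φ)` against all test functions `φ`. -/
def observation {Ω : Type*} (N : TestFun → Ω → ℝ) (ε θ : ℝ) (f : ℝ → ℝ) (ω : Ω) : TestFun → ℝ :=
  fun φ => (∫ t in Icc (-1 / 2 : ℝ) (1 / 2), φ t * f (t - θ)) + ε * N φ ω

/-- The normalized risk `E_{θ,f}[(T(X^ε) - θ)² I^ε(f)]` of the estimator `T(X^ε)`. -/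
def normalizedRisk {Ω : Type*} [MeasurableSpace Ω] (P : Measure Ω) (N : TestFun → Ω → ℝ)
    (T : (TestFun → ℝ) → ℝ) (ε θ : ℝ) (f : ℝ → ℝ) : ℝ≥0∞ :=
  ∫⁻ ω, ENNReal.ofReal ((T (observation N ε θ f ω) - θ) ^ 2 * fisherInfo ε f) ∂P

/-- The minimax risk over `θ ∈ Θ` and `f ∈ 𝓕`: the infimum over all estimators, that is, over all
measurable functions of the observation, of the maximal normalized risk. -/
def minimaxShiftRisk {Ω : Type*} [MeasurableSpace Ω] (P : Measure Ω) (N : TestFun → Ω → ℝ)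
    (ε : ℝ) (Θ : Set ℝ) (𝓕 : Set (ℝ → ℝ)) : ℝ≥0∞ :=
  ⨅ (T : (TestFun → ℝ) → ℝ) (_ : Measurable T),
    ⨆ θ ∈ Θ, ⨆ f ∈ 𝓕, normalizedRisk P N T ε θ f

end

open scoped NNReal BoundedContinuousFunction

noncomputable section

/-! ### Cameron–Martin formula for white noise with a drift -/

section GaussianShift

open scoped NNReal

/-! The maximal risk is bounded below by an average over a prior on the pair (shift, signal), and
this average is bounded by a van Trees inequality that keeps the second-order term.

Change of measure. In the coordinates √2cos(2πkt), √2sin(2πkt), shifting a cosine series by θ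
rotates the k-th coefficient pair by the angle 2πkθ. By the Cameron–Martin formula
(`lintegral_drift`, `lintegral_observation`) every risk becomes an integral over pure noise (x, y),
weighted by a likelihood that depends on θ only through the rotated noise `rotCos θ x y`. Let q be
this likelihood averaged over the random signal. Its θ-derivative is ε⁻¹∑ 2πk m_k·`rotSin`_k, where
m_k is the unnormalized posterior mean of the k-th coefficient, a function of `rotCos`. The sequence
`rotSin` is orthonormal and independent of `rotCos`, so the conditional second moment of the
derivative is at most ε⁻²∑(2πk)²m_k².

Van Trees. Let r² be a density on [-τ, τ] with r(±τ) = 0. Integration by parts writes the total mass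
1 as the integral of (U - t)∂ₜ(r²q), where U is the estimator. The loss contains the Fisher
information of the signal itself, so averaging it over the signal produces the weight G, the
unnormalized posterior mean of ‖f'‖². The product is therefore split by 2AB ≤ A² + B² with weight
G/ε². Since ∑(2πk)²m_k²/q plus the posterior variance of f' is at most G (`sum_sq_mixCoef_add_le`),
the factor with the derivative of q is not 1 but 1 minus (posterior variance of f')/‖f'‖², up to an
error of order ε² from the prior on the shift (`conditional_score_le`, `van_trees`). Hence the risk
exceeds 1 by the relative posterior variance of f'.

Least favourable signals. The perturbations of the fixed signal are independent Gaussian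
coefficients with Pinsker's variances ε²h_k/u_k, where u_k = (k/w)^(β-1), h_k = (1 - u_k)₊ and the
cutoff w saturates the ellipsoid. Their posterior variances are ε²h_k, so the gain is ε²∑(2πk)²h_k,
and the filter h shows that r^ε is at most this sum (`pinskerValue_le`); no reverse estimate is
needed. The variances are shrunk by 1 - g, restricted to frequencies in [κw, w), and the prior is
conditioned on the ellipsoid and the δ-ball. Chebyshev's and Markov's inequalities make the
conditioning event likely, and comparison with the unconditioned conjugate posterior
(`le_mixVar_add_lintegral_compl`) shows that conditioning costs little.

Finally w → ∞ and ε²w³ → 0: the information of the shift prior is negligible against ε²w³, the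
perturbation changes ‖f'‖² negligibly, and the condition on δ gives ε²w/δ² → 0. Each fixed relative
loss is thus admissible for small ε, and a diagonal choice makes the loss vanish. -/

theorem lintegral_gaussianReal_shift {v : ℝ≥0} (hv : v ≠ 0) (a : ℝ) {G : ℝ → ℝ≥0∞}
    (hG : Measurable G) :
    ∫⁻ y, G (y + a * v) ∂gaussianReal 0 v =
      ∫⁻ y, G y * ENNReal.ofReal (Real.exp (a * y - a ^ 2 * v / 2)) ∂gaussianReal 0 v := by
  have h1 : ∫⁻ y, G (y + a * v) ∂gaussianReal 0 v = ∫⁻ y, G y ∂gaussianReal (a * v) v := by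
    have := gaussianReal_map_add_const (μ := 0) (v := v) (a * v)
    rw [zero_add] at this
    rw [← this, lintegral_map hG (by fun_prop)]
  rw [h1, gaussianReal_of_var_ne_zero _ hv, gaussianReal_of_var_ne_zero _ hv,
    lintegral_withDensity_eq_lintegral_mul _ (measurable_gaussianPDF _ _) hG,
    lintegral_withDensity_eq_lintegral_mul _ (measurable_gaussianPDF _ _)
      (g := fun y => G y * ENNReal.ofReal (Real.exp (a * y - a ^ 2 * v / 2)))
      (hG.mul (by fun_prop))]
  refine lintegral_congr fun y => ?_
  simp only [Pi.mul_apply, gaussianPDF]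
  rw [mul_comm (G y), ← mul_assoc, ← ENNReal.ofReal_mul (gaussianPDFReal_nonneg _ _ _)]
  congr 2
  have hv' : (v : ℝ) ≠ 0 := by exact_mod_cast hv
  rw [gaussianPDFReal, gaussianPDFReal, mul_assoc _ (Real.exp _) (Real.exp _), ← Real.exp_add]
  congr 2
  field_simp
  ring

end GaussianShift

namespace IsWhiteNoise

variable {Ω : Type*} [MeasurableSpace Ω] {P : Measure Ω} {N : TestFun → Ω → ℝ}

theorem memLp_two (hN : IsWhiteNoise N P) (φ : TestFun) : MemLp (N φ) 2 P :=
  (hN.gaussian.hasGaussianLaw_eval φ).memLp_two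

theorem integral_mul (hN : IsWhiteNoise N P) [IsProbabilityMeasure P] (φ ψ : TestFun) :
    ∫ ω, N φ ω * N ψ ω ∂P = inner ℝ φ ψ := by
  rw [← hN.covariance, covariance_eq_sub (hN.memLp_two φ) (hN.memLp_two ψ), hN.mean_zero,
    hN.mean_zero]
  simp

theorem hasLaw (hN : IsWhiteNoise N P) [IsProbabilityMeasure P] (φ : TestFun) :
    P.map (N φ) = gaussianReal 0 (‖φ‖ ^ 2).toNNReal := by
  rw [(hN.gaussian.hasGaussianLaw_eval φ).map_eq_gaussianReal, hN.mean_zero,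
    ← covariance_self (hN.measurable φ).aemeasurable, hN.covariance, real_inner_self_eq_norm_sq]

/-- Subtracting the projection on `s` kills the covariance with `N s`, and joint Gaussianity
upgrades this to independence. The residual is kept as one element of the product space, so that the
whole observation is a measurable function of the pair. -/
theorem indepFun_residual (hN : IsWhiteNoise N P) [IsProbabilityMeasure P] {s : TestFun}
    (hs : s ≠ 0) :
    IndepFun (N s) (fun ω (φ : TestFun) => N φ ω - inner ℝ φ s / ‖s‖ ^ 2 * N s ω) P := by
  have hs' : ‖s‖ ^ 2 ≠ 0 := by simpa using hs
  have key : IndepFun (fun ω (_ : Unit) => N s ω)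
      (fun ω (φ : TestFun) => N φ ω - inner ℝ φ s / ‖s‖ ^ 2 * N s ω) P := by
    refine IsGaussianProcess.indepFun_of_covariance_eq_zero (X := fun (_ : Unit) ω => N s ω)
      (Y := fun φ ω => N φ ω - inner ℝ φ s / ‖s‖ ^ 2 * N s ω) ?_
      (fun _ => (hN.measurable s).aemeasurable)
      (fun φ => ((hN.measurable φ).sub ((hN.measurable s).const_mul _)).aemeasurable) ?_
    · classical
      refine hN.gaussian.of_isGaussianProcess fun i => ?_
      rcases i with u | φ
      · exact ⟨{s}, ContinuousLinearMap.proj ⟨s, by simp⟩, fun ω => by simp⟩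
      · refine ⟨{φ, s}, ContinuousLinearMap.proj ⟨φ, by simp⟩ -
          (inner ℝ φ s / ‖s‖ ^ 2) • ContinuousLinearMap.proj ⟨s, by simp⟩, fun ω => by simp⟩
    · intro _ φ
      have h2 := (hN.memLp_two s).const_mul (inner ℝ φ s / ‖s‖ ^ 2)
      change cov[N s, N φ - fun ω => inner ℝ φ s / ‖s‖ ^ 2 * N s ω; P] = 0
      rw [covariance_sub_right (hN.memLp_two s) (hN.memLp_two φ) h2,
        covariance_const_mul_right, hN.covariance, hN.covariance, real_inner_self_eq_norm_sq,
        real_inner_comm]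
      field_simp
      ring
  exact key.comp (φ := fun g : Unit → ℝ => g ()) (measurable_pi_apply _) measurable_id

/-- The Cameron–Martin formula for white noise observed with a drift. -/
theorem lintegral_drift (hN : IsWhiteNoise N P) [IsProbabilityMeasure P] {s : TestFun}
    (hs : s ≠ 0) {ε : ℝ} (hε : ε ≠ 0) {F : (TestFun → ℝ) → ℝ≥0∞} (hF : Measurable F) :
    ∫⁻ ω, F (fun φ => inner ℝ φ s + ε * N φ ω) ∂P =
      ∫⁻ ω, F (fun φ => ε * N φ ω) *
        ENNReal.ofReal (Real.exp (ε⁻¹ * N s ω - ‖s‖ ^ 2 / (2 * ε ^ 2))) ∂P := by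
  have hs' : ‖s‖ ^ 2 ≠ 0 := by simpa using hs
  set R : Ω → TestFun → ℝ := fun ω φ => N φ ω - inner ℝ φ s / ‖s‖ ^ 2 * N s ω with hR
  have hRm : Measurable R := measurable_pi_lambda _ fun φ =>
    (hN.measurable φ).sub ((hN.measurable s).const_mul _)
  set Φ : ℝ × (TestFun → ℝ) → (TestFun → ℝ) :=
    fun p φ => ε * (inner ℝ φ s / ‖s‖ ^ 2 * p.1 + p.2 φ) with hΦ
  have hΦm : Measurable Φ := measurable_pi_lambda _ fun φ => by
    refine Measurable.const_mul (Measurable.add (measurable_fst.const_mul _) ?_) _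
    exact (measurable_pi_apply φ).comp measurable_snd
  set v : NNReal := (‖s‖ ^ 2).toNNReal with hv
  have hvr : (v : ℝ) = ‖s‖ ^ 2 := Real.coe_toNNReal _ (by positivity)
  have hv0 : v ≠ 0 := by
    intro h
    rw [h] at hvr
    exact hs' hvr.symm
  have hpair : P.map (fun ω => (N s ω, R ω)) = (gaussianReal 0 v).prod (P.map R) := by
    rw [← hN.hasLaw]
    exact (indepFun_iff_map_prod_eq_prod_map_map (hN.measurable s).aemeasurable
      hRm.aemeasurable).1 (hN.indepFun_residual hs)
  have hpm : Measurable fun ω => (N s ω, R ω) := (hN.measurable s).prodMk hRm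
  have : IsProbabilityMeasure (P.map R) := Measure.isProbabilityMeasure_map hRm.aemeasurable
  -- The drift acts only on the scalar coordinate `N s`, translating it by ‖s‖²/ε and leaving the
  -- residual fixed. This reduces the formula to a one-dimensional Gaussian shift.
  have e1 : ∀ ω, (fun φ => inner ℝ φ s + ε * N φ ω) = Φ (N s ω + ε⁻¹ * v, R ω) := by
    intro ω
    funext φ
    simp only [hΦ, hR, hvr]
    field_simp
    ring
  have e2 : ∀ ω, (fun φ => ε * N φ ω) = Φ (N s ω, R ω) := by
    intro ω
    funext φ
    simp only [hΦ, hR]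
    ring
  have m1 : Measurable fun p : ℝ × (TestFun → ℝ) => F (Φ (p.1 + ε⁻¹ * v, p.2)) :=
    hF.comp (hΦm.comp ((measurable_fst.add_const _).prodMk measurable_snd))
  have m2 : Measurable fun p : ℝ × (TestFun → ℝ) => F (Φ (p.1, p.2)) *
      ENNReal.ofReal (Real.exp (ε⁻¹ * p.1 - (ε⁻¹) ^ 2 * v / 2)) := by
    refine (hF.comp hΦm).mul ?_
    fun_prop
  have l1 : ∫⁻ ω, F (fun φ => inner ℝ φ s + ε * N φ ω) ∂P =
      ∫⁻ r, ∫⁻ y, F (Φ (y + ε⁻¹ * v, r)) ∂gaussianReal 0 v ∂P.map R := by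
    rw [← lintegral_prod_symm' _ m1, ← hpair, lintegral_map m1 hpm]
    simp only [e1]
  have l2 : ∫⁻ ω, F (fun φ => ε * N φ ω) *
        ENNReal.ofReal (Real.exp (ε⁻¹ * N s ω - ‖s‖ ^ 2 / (2 * ε ^ 2))) ∂P =
      ∫⁻ r, ∫⁻ y, F (Φ (y, r)) *
        ENNReal.ofReal (Real.exp (ε⁻¹ * y - (ε⁻¹) ^ 2 * v / 2)) ∂gaussianReal 0 v ∂P.map R := by
    rw [← lintegral_prod_symm' _ m2, ← hpair, lintegral_map m2 hpm]
    refine lintegral_congr fun ω => ?_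
    simp only [e2, hvr]
    congr 4
    field_simp
  rw [l1, l2]
  refine lintegral_congr fun r => ?_
  exact lintegral_gaussianReal_shift hv0 ε⁻¹ (G := fun y => F (Φ (y, r)))
    (hF.comp (hΦm.comp (measurable_id.prodMk measurable_const)))

/-! ### Almost sure linearity of white noise -/

theorem integral_sq_sub (hN : IsWhiteNoise N P) [IsProbabilityMeasure P] (φ ψ : TestFun) :
    ∫ ω, (N φ ω - N ψ ω) ^ 2 ∂P = ‖φ - ψ‖ ^ 2 := by
  have i : ∀ x y, Integrable (fun ω => N x ω * N y ω) P := fun x y =>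
    (hN.memLp_two x).integrable_mul (hN.memLp_two y)
  have : ∀ ω, (N φ ω - N ψ ω) ^ 2 =
      N φ ω * N φ ω + ((-2) * (N φ ω * N ψ ω) + N ψ ω * N ψ ω) := fun ω => by ring
  simp_rw [this]
  rw [integral_add (i φ φ) (g := fun ω => -2 * (N φ ω * N ψ ω) + N ψ ω * N ψ ω)
      (((i φ ψ).const_mul (-2)).add (i ψ ψ)),
    integral_add ((i φ ψ).const_mul (-2)) (i ψ ψ),
    integral_const_mul, hN.integral_mul, hN.integral_mul, hN.integral_mul,
    @norm_sub_sq_real, real_inner_self_eq_norm_sq, real_inner_self_eq_norm_sq]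
  ring

/-- Linearity is not part of the definition of the noise: it follows from the covariance, because
the difference of the two sides has zero second moment. -/
theorem ae_eq_combination (hN : IsWhiteNoise N P) [IsProbabilityMeasure P] (a b : ℝ)
    (φ ψ : TestFun) : N (a • φ + b • ψ) =ᵐ[P] fun ω => a * N φ ω + b * N ψ ω := by
  set χ := a • φ + b • ψ with hχ
  have i : ∀ x y, Integrable (fun ω => N x ω * N y ω) P := fun x y =>
    (hN.memLp_two x).integrable_mul (hN.memLp_two y)
  have hm : MemLp (fun ω => N χ ω - (a * N φ ω + b * N ψ ω)) 2 P :=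
    (hN.memLp_two χ).sub (((hN.memLp_two φ).const_mul a).add ((hN.memLp_two ψ).const_mul b))
  have hint : Integrable (fun ω => (N χ ω - (a * N φ ω + b * N ψ ω)) ^ 2) P := hm.integrable_sq
  have hz : ∫ ω, (N χ ω - (a * N φ ω + b * N ψ ω)) ^ 2 ∂P = 0 := by
    have : ∀ ω, (N χ ω - (a * N φ ω + b * N ψ ω)) ^ 2 =
        N χ ω * N χ ω + (a ^ 2 * (N φ ω * N φ ω) + (b ^ 2 * (N ψ ω * N ψ ω) +
          ((2 * a * b) * (N φ ω * N ψ ω) + ((-(2 * a)) * (N χ ω * N φ ω) +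
            (-(2 * b)) * (N χ ω * N ψ ω))))) := fun ω => by ring
    simp_rw [this]
    rw [integral_add, integral_add, integral_add, integral_add, integral_add]
    · simp only [integral_const_mul, hN.integral_mul, hχ]
      simp only [inner_add_left, inner_add_right, inner_smul_left, inner_smul_right,
        real_inner_comm φ ψ]
      simp
      ring
    all_goals
      first
        | exact i _ _
        | exact (i _ _).const_mul _
        | exact ((i _ _).const_mul _).add ((i _ _).const_mul _)
        | exact ((i _ _).const_mul _).add (((i _ _).const_mul _).add ((i _ _).const_mul _))
        | exact ((i _ _).const_mul _).add (((i _ _).const_mul _).add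
            (((i _ _).const_mul _).add ((i _ _).const_mul _)))
        | exact ((i _ _).const_mul _).add (((i _ _).const_mul _).add
            (((i _ _).const_mul _).add (((i _ _).const_mul _).add ((i _ _).const_mul _))))
  have := (integral_eq_zero_iff_of_nonneg (fun ω => sq_nonneg _) hint).1 hz
  filter_upwards [this] with ω hω
  have : N χ ω - (a * N φ ω + b * N ψ ω) = 0 := by simpa using hω
  linarith

theorem ae_eq_sum (hN : IsWhiteNoise N P) [IsProbabilityMeasure P] {ι : Type*} (g : ι → TestFun)
    (F : Finset ι) : N (∑ i ∈ F, g i) =ᵐ[P] fun ω => ∑ i ∈ F, N (g i) ω := by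
  classical
  induction F using Finset.induction_on with
  | empty =>
    have := hN.ae_eq_combination 0 0 0 0
    simpa using this
  | insert i F hi ih =>
    have := hN.ae_eq_combination 1 1 (g i) (∑ j ∈ F, g j)
    filter_upwards [this, ih] with ω h1 h2
    rw [Finset.sum_insert hi, Finset.sum_insert hi, ← h2]
    simpa using h1

/-- Partial sums converge to `N s` in L² by the isometry, and to the series pathwise by assumption.
Fatou's lemma along a cofinal sequence of finite sets identifies the two limits. -/
theorem ae_eq_tsum (hN : IsWhiteNoise N P) [IsProbabilityMeasure P] {ι : Type*} [Countable ι]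
    {g : ι → TestFun} {s : TestFun} (hg : HasSum g s)
    (hsum : ∀ᵐ ω ∂P, Summable fun i => N (g i) ω) :
    N s =ᵐ[P] fun ω => ∑' i, N (g i) ω := by
  obtain ⟨F, hF⟩ := exists_seq_tendsto (atTop : Filter (Finset ι))
  have hall : ∀ᵐ ω ∂P, ∀ n, N (∑ i ∈ F n, g i) ω = ∑ i ∈ F n, N (g i) ω :=
    ae_all_iff.2 fun n => hN.ae_eq_sum g (F n)
  have hlim : ∀ᵐ ω ∂P, Tendsto (fun n => ENNReal.ofReal ((N s ω - N (∑ i ∈ F n, g i) ω) ^ 2))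
      atTop (𝓝 (ENNReal.ofReal ((N s ω - ∑' i, N (g i) ω) ^ 2))) := by
    filter_upwards [hall, hsum] with ω h1 h2
    simp only [h1]
    have := h2.hasSum.comp hF
    exact ENNReal.tendsto_ofReal ((tendsto_const_nhds.sub this).pow 2)
  have hbound : ∀ n, ∫⁻ ω, ENNReal.ofReal ((N s ω - N (∑ i ∈ F n, g i) ω) ^ 2) ∂P =
      ENNReal.ofReal (‖s - ∑ i ∈ F n, g i‖ ^ 2) := by
    intro n
    rw [← hN.integral_sq_sub]
    exact (ofReal_integral_eq_lintegral_ofReal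
      ((hN.memLp_two _).sub (hN.memLp_two _)).integrable_sq (ae_of_all _ fun ω => sq_nonneg _)).symm
  have hto : Tendsto (fun n => ENNReal.ofReal (‖s - ∑ i ∈ F n, g i‖ ^ 2)) atTop (𝓝 0) := by
    have h1 : Tendsto (fun n => ∑ i ∈ F n, g i) atTop (𝓝 s) := hg.comp hF
    have := ENNReal.tendsto_ofReal (((tendsto_const_nhds (x := s)).sub h1).norm.pow 2)
    simpa using this
  have hle : ∫⁻ ω, ENNReal.ofReal ((N s ω - ∑' i, N (g i) ω) ^ 2) ∂P ≤ 0 := by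
    calc ∫⁻ ω, ENNReal.ofReal ((N s ω - ∑' i, N (g i) ω) ^ 2) ∂P
        = ∫⁻ ω, liminf (fun n => ENNReal.ofReal ((N s ω - N (∑ i ∈ F n, g i) ω) ^ 2)) atTop ∂P :=
          lintegral_congr_ae (hlim.mono fun ω h => h.liminf_eq.symm)
      _ ≤ liminf (fun n => ∫⁻ ω, ENNReal.ofReal ((N s ω - N (∑ i ∈ F n, g i) ω) ^ 2) ∂P) atTop :=
          lintegral_liminf_le fun n =>
            (((hN.measurable _).sub (hN.measurable _)).pow_const 2).ennreal_ofReal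
      _ = 0 := by
          simp only [hbound]
          exact hto.liminf_eq
  have hmeas : AEMeasurable (fun ω => ENNReal.ofReal ((N s ω - ∑' i, N (g i) ω) ^ 2)) P :=
    aemeasurable_of_tendsto_metrizable_ae atTop
      (fun n => (((hN.measurable _).sub (hN.measurable _)).pow_const 2).ennreal_ofReal.aemeasurable)
      hlim
  have := (lintegral_eq_zero_iff' hmeas).1 (le_antisymm hle bot_le)
  filter_upwards [this] with ω hω
  have h0 : (N s ω - ∑' i, N (g i) ω) ^ 2 ≤ 0 := by simpa using hω
  have : N s ω - ∑' i, N (g i) ω = 0 := by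
    exact pow_eq_zero_iff (two_ne_zero) |>.1 (le_antisymm h0 (sq_nonneg _))
  linarith

end IsWhiteNoise

/-! ### Second moments of series with independent orthonormal terms -/

theorem integral_sq_add_sum_mul {Ω ι : Type*} [MeasurableSpace Ω] [DecidableEq ι] {P : Measure Ω}
    [IsProbabilityMeasure P] {s : ι → Ω → ℝ} (hs2 : ∀ i, MemLp (s i) 2 P)
    (hs0 : ∀ i, ∫ ω, s i ω ∂P = 0)
    (hss : ∀ i j, ∫ ω, s i ω * s j ω ∂P = if i = j then 1 else 0) (F : Finset ι) (b : ℝ)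
    (A : ι → ℝ) :
    ∫ ω, (b + ∑ i ∈ F, s i ω * A i) ^ 2 ∂P = b ^ 2 + ∑ i ∈ F, A i ^ 2 := by
  have hsi : ∀ i, Integrable (s i) P := fun i => (hs2 i).integrable (by norm_num)
  have hsij : ∀ i j, Integrable (fun ω => s i ω * s j ω) P := fun i j =>
    (hs2 i).integrable_mul (hs2 j)
  have hexp : ∀ ω, (b + ∑ i ∈ F, s i ω * A i) ^ 2 =
      b ^ 2 + (∑ i ∈ F, (2 * b * A i) * s i ω +
        ∑ i ∈ F, ∑ j ∈ F, (A i * A j) * (s i ω * s j ω)) := by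
    intro ω
    have h1 : (∑ i ∈ F, s i ω * A i) ^ 2 =
        ∑ i ∈ F, ∑ j ∈ F, (A i * A j) * (s i ω * s j ω) := by
      rw [sq, Finset.sum_mul_sum]
      exact Finset.sum_congr rfl fun i _ => Finset.sum_congr rfl fun j _ => by ring
    have h2 : 2 * b * (∑ i ∈ F, s i ω * A i) = ∑ i ∈ F, (2 * b * A i) * s i ω := by
      rw [Finset.mul_sum]
      exact Finset.sum_congr rfl fun i _ => by ring
    rw [← h1, ← h2]
    ring
  have i1 : Integrable (fun ω => ∑ i ∈ F, (2 * b * A i) * s i ω) P :=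
    integrable_finsetSum _ fun i _ => (hsi i).const_mul _
  have i2 : Integrable (fun ω => ∑ i ∈ F, ∑ j ∈ F, (A i * A j) * (s i ω * s j ω)) P :=
    integrable_finsetSum _ fun i _ => integrable_finsetSum _ fun j _ => (hsij i j).const_mul _
  have e1 : ∫ ω, ∑ i ∈ F, (2 * b * A i) * s i ω ∂P = 0 := by
    rw [integral_finsetSum _ fun i _ => (hsi i).const_mul _]
    exact Finset.sum_eq_zero fun i _ => by rw [integral_const_mul, hs0, mul_zero]
  have e2 : ∫ ω, ∑ i ∈ F, ∑ j ∈ F, (A i * A j) * (s i ω * s j ω) ∂P = ∑ i ∈ F, A i ^ 2 := by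
    rw [integral_finsetSum _ fun i _ => integrable_finsetSum _ fun j _ => (hsij i j).const_mul _]
    refine Finset.sum_congr rfl fun i hi => ?_
    rw [integral_finsetSum _ fun j _ => (hsij i j).const_mul _]
    simp only [integral_const_mul, hss, mul_ite, mul_one, mul_zero, Finset.sum_ite_eq, if_pos hi]
    ring
  calc ∫ ω, (b + ∑ i ∈ F, s i ω * A i) ^ 2 ∂P
      = ∫ ω, (b ^ 2 + (∑ i ∈ F, (2 * b * A i) * s i ω +
        ∑ i ∈ F, ∑ j ∈ F, (A i * A j) * (s i ω * s j ω))) ∂P := by simp_rw [hexp]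
    _ = ∫ _, b ^ 2 ∂P + ∫ ω, (∑ i ∈ F, (2 * b * A i) * s i ω +
        ∑ i ∈ F, ∑ j ∈ F, (A i * A j) * (s i ω * s j ω)) ∂P :=
        integral_add (integrable_const _) (i1.add i2)
    _ = ∫ _, b ^ 2 ∂P + (∫ ω, ∑ i ∈ F, (2 * b * A i) * s i ω ∂P +
        ∫ ω, ∑ i ∈ F, ∑ j ∈ F, (A i * A j) * (s i ω * s j ω) ∂P) := by
        rw [integral_add i1 i2]
    _ = _ := by rw [e1, e2]; simp

theorem lintegral_sq_add_sum_mul {Ω ι : Type*} [MeasurableSpace Ω] [DecidableEq ι] {P : Measure Ω}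
    [IsProbabilityMeasure P] {s : ι → Ω → ℝ} (hs2 : ∀ i, MemLp (s i) 2 P)
    (hs0 : ∀ i, ∫ ω, s i ω ∂P = 0)
    (hss : ∀ i j, ∫ ω, s i ω * s j ω ∂P = if i = j then 1 else 0) (F : Finset ι) (b : ℝ)
    (A : ι → ℝ) :
    ∫⁻ ω, ENNReal.ofReal ((b + ∑ i ∈ F, s i ω * A i) ^ 2) ∂P =
      ENNReal.ofReal (b ^ 2) + ∑ i ∈ F, ENNReal.ofReal (A i ^ 2) := by
  have hsum : MemLp (fun ω => ∑ i ∈ F, s i ω * A i) 2 P :=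
    memLp_finsetSum F fun i _ => (hs2 i).mul_const (A i)
  have hm2 : MemLp (fun ω => b + ∑ i ∈ F, s i ω * A i) 2 P := (memLp_const b).add hsum
  refine (ofReal_integral_eq_lintegral_ofReal hm2.integrable_sq
    (ae_of_all _ fun ω => sq_nonneg _)).symm.trans ?_
  rw [integral_sq_add_sum_mul hs2 hs0 hss, ENNReal.ofReal_add (sq_nonneg _)
    (Finset.sum_nonneg fun i _ => sq_nonneg _),
    ENNReal.ofReal_sum_of_nonneg (fun i _ => sq_nonneg _)]

/-- The second moment of a series in an orthonormal sequence whose coefficients are independent of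
that sequence. -/
theorem lintegral_sq_add_tsum_mul_le {Ω Y ι : Type*} [MeasurableSpace Ω] [MeasurableSpace Y]
    [Countable ι] [DecidableEq ι] {P : Measure Ω} [IsProbabilityMeasure P] {Z : Ω → Y}
    {s : ι → Ω → ℝ} (hZ : Measurable Z) (hs : ∀ i, Measurable (s i))
    (hind : IndepFun Z (fun ω i => s i ω) P) (hs2 : ∀ i, MemLp (s i) 2 P)
    (hs0 : ∀ i, ∫ ω, s i ω ∂P = 0)
    (hss : ∀ i j, ∫ ω, s i ω * s j ω ∂P = if i = j then 1 else 0)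
    {b : Y → ℝ} {A : ι → Y → ℝ} {H : Y → ℝ≥0∞} (hb : Measurable b) (hA : ∀ i, Measurable (A i))
    (hH : Measurable H) (hsum : ∀ ω, Summable fun i => s i ω * A i (Z ω)) :
    ∫⁻ ω, ENNReal.ofReal ((b (Z ω) + ∑' i, s i ω * A i (Z ω)) ^ 2) * H (Z ω) ∂P ≤
      ∫⁻ ω, (ENNReal.ofReal (b (Z ω) ^ 2) + ∑' i, ENNReal.ofReal (A i (Z ω) ^ 2)) * H (Z ω) ∂P := by
  obtain ⟨F, hF⟩ := exists_seq_tendsto (atTop : Filter (Finset ι))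
  have hSm : Measurable fun ω i => s i ω := measurable_pi_lambda _ hs
  have hpair : P.map (fun ω => (Z ω, fun i => s i ω)) =
      (P.map Z).prod (P.map fun ω i => s i ω) :=
    (indepFun_iff_map_prod_eq_prod_map_map hZ.aemeasurable hSm.aemeasurable).1 hind
  have : IsProbabilityMeasure (P.map fun ω i => s i ω) :=
    Measure.isProbabilityMeasure_map hSm.aemeasurable
  have hmF : ∀ n, Measurable fun p : Y × (ι → ℝ) =>
      ENNReal.ofReal ((b p.1 + ∑ i ∈ F n, p.2 i * A i p.1) ^ 2) * H p.1 := by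
    intro n
    refine Measurable.mul (Measurable.ennreal_ofReal (Measurable.pow_const ?_ 2))
      (hH.comp measurable_fst)
    refine (hb.comp measurable_fst).add (Finset.measurable_fun_sum _ fun i _ => ?_)
    exact ((measurable_pi_apply i).comp measurable_snd).mul ((hA i).comp measurable_fst)
  have hfinite : ∀ n, ∫⁻ ω, ENNReal.ofReal ((b (Z ω) + ∑ i ∈ F n, s i ω * A i (Z ω)) ^ 2) *
      H (Z ω) ∂P =
      ∫⁻ ω, (ENNReal.ofReal (b (Z ω) ^ 2) + ∑ i ∈ F n, ENNReal.ofReal (A i (Z ω) ^ 2)) *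
        H (Z ω) ∂P := by
    intro n
    have h1 := lintegral_map (μ := P) (hmF n) (hZ.prodMk hSm)
    -- Independence allows `Z` to be frozen: the coefficients become constants, and only the
    -- orthonormal sequence is integrated.
    rw [← h1, hpair, lintegral_prod _ (hmF n).aemeasurable]
    have h2 : ∀ z, ∫⁻ t, ENNReal.ofReal ((b z + ∑ i ∈ F n, t i * A i z) ^ 2) * H z
        ∂(P.map fun ω i => s i ω) =
        (ENNReal.ofReal (b z ^ 2) + ∑ i ∈ F n, ENNReal.ofReal (A i z ^ 2)) * H z := by
      intro z
      have hm : Measurable fun t : ι → ℝ => ENNReal.ofReal ((b z + ∑ i ∈ F n, t i * A i z) ^ 2) := by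
        refine Measurable.ennreal_ofReal (Measurable.pow_const ?_ 2)
        exact measurable_const.add
          (Finset.measurable_fun_sum _ fun i _ => (measurable_pi_apply i).mul_const _)
      rw [lintegral_mul_const _ hm, lintegral_map hm hSm,
        lintegral_sq_add_sum_mul hs2 hs0 hss]
    simp only [h2]
    rw [lintegral_map _ hZ]
    refine Measurable.mul (Measurable.add (hb.pow_const 2).ennreal_ofReal ?_) hH
    exact Finset.measurable_fun_sum _ fun i _ => ((hA i).pow_const 2).ennreal_ofReal
  calc ∫⁻ ω, ENNReal.ofReal ((b (Z ω) + ∑' i, s i ω * A i (Z ω)) ^ 2) * H (Z ω) ∂P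
      ≤ ∫⁻ ω, liminf (fun n => ENNReal.ofReal
          ((b (Z ω) + ∑ i ∈ F n, s i ω * A i (Z ω)) ^ 2) * H (Z ω)) atTop ∂P := by
        refine lintegral_mono fun ω => ?_
        have h1 : Tendsto (fun n => ENNReal.ofReal
            ((b (Z ω) + ∑ i ∈ F n, s i ω * A i (Z ω)) ^ 2)) atTop
            (𝓝 (ENNReal.ofReal ((b (Z ω) + ∑' i, s i ω * A i (Z ω)) ^ 2))) :=
          ENNReal.tendsto_ofReal ((tendsto_const_nhds.add ((hsum ω).hasSum.comp hF)).pow 2)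
        -- Multiplication by `H` may fail to be continuous only for limit 0 and factor ∞, and then
        -- the left-hand side is 0.
        by_cases h0 : ENNReal.ofReal ((b (Z ω) + ∑' i, s i ω * A i (Z ω)) ^ 2) = 0
        · simp [h0]
        · exact (ENNReal.Tendsto.mul_const h1 (Or.inl h0)).liminf_eq.ge
    _ ≤ liminf (fun n => ∫⁻ ω, ENNReal.ofReal
          ((b (Z ω) + ∑ i ∈ F n, s i ω * A i (Z ω)) ^ 2) * H (Z ω) ∂P) atTop :=
        lintegral_liminf_le fun n => (hmF n).comp (hZ.prodMk hSm)
    _ ≤ ∫⁻ ω, (ENNReal.ofReal (b (Z ω) ^ 2) + ∑' i, ENNReal.ofReal (A i (Z ω) ^ 2)) *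
          H (Z ω) ∂P := by
        refine liminf_le_of_le (by isBoundedDefault) fun B hB => ?_
        obtain ⟨n, hn⟩ := hB.exists
        refine hn.trans ?_
        rw [hfinite]
        refine lintegral_mono fun ω => ?_
        gcongr
        exact ENNReal.sum_le_tsum _

/-! ### Rotation of the noise coordinates -/

/-- The coefficients of a pair of sequences in the frame rotated by the angles `2πkθ`. -/
def rotCos (θ : ℝ) (x y : ℕ+ → ℝ) (k : ℕ+) : ℝ :=
  Real.cos (2 * Real.pi * (k : ℕ) * θ) * x k + Real.sin (2 * Real.pi * (k : ℕ) * θ) * y k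

/-- The orthogonal component of the rotated pair of sequences. -/
def rotSin (θ : ℝ) (x y : ℕ+ → ℝ) (k : ℕ+) : ℝ :=
  -Real.sin (2 * Real.pi * (k : ℕ) * θ) * x k + Real.cos (2 * Real.pi * (k : ℕ) * θ) * y k

namespace IsWhiteNoise

variable {Ω : Type*} [MeasurableSpace Ω] {P : Measure Ω} {N : TestFun → Ω → ℝ}

theorem covariance_rotation (hN : IsWhiteNoise N P) [IsProbabilityMeasure P]
    (a b a' b' : ℝ) (φ ψ φ' ψ' : TestFun) :
    cov[fun ω => a * N φ ω + b * N ψ ω, fun ω => a' * N φ' ω + b' * N ψ' ω; P] =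
      a * a' * inner ℝ φ φ' + a * b' * inner ℝ φ ψ' + b * a' * inner ℝ ψ φ' +
        b * b' * inner ℝ ψ ψ' := by
  have h := fun χ => hN.memLp_two χ
  change cov[(fun ω => a * N φ ω) + fun ω => b * N ψ ω,
    (fun ω => a' * N φ' ω) + fun ω => b' * N ψ' ω; P] = _
  rw [covariance_add_left ((h _).const_mul _) ((h _).const_mul _)
    (((h _).const_mul _).add ((h _).const_mul _)),
    covariance_add_right ((h _).const_mul _) ((h _).const_mul _) ((h _).const_mul _),
    covariance_add_right ((h _).const_mul _) ((h _).const_mul _) ((h _).const_mul _)]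
  simp only [covariance_const_mul_left, covariance_const_mul_right, hN.covariance]
  ring

variable {e d : ℕ+ → TestFun}

/-- A rotation of each pair preserves orthonormality, so the two rotated sequences are uncorrelated
and, being jointly Gaussian, independent. Conditionally on `rotCos`, the score is then a linear form
in orthonormal variables. -/
theorem indepFun_rotation (hN : IsWhiteNoise N P) [IsProbabilityMeasure P]
    (hee : ∀ j k, inner ℝ (e j) (e k) = if j = k then (1 : ℝ) else 0)
    (hdd : ∀ j k, inner ℝ (d j) (d k) = if j = k then (1 : ℝ) else 0)
    (hed : ∀ j k, inner ℝ (e j) (d k) = (0 : ℝ))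
    (θ : ℝ) :
    IndepFun (fun ω => rotCos θ (fun k => N (e k) ω) (fun k => N (d k) ω))
      (fun ω => rotSin θ (fun k => N (e k) ω) (fun k => N (d k) ω)) P := by
  have hm := hN.measurable
  refine IsGaussianProcess.indepFun_of_covariance_eq_zero
    (X := fun k ω => rotCos θ (fun k => N (e k) ω) (fun k => N (d k) ω) k)
    (Y := fun k ω => rotSin θ (fun k => N (e k) ω) (fun k => N (d k) ω) k) ?_
    (fun k => (((hm _).const_mul _).add ((hm _).const_mul _)).aemeasurable)
    (fun k => (((hm _).const_mul _).add ((hm _).const_mul _)).aemeasurable) ?_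
  · classical
    refine hN.gaussian.of_isGaussianProcess fun i => ?_
    rcases i with k | k
    · exact ⟨{e k, d k}, Real.cos (2 * Real.pi * (k : ℕ) * θ) •
        ContinuousLinearMap.proj ⟨e k, by simp⟩ + Real.sin (2 * Real.pi * (k : ℕ) * θ) •
        ContinuousLinearMap.proj ⟨d k, by simp⟩, fun ω => by simp [rotCos]⟩
    · exact ⟨{e k, d k}, (-Real.sin (2 * Real.pi * (k : ℕ) * θ)) •
        ContinuousLinearMap.proj ⟨e k, by simp⟩ + Real.cos (2 * Real.pi * (k : ℕ) * θ) •
        ContinuousLinearMap.proj ⟨d k, by simp⟩, fun ω => by simp [rotSin]⟩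
  · intro j k
    unfold rotCos rotSin
    rw [hN.covariance_rotation, hee, hdd, hed, real_inner_comm, hed]
    split_ifs with h
    · subst h
      ring
    · ring

theorem integral_rotSin_mul (hN : IsWhiteNoise N P) [IsProbabilityMeasure P]
    (hee : ∀ j k, inner ℝ (e j) (e k) = if j = k then (1 : ℝ) else 0)
    (hdd : ∀ j k, inner ℝ (d j) (d k) = if j = k then (1 : ℝ) else 0)
    (hed : ∀ j k, inner ℝ (e j) (d k) = (0 : ℝ))
    (θ : ℝ) (j k : ℕ+) :
    ∫ ω, rotSin θ (fun k => N (e k) ω) (fun k => N (d k) ω) j *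
      rotSin θ (fun k => N (e k) ω) (fun k => N (d k) ω) k ∂P = if j = k then 1 else 0 := by
  have h := fun χ => hN.memLp_two χ
  have h1 : ∀ k, MemLp (fun ω => rotSin θ (fun k => N (e k) ω) (fun k => N (d k) ω) k) 2 P :=
    fun k => ((h _).const_mul _).add ((h _).const_mul _)
  have h0 : ∀ k, ∫ ω, rotSin θ (fun k => N (e k) ω) (fun k => N (d k) ω) k ∂P = 0 := by
    intro k
    unfold rotSin
    rw [integral_add (((h _).const_mul _).integrable (by norm_num))
      (((h _).const_mul _).integrable (by norm_num)), integral_const_mul, integral_const_mul,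
      hN.mean_zero, hN.mean_zero]
    simp
  have h2 := covariance_eq_sub (h1 j) (h1 k)
  rw [h0, h0, zero_mul, sub_zero] at h2
  change ∫ ω, ((fun ω => rotSin θ (fun k => N (e k) ω) (fun k => N (d k) ω) j) *
      (fun ω => rotSin θ (fun k => N (e k) ω) (fun k => N (d k) ω) k)) ω ∂P = _
  rw [← h2]
  unfold rotSin
  rw [hN.covariance_rotation, hee, hdd, hed, real_inner_comm, hed]
  split_ifs with hjk
  · subst hjk
    nlinarith [Real.sin_sq_add_cos_sq (2 * Real.pi * (j : ℕ) * θ)]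
  · ring

theorem integral_rotSin (hN : IsWhiteNoise N P) [IsProbabilityMeasure P] (θ : ℝ) (k : ℕ+) :
    ∫ ω, rotSin θ (fun k => N (e k) ω) (fun k => N (d k) ω) k ∂P = 0 := by
  have h := fun χ => hN.memLp_two χ
  unfold rotSin
  rw [integral_add (((h _).const_mul _).integrable (by norm_num))
    (((h _).const_mul _).integrable (by norm_num)), integral_const_mul, integral_const_mul,
    hN.mean_zero, hN.mean_zero]
  simp

end IsWhiteNoise

/-! ### Mixed likelihood and posterior moments -/

/-- The likelihood ratio of the signal with coefficients `c`, observed at noise level `ε` through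
the sequence `c k + ε y k`, with respect to pure noise. -/
def likelihood (ε : ℝ) (c y : ℕ+ → ℝ) : ℝ :=
  Real.exp (ε⁻¹ * ∑' k, c k * y k - (∑' k, c k ^ 2) / (2 * ε ^ 2))

/-- The squared norm of the derivative of the signal with coefficients `c`. -/
def derivSq (c : ℕ+ → ℝ) : ℝ := ∑' k : ℕ+, (2 * Real.pi * (k : ℕ)) ^ 2 * c k ^ 2

/-- A measurable family of coefficient sequences with a common summable bound. -/
structure BoundedFamily {V : Type*} [MeasurableSpace V] (c : V → ℕ+ → ℝ) (C : ℕ+ → ℝ) : Prop where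
  measurable : ∀ k, Measurable fun v => c v k
  nonneg : ∀ k, 0 ≤ C k
  le : ∀ v k, |c v k| ≤ C k
  summable : Summable fun k : ℕ+ => (k : ℝ) * C k

section Mixture

variable {V : Type*} [MeasurableSpace V] (μ : Measure V) (c : V → ℕ+ → ℝ) (ε : ℝ)

/-- The likelihood mixed over the random signal `c`. -/
def mixLik (y : ℕ+ → ℝ) : ℝ := ∫ v, likelihood ε (c v) y ∂μ

/-- The unnormalized posterior mean of the `k`-th coefficient. -/
def mixCoef (k : ℕ+) (y : ℕ+ → ℝ) : ℝ := ∫ v, c v k * likelihood ε (c v) y ∂μ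

/-- The unnormalized posterior mean of the squared norm of the derivative. -/
def mixInfo (y : ℕ+ → ℝ) : ℝ := ∫ v, derivSq (c v) * likelihood ε (c v) y ∂μ

/-- The unnormalized posterior variance of the `k`-th coefficient. -/
def mixVar (k : ℕ+) (y : ℕ+ → ℝ) : ℝ :=
  ∫ v, (c v k - mixCoef μ c ε k y / mixLik μ c ε y) ^ 2 * likelihood ε (c v) y ∂μ

end Mixture

theorem likelihood_pos (ε : ℝ) (c y : ℕ+ → ℝ) : 0 < likelihood ε c y := Real.exp_pos _

theorem derivSq_nonneg (c : ℕ+ → ℝ) : 0 ≤ derivSq c := tsum_nonneg fun k => by positivity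

theorem one_le_pnat_cast (k : ℕ+) : (1 : ℝ) ≤ (k : ℝ) := by exact_mod_cast k.pos

theorem summable_sq_of_summable {ι : Type*} {a : ι → ℝ} (h0 : ∀ i, 0 ≤ a i) (ha : Summable a) :
    Summable fun i => a i ^ 2 := by
  refine Summable.of_nonneg_of_le (fun i => sq_nonneg _) (fun i => ?_) (ha.mul_left (∑' i, a i))
  rw [sq]
  exact mul_le_mul_of_nonneg_right (ha.le_tsum i fun j _ => h0 j) (h0 i)

namespace BoundedFamily

variable {V : Type*} [MeasurableSpace V] {μ : Measure V} {c : V → ℕ+ → ℝ} {C : ℕ+ → ℝ} {ε : ℝ}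
  {y : ℕ+ → ℝ}

theorem summable_deriv_bound (h : BoundedFamily c C) :
    Summable fun k : ℕ+ => (2 * Real.pi * (k : ℕ)) ^ 2 * C k ^ 2 := by
  have := (summable_sq_of_summable (fun k : ℕ+ => mul_nonneg (by positivity) (h.nonneg k))
    h.summable).mul_left ((2 * Real.pi) ^ 2)
  refine this.congr fun k => ?_
  ring

theorem summable_deriv (h : BoundedFamily c C) (v : V) :
    Summable fun k : ℕ+ => (2 * Real.pi * (k : ℕ)) ^ 2 * c v k ^ 2 :=
  Summable.of_nonneg_of_le (fun k => by positivity)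
    (fun k => mul_le_mul_of_nonneg_left
      (by rw [← sq_abs]; exact pow_le_pow_left₀ (abs_nonneg _) (h.le v k) 2) (by positivity))
    h.summable_deriv_bound

theorem derivSq_le (h : BoundedFamily c C) (v : V) : derivSq (c v) ≤ derivSq C :=
  Summable.tsum_le_tsum (fun k => mul_le_mul_of_nonneg_left
      (by rw [← sq_abs]; exact pow_le_pow_left₀ (abs_nonneg _) (h.le v k) 2) (by positivity))
    (h.summable_deriv v) h.summable_deriv_bound

theorem measurable_derivSq (h : BoundedFamily c C) : Measurable fun v => derivSq (c v) :=
  Measurable.tsum fun k => ((h.measurable k).pow_const 2).const_mul _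

theorem measurable_likelihood (h : BoundedFamily c C) :
    Measurable fun p : (ℕ+ → ℝ) × V => likelihood ε (c p.2) p.1 := by
  refine Real.measurable_exp.comp ((Measurable.const_mul ?_ _).sub (Measurable.div_const ?_ _))
  · exact Measurable.tsum fun k => ((h.measurable k).comp measurable_snd).mul
      ((measurable_pi_apply k).comp measurable_fst)
  · exact Measurable.tsum fun k => ((h.measurable k).comp measurable_snd).pow_const 2

theorem measurable_likelihood_right (h : BoundedFamily c C) (y : ℕ+ → ℝ) :
    Measurable fun v => likelihood ε (c v) y :=
  (h.measurable_likelihood (ε := ε)).comp (measurable_const.prodMk measurable_id)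

/-- Discarding the quadratic term leaves a bound uniform in `v`, the source of all integrability
over the prior. -/
theorem likelihood_le (h : BoundedFamily c C) (hy : Summable fun k => C k * |y k|) (v : V) :
    likelihood ε (c v) y ≤ Real.exp (|ε⁻¹| * ∑' k, C k * |y k|) := by
  refine Real.exp_le_exp.2 ?_
  have h1 : |∑' k, c v k * y k| ≤ ∑' k, C k * |y k| := by
    rw [← Real.norm_eq_abs]
    refine tsum_of_norm_bounded hy.hasSum fun k => ?_
    rw [Real.norm_eq_abs, abs_mul]
    exact mul_le_mul_of_nonneg_right (h.le v k) (abs_nonneg _)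
  have h2 : 0 ≤ (∑' k, c v k ^ 2) / (2 * ε ^ 2) :=
    div_nonneg (tsum_nonneg fun k => sq_nonneg _) (by positivity)
  have h3 : ε⁻¹ * ∑' k, c v k * y k ≤ |ε⁻¹| * ∑' k, C k * |y k| :=
    (le_abs_self _).trans (by rw [abs_mul]; exact mul_le_mul_of_nonneg_left h1 (abs_nonneg _))
  linarith

theorem integrable_mul_likelihood [IsFiniteMeasure μ] (h : BoundedFamily c C)
    (hy : Summable fun k => C k * |y k|) {g : V → ℝ} (hg : Measurable g) {B : ℝ}
    (hB : ∀ v, |g v| ≤ B) : Integrable (fun v => g v * likelihood ε (c v) y) μ := by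
  refine Integrable.of_bound (hg.mul (h.measurable_likelihood_right y)).aestronglyMeasurable
    (B * Real.exp (|ε⁻¹| * ∑' k, C k * |y k|)) (ae_of_all _ fun v => ?_)
  rw [Real.norm_eq_abs, abs_mul, abs_of_pos (likelihood_pos _ _ _)]
  exact mul_le_mul (hB v) (h.likelihood_le hy v) (likelihood_pos _ _ _).le
    ((abs_nonneg _).trans (hB v))

theorem integrable_likelihood [IsFiniteMeasure μ] (h : BoundedFamily c C)
    (hy : Summable fun k => C k * |y k|) : Integrable (fun v => likelihood ε (c v) y) μ := by
  have := h.integrable_mul_likelihood (μ := μ) (ε := ε) hy (g := fun _ => 1) measurable_const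
    (B := 1) (fun v => by simp)
  simpa using this

theorem mixLik_pos [IsProbabilityMeasure μ] (h : BoundedFamily c C)
    (hy : Summable fun k => C k * |y k|) : 0 < mixLik μ c ε y := by
  rw [mixLik, integral_pos_iff_support_of_nonneg (fun v => (likelihood_pos _ _ _).le)
    (h.integrable_likelihood hy)]
  have : Function.support (fun v => likelihood ε (c v) y) = univ := by
    ext v
    simp [(likelihood_pos ε (c v) y).ne']
  rw [this]
  simp

theorem integrable_derivSq [IsFiniteMeasure μ] (h : BoundedFamily c C)
    (hy : Summable fun k => C k * |y k|) :
    Integrable (fun v => derivSq (c v) * likelihood ε (c v) y) μ :=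
  h.integrable_mul_likelihood hy h.measurable_derivSq (B := derivSq C) fun v => by
    rw [abs_of_nonneg (derivSq_nonneg _)]
    exact h.derivSq_le v

theorem mixInfo_le [IsFiniteMeasure μ] (h : BoundedFamily c C)
    (hy : Summable fun k => C k * |y k|) {B : ℝ} (hB : ∀ v, derivSq (c v) ≤ B) :
    mixInfo μ c ε y ≤ B * mixLik μ c ε y := by
  rw [mixInfo, mixLik, ← integral_const_mul]
  exact integral_mono (h.integrable_derivSq hy) ((h.integrable_likelihood hy).const_mul _)
    fun v => mul_le_mul_of_nonneg_right (hB v) (likelihood_pos _ _ _).le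

theorem le_mixInfo [IsFiniteMeasure μ] (h : BoundedFamily c C)
    (hy : Summable fun k => C k * |y k|) {B : ℝ} (hB : ∀ v, B ≤ derivSq (c v)) :
    B * mixLik μ c ε y ≤ mixInfo μ c ε y := by
  rw [mixInfo, mixLik, ← integral_const_mul]
  exact integral_mono ((h.integrable_likelihood hy).const_mul _) (h.integrable_derivSq hy)
    fun v => mul_le_mul_of_nonneg_right (hB v) (likelihood_pos _ _ _).le

theorem measurable_mixLik [SFinite μ] (h : BoundedFamily c C) : Measurable (mixLik μ c ε) :=
  (h.measurable_likelihood.stronglyMeasurable.integral_prod_right (ν := μ)).measurable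

theorem measurable_mixCoef [SFinite μ] (h : BoundedFamily c C) (k : ℕ+) :
    Measurable (mixCoef μ c ε k) := by
  have : Measurable fun p : (ℕ+ → ℝ) × V => c p.2 k * likelihood ε (c p.2) p.1 :=
    ((h.measurable k).comp measurable_snd).mul h.measurable_likelihood
  exact (this.stronglyMeasurable.integral_prod_right (ν := μ)).measurable

theorem measurable_mixInfo [SFinite μ] (h : BoundedFamily c C) : Measurable (mixInfo μ c ε) := by
  have : Measurable fun p : (ℕ+ → ℝ) × V => derivSq (c p.2) * likelihood ε (c p.2) p.1 :=
    (h.measurable_derivSq.comp measurable_snd).mul h.measurable_likelihood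
  exact (this.stronglyMeasurable.integral_prod_right (ν := μ)).measurable

theorem measurable_mixVar [SFinite μ] (h : BoundedFamily c C) (k : ℕ+) :
    Measurable (mixVar μ c ε k) := by
  have : Measurable fun p : (ℕ+ → ℝ) × V => (c p.2 k - mixCoef μ c ε k p.1 / mixLik μ c ε p.1) ^ 2 *
      likelihood ε (c p.2) p.1 := by
    refine Measurable.mul (Measurable.pow_const (((h.measurable k).comp measurable_snd).sub ?_) 2)
      h.measurable_likelihood
    exact ((h.measurable_mixCoef k).div h.measurable_mixLik).comp measurable_fst
  exact (this.stronglyMeasurable.integral_prod_right (ν := μ)).measurable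

theorem integrable_coef [IsFiniteMeasure μ] (h : BoundedFamily c C)
    (hy : Summable fun k => C k * |y k|) (k : ℕ+) :
    Integrable (fun v => c v k * likelihood ε (c v) y) μ :=
  h.integrable_mul_likelihood hy (h.measurable k) (B := C k) (h.le · k)

theorem abs_mixCoef_le [IsFiniteMeasure μ] (h : BoundedFamily c C)
    (hy : Summable fun k => C k * |y k|) (k : ℕ+) :
    |mixCoef μ c ε k y| ≤ C k * mixLik μ c ε y := by
  rw [mixCoef, mixLik, ← integral_const_mul]
  refine (abs_integral_le_integral_abs).trans ?_
  refine integral_mono (h.integrable_coef hy k).abs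
    ((h.integrable_likelihood hy).const_mul _) fun v => ?_
  simp only [abs_mul, abs_of_pos (likelihood_pos _ _ _)]
  exact mul_le_mul_of_nonneg_right (h.le v k) (likelihood_pos _ _ _).le

theorem mixVar_nonneg (k : ℕ+) : 0 ≤ mixVar μ c ε k y :=
  integral_nonneg fun _ => mul_nonneg (sq_nonneg _) (likelihood_pos _ _ _).le

/-- This is the decomposition of a second moment into squared mean and variance. The moments are
unnormalized, whence the division by the mixed likelihood. -/
theorem integral_sq_coef [IsProbabilityMeasure μ] (h : BoundedFamily c C)
    (hy : Summable fun k => C k * |y k|) (k : ℕ+) :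
    ∫ v, c v k ^ 2 * likelihood ε (c v) y ∂μ =
      mixCoef μ c ε k y ^ 2 / mixLik μ c ε y + mixVar μ c ε k y := by
  have hq := h.mixLik_pos (μ := μ) (ε := ε) hy
  set m := mixCoef μ c ε k y / mixLik μ c ε y with hm
  have i2 : Integrable (fun v => c v k ^ 2 * likelihood ε (c v) y) μ :=
    h.integrable_mul_likelihood hy ((h.measurable k).pow_const 2) (B := C k ^ 2) (fun v => by
      rw [abs_pow]
      exact pow_le_pow_left₀ (abs_nonneg _) (h.le v k) 2)
  have i1 := h.integrable_coef (μ := μ) (ε := ε) hy k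
  have i0 := h.integrable_likelihood (μ := μ) (ε := ε) hy
  have hvar : mixVar μ c ε k y = ∫ v, c v k ^ 2 * likelihood ε (c v) y ∂μ -
      2 * m * mixCoef μ c ε k y + m ^ 2 * mixLik μ c ε y := by
    calc mixVar μ c ε k y
        = ∫ v, (c v k ^ 2 * likelihood ε (c v) y - 2 * m * (c v k * likelihood ε (c v) y) +
            m ^ 2 * likelihood ε (c v) y) ∂μ :=
          integral_congr_ae (ae_of_all _ fun v => by simp only [← hm]; ring)
      _ = ∫ v, (c v k ^ 2 * likelihood ε (c v) y - 2 * m * (c v k * likelihood ε (c v) y)) ∂μ +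
            ∫ v, m ^ 2 * likelihood ε (c v) y ∂μ :=
          integral_add (i2.sub (i1.const_mul _)) (i0.const_mul _)
      _ = _ := by
          rw [integral_sub i2 (i1.const_mul _), integral_const_mul, integral_const_mul, mixCoef,
            mixLik]
  rw [hvar, hm]
  field_simp
  ring

/-- The origin of the second-order term: the squared posterior means, which make up the score, fall
short of the posterior mean of ‖f'‖² by at least the posterior variance. -/
theorem sum_sq_mixCoef_add_le [IsProbabilityMeasure μ] (h : BoundedFamily c C)
    (hy : Summable fun k => C k * |y k|) (F K : Finset ℕ+) :
    ∑ k ∈ F, (2 * Real.pi * (k : ℕ)) ^ 2 * (mixCoef μ c ε k y ^ 2 / mixLik μ c ε y) +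
      ∑ k ∈ K, (2 * Real.pi * (k : ℕ)) ^ 2 * mixVar μ c ε k y ≤ mixInfo μ c ε y := by
  classical
  have hq := h.mixLik_pos (μ := μ) (ε := ε) hy
  have i2 : ∀ k, Integrable (fun v => c v k ^ 2 * likelihood ε (c v) y) μ := fun k =>
    h.integrable_mul_likelihood hy ((h.measurable k).pow_const 2) (B := C k ^ 2) (fun v => by
      rw [abs_pow]
      exact pow_le_pow_left₀ (abs_nonneg _) (h.le v k) 2)
  -- `F` is an arbitrary partial sum of the score, while `K` carries the prior. Over the union both
  -- parts of the decomposition are present and nonnegative, so each sum may be cut back to its own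
  -- set.
  have h1 : ∑ k ∈ F ∪ K, (2 * Real.pi * (k : ℕ)) ^ 2 *
      ∫ v, c v k ^ 2 * likelihood ε (c v) y ∂μ ≤ mixInfo μ c ε y := by
    simp_rw [← integral_const_mul]
    rw [← integral_finsetSum _ fun k _ => (i2 k).const_mul _, mixInfo]
    refine integral_mono (integrable_finsetSum _ fun k _ => (i2 k).const_mul _)
      (h.integrable_derivSq hy) fun v => ?_
    simp_rw [← mul_assoc]
    rw [← Finset.sum_mul]
    refine mul_le_mul_of_nonneg_right ?_ (likelihood_pos _ _ _).le
    exact (h.summable_deriv v).sum_le_tsum _ fun k _ => by positivity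
  refine le_trans ?_ h1
  simp_rw [h.integral_sq_coef hy, mul_add]
  rw [Finset.sum_add_distrib]
  refine add_le_add (Finset.sum_le_sum_of_subset_of_nonneg Finset.subset_union_left ?_)
    (Finset.sum_le_sum_of_subset_of_nonneg Finset.subset_union_right ?_)
  · intro k _ _
    have := hq.le
    positivity
  · intro k _ _
    exact mul_nonneg (by positivity) (mixVar_nonneg k)

end BoundedFamily

/-! ### Differentiation in the shift parameter -/

theorem hasDerivAt_rotCos (θ : ℝ) (x y : ℕ+ → ℝ) (k : ℕ+) :
    HasDerivAt (fun t => rotCos t x y k) (2 * Real.pi * (k : ℕ) * rotSin θ x y k) θ := by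
  have h0 : HasDerivAt (fun t : ℝ => 2 * Real.pi * (k : ℕ) * t) (2 * Real.pi * (k : ℕ)) θ := by
    simpa using (hasDerivAt_id θ).const_mul (2 * Real.pi * ((k : ℕ) : ℝ))
  have := (h0.cos.mul_const (x k)).add (h0.sin.mul_const (y k))
  refine this.congr_deriv ?_
  rw [rotSin]
  ring

theorem abs_rotCos_le (θ : ℝ) (x y : ℕ+ → ℝ) (k : ℕ+) : |rotCos θ x y k| ≤ |x k| + |y k| := by
  refine (abs_add_le _ _).trans ?_
  rw [abs_mul, abs_mul]
  exact add_le_add (mul_le_of_le_one_left (abs_nonneg _) (Real.abs_cos_le_one _))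
    (mul_le_of_le_one_left (abs_nonneg _) (Real.abs_sin_le_one _))

theorem abs_rotSin_le (θ : ℝ) (x y : ℕ+ → ℝ) (k : ℕ+) : |rotSin θ x y k| ≤ |x k| + |y k| := by
  refine (abs_add_le _ _).trans ?_
  rw [abs_mul, abs_mul, abs_neg]
  exact add_le_add (mul_le_of_le_one_left (abs_nonneg _) (Real.abs_sin_le_one _))
    (mul_le_of_le_one_left (abs_nonneg _) (Real.abs_cos_le_one _))

theorem measurable_rotCos {Ω : Type*} [MeasurableSpace Ω] {x y : Ω → ℕ+ → ℝ} (hx : Measurable x)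
    (hy : Measurable y) : Measurable fun p : ℝ × Ω => rotCos p.1 (x p.2) (y p.2) := by
  refine measurable_pi_lambda _ fun k => ?_
  have h1 : Measurable fun p : ℝ × Ω => x p.2 k := (measurable_pi_apply k).comp (hx.comp measurable_snd)
  have h2 : Measurable fun p : ℝ × Ω => y p.2 k := (measurable_pi_apply k).comp (hy.comp measurable_snd)
  unfold rotCos
  fun_prop

theorem measurable_rotSin {Ω : Type*} [MeasurableSpace Ω] {x y : Ω → ℕ+ → ℝ} (hx : Measurable x)
    (hy : Measurable y) : Measurable fun p : ℝ × Ω => rotSin p.1 (x p.2) (y p.2) := by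
  refine measurable_pi_lambda _ fun k => ?_
  have h1 : Measurable fun p : ℝ × Ω => x p.2 k := (measurable_pi_apply k).comp (hx.comp measurable_snd)
  have h2 : Measurable fun p : ℝ × Ω => y p.2 k := (measurable_pi_apply k).comp (hy.comp measurable_snd)
  unfold rotSin
  fun_prop

/-- The derivative with respect to `θ` of the mixed likelihood of the rotated observation. -/
def mixDeriv {V : Type*} [MeasurableSpace V] (μ : Measure V) (c : V → ℕ+ → ℝ) (ε θ : ℝ)
    (x y : ℕ+ → ℝ) : ℝ :=
  ∑' k : ℕ+, rotSin θ x y k *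
    (ε⁻¹ * (2 * Real.pi * (k : ℕ)) * mixCoef μ c ε k (rotCos θ x y))

namespace BoundedFamily

variable {V : Type*} [MeasurableSpace V] {μ : Measure V} {c : V → ℕ+ → ℝ} {C : ℕ+ → ℝ} {ε : ℝ}
  {x y : ℕ+ → ℝ}

theorem summable_rotCos (h : BoundedFamily c C)
    (hxy : Summable fun k : ℕ+ => (k : ℝ) * C k * (|x k| + |y k|)) (θ : ℝ) :
    Summable fun k => C k * |rotCos θ x y k| := by
  refine Summable.of_nonneg_of_le (fun k => mul_nonneg (h.nonneg k) (abs_nonneg _)) (fun k => ?_) hxy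
  have h1 := one_le_pnat_cast k
  have h2 := h.nonneg k
  exact mul_le_mul (le_mul_of_one_le_left h2 h1) (abs_rotCos_le θ x y k) (abs_nonneg _)
    (by positivity)

theorem tsum_rotCos_le (h : BoundedFamily c C)
    (hxy : Summable fun k : ℕ+ => (k : ℝ) * C k * (|x k| + |y k|)) (θ : ℝ) :
    ∑' k, C k * |rotCos θ x y k| ≤ ∑' k : ℕ+, (k : ℝ) * C k * (|x k| + |y k|) := by
  refine Summable.tsum_le_tsum (fun k => ?_) (h.summable_rotCos hxy θ) hxy
  have h1 := one_le_pnat_cast k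
  have h2 := h.nonneg k
  exact mul_le_mul (le_mul_of_one_le_left h2 h1) (abs_rotCos_le θ x y k) (abs_nonneg _)
    (by positivity)

theorem likelihood_rotCos_le (h : BoundedFamily c C)
    (hxy : Summable fun k : ℕ+ => (k : ℝ) * C k * (|x k| + |y k|)) (θ : ℝ) (v : V) :
    likelihood ε (c v) (rotCos θ x y) ≤
      Real.exp (|ε⁻¹| * ∑' k : ℕ+, (k : ℝ) * C k * (|x k| + |y k|)) :=
  (h.likelihood_le (h.summable_rotCos hxy θ) v).trans
    (Real.exp_le_exp.2 (mul_le_mul_of_nonneg_left (h.tsum_rotCos_le hxy θ) (abs_nonneg _)))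

theorem mixLik_rotCos_le [IsProbabilityMeasure μ] (h : BoundedFamily c C)
    (hxy : Summable fun k : ℕ+ => (k : ℝ) * C k * (|x k| + |y k|)) (θ : ℝ) :
    mixLik μ c ε (rotCos θ x y) ≤
      Real.exp (|ε⁻¹| * ∑' k : ℕ+, (k : ℝ) * C k * (|x k| + |y k|)) := by
  have := integral_mono (h.integrable_likelihood (μ := μ) (ε := ε) (h.summable_rotCos hxy θ))
    (integrable_const _) (h.likelihood_rotCos_le hxy θ)
  simpa [mixLik] using this

theorem abs_deriv_term_le (h : BoundedFamily c C) (θ : ℝ) (v : V) (k : ℕ+) :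
    |c v k * (2 * Real.pi * (k : ℕ) * rotSin θ x y k)| ≤
      2 * Real.pi * ((k : ℝ) * C k * (|x k| + |y k|)) := by
  have h1 : |2 * Real.pi * ((k : ℕ) : ℝ)| = 2 * Real.pi * (k : ℕ) := abs_of_nonneg (by positivity)
  rw [abs_mul, abs_mul, h1]
  calc |c v k| * (2 * Real.pi * (k : ℕ) * |rotSin θ x y k|)
      ≤ C k * (2 * Real.pi * (k : ℕ) * (|x k| + |y k|)) := by
        have := h.nonneg k
        exact mul_le_mul (h.le v k) (mul_le_mul_of_nonneg_left (abs_rotSin_le θ x y k)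
          (by positivity)) (by positivity) this
    _ = _ := by ring

/-- Only the linear part of the exponent depends on the shift. Its terms have derivatives dominated
by k·C_k(|x_k| + |y_k|), which is why families are bounded with the weight k. -/
theorem hasDerivAt_likelihood (h : BoundedFamily c C)
    (hxy : Summable fun k : ℕ+ => (k : ℝ) * C k * (|x k| + |y k|)) (θ : ℝ) (v : V) :
    HasDerivAt (fun t => likelihood ε (c v) (rotCos t x y))
      ((ε⁻¹ * ∑' k : ℕ+, c v k * (2 * Real.pi * (k : ℕ) * rotSin θ x y k)) *
        likelihood ε (c v) (rotCos θ x y)) θ := by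
  have h1 : HasDerivAt (fun t => ∑' k, c v k * rotCos t x y k)
      (∑' k : ℕ+, c v k * (2 * Real.pi * (k : ℕ) * rotSin θ x y k)) θ := by
    refine hasDerivAt_tsum (u := fun k : ℕ+ => 2 * Real.pi * ((k : ℝ) * C k * (|x k| + |y k|)))
      (g := fun k t => c v k * rotCos t x y k)
      (g' := fun k t => c v k * (2 * Real.pi * (k : ℕ) * rotSin t x y k)) (y₀ := 0)
      (hxy.mul_left _) (fun k t => (hasDerivAt_rotCos t x y k).const_mul _)
      (fun k t => ?_) ?_ θ
    · rw [Real.norm_eq_abs]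
      exact h.abs_deriv_term_le t v k
    · refine Summable.of_norm_bounded (h.summable_rotCos hxy 0) fun k => ?_
      rw [Real.norm_eq_abs, abs_mul]
      exact mul_le_mul_of_nonneg_right (h.le v k) (abs_nonneg _)
  have := ((h1.const_mul ε⁻¹).sub_const ((∑' k, c v k ^ 2) / (2 * ε ^ 2))).exp
  refine this.congr_deriv ?_
  rw [likelihood]
  ring

/-- Differentiation under the integral gives the posterior average of a series linear in the
coefficients. Exchanging sum and integral replaces each coefficient by its unnormalized posterior
mean. -/
theorem hasDerivAt_mixLik [IsProbabilityMeasure μ] (h : BoundedFamily c C)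
    (hxy : Summable fun k : ℕ+ => (k : ℝ) * C k * (|x k| + |y k|)) (θ : ℝ) :
    HasDerivAt (fun t => mixLik μ c ε (rotCos t x y)) (mixDeriv μ c ε θ x y) θ := by
  set S := ∑' k : ℕ+, (k : ℝ) * C k * (|x k| + |y k|) with hS
  have hterm : ∀ t v, |∑' k : ℕ+, c v k * (2 * Real.pi * (k : ℕ) * rotSin t x y k)| ≤
      2 * Real.pi * S := by
    intro t v
    rw [← Real.norm_eq_abs, hS, ← tsum_mul_left]
    refine tsum_of_norm_bounded (hxy.mul_left (2 * Real.pi)).hasSum fun k => ?_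
    rw [Real.norm_eq_abs]
    exact h.abs_deriv_term_le t v k
  have hS0 : 0 ≤ S := tsum_nonneg fun k => by
    have := h.nonneg k
    positivity
  have hmeas : ∀ t, Measurable fun v =>
      (ε⁻¹ * ∑' k : ℕ+, c v k * (2 * Real.pi * (k : ℕ) * rotSin t x y k)) *
        likelihood ε (c v) (rotCos t x y) := fun t =>
    ((Measurable.tsum fun k => (h.measurable k).mul_const _).const_mul _).mul
      (h.measurable_likelihood_right _)
  have key := hasDerivAt_integral_of_dominated_loc_of_deriv_le (μ := μ) (s := univ) (x₀ := θ)
    (F := fun t v => likelihood ε (c v) (rotCos t x y))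
    (F' := fun t v => (ε⁻¹ * ∑' k : ℕ+, c v k * (2 * Real.pi * (k : ℕ) * rotSin t x y k)) *
        likelihood ε (c v) (rotCos t x y))
    (bound := fun _ => |ε⁻¹| * (2 * Real.pi * S) * Real.exp (|ε⁻¹| * S))
    univ_mem (Eventually.of_forall fun t => (h.measurable_likelihood_right _).aestronglyMeasurable)
    (h.integrable_likelihood (h.summable_rotCos hxy θ)) (hmeas θ).aestronglyMeasurable
    (ae_of_all _ fun v t _ => by
      rw [Real.norm_eq_abs, abs_mul, abs_mul, abs_of_pos (likelihood_pos _ _ _)]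
      exact mul_le_mul (mul_le_mul_of_nonneg_left (hterm t v) (abs_nonneg _))
        (h.likelihood_rotCos_le hxy t v) (likelihood_pos _ _ _).le (by positivity))
    (integrable_const _)
    (ae_of_all _ fun v t _ => h.hasDerivAt_likelihood hxy t v)
  refine key.2.congr_deriv ?_
  have hsum : ∀ v, (ε⁻¹ * ∑' k : ℕ+, c v k * (2 * Real.pi * (k : ℕ) * rotSin θ x y k)) *
        likelihood ε (c v) (rotCos θ x y) =
      ∑' k : ℕ+, (ε⁻¹ * (2 * Real.pi * (k : ℕ)) * rotSin θ x y k) *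
        (c v k * likelihood ε (c v) (rotCos θ x y)) := by
    intro v
    rw [← tsum_mul_left, ← tsum_mul_right]
    exact tsum_congr fun k => by ring
  have hi : ∀ k : ℕ+, Integrable (fun v => (ε⁻¹ * (2 * Real.pi * (k : ℕ)) * rotSin θ x y k) *
        (c v k * likelihood ε (c v) (rotCos θ x y))) μ := fun k =>
    (h.integrable_coef (h.summable_rotCos hxy θ) k).const_mul _
  simp_rw [hsum]
  rw [← integral_tsum_of_summable_integral_norm hi, mixDeriv]
  · refine tsum_congr fun k => ?_
    rw [integral_const_mul, mixCoef]
    ring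
  · refine Summable.of_nonneg_of_le (fun k => integral_nonneg fun v => norm_nonneg _) (fun k => ?_)
      (hxy.mul_left (|ε⁻¹| * (2 * Real.pi) * Real.exp (|ε⁻¹| * S)))
    have hb : ∀ v, ‖(ε⁻¹ * (2 * Real.pi * (k : ℕ)) * rotSin θ x y k) *
        (c v k * likelihood ε (c v) (rotCos θ x y))‖ ≤
        |ε⁻¹| * (2 * Real.pi) * Real.exp (|ε⁻¹| * S) * ((k : ℝ) * C k * (|x k| + |y k|)) := by
      intro v
      have e : (ε⁻¹ * (2 * Real.pi * (k : ℕ)) * rotSin θ x y k) *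
        (c v k * likelihood ε (c v) (rotCos θ x y)) = ε⁻¹ *
          (likelihood ε (c v) (rotCos θ x y) * (c v k * (2 * Real.pi * (k : ℕ) * rotSin θ x y k))) := by
        ring
      rw [Real.norm_eq_abs, e, abs_mul, abs_mul, abs_of_pos (likelihood_pos _ _ _)]
      calc |ε⁻¹| * (likelihood ε (c v) (rotCos θ x y) *
            |c v k * (2 * Real.pi * (k : ℕ) * rotSin θ x y k)|)
          ≤ |ε⁻¹| * (Real.exp (|ε⁻¹| * S) * (2 * Real.pi * ((k : ℝ) * C k * (|x k| + |y k|)))) := by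
            refine mul_le_mul_of_nonneg_left ?_ (abs_nonneg _)
            exact mul_le_mul (h.likelihood_rotCos_le hxy θ v) (h.abs_deriv_term_le θ v k)
              (abs_nonneg _) (Real.exp_pos _).le
        _ = _ := by ring
    have := integral_mono (hi k).norm (integrable_const _) hb
    simpa using this

theorem abs_mixDeriv_le [IsProbabilityMeasure μ] (h : BoundedFamily c C)
    (hxy : Summable fun k : ℕ+ => (k : ℝ) * C k * (|x k| + |y k|)) (θ : ℝ) :
    (Summable fun k : ℕ+ => rotSin θ x y k *
      (ε⁻¹ * (2 * Real.pi * (k : ℕ)) * mixCoef μ c ε k (rotCos θ x y))) ∧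
    |mixDeriv μ c ε θ x y| ≤ |ε⁻¹| * (2 * Real.pi) *
      Real.exp (|ε⁻¹| * ∑' k : ℕ+, (k : ℝ) * C k * (|x k| + |y k|)) *
        ∑' k : ℕ+, (k : ℝ) * C k * (|x k| + |y k|) := by
  set S := ∑' k : ℕ+, (k : ℝ) * C k * (|x k| + |y k|) with hS
  have hb : ∀ k : ℕ+, ‖rotSin θ x y k *
      (ε⁻¹ * (2 * Real.pi * (k : ℕ)) * mixCoef μ c ε k (rotCos θ x y))‖ ≤
      |ε⁻¹| * (2 * Real.pi) * Real.exp (|ε⁻¹| * S) * ((k : ℝ) * C k * (|x k| + |y k|)) := by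
    intro k
    have h1 := h.abs_mixCoef_le (μ := μ) (ε := ε) (h.summable_rotCos hxy θ) k
    have h2 := h.mixLik_rotCos_le (μ := μ) (ε := ε) hxy θ
    have h3 := h.nonneg k
    have h4 : |mixCoef μ c ε k (rotCos θ x y)| ≤ C k * Real.exp (|ε⁻¹| * S) :=
      h1.trans (mul_le_mul_of_nonneg_left h2 h3)
    have h5 : |2 * Real.pi * ((k : ℕ) : ℝ)| = 2 * Real.pi * (k : ℕ) :=
      abs_of_nonneg (by positivity)
    rw [Real.norm_eq_abs, abs_mul, abs_mul, abs_mul, h5]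
    calc |rotSin θ x y k| * (|ε⁻¹| * (2 * Real.pi * (k : ℕ)) *
          |mixCoef μ c ε k (rotCos θ x y)|)
        ≤ (|x k| + |y k|) * (|ε⁻¹| * (2 * Real.pi * (k : ℕ)) * (C k * Real.exp (|ε⁻¹| * S))) := by
          refine mul_le_mul (abs_rotSin_le θ x y k) ?_ (by positivity) (by positivity)
          exact mul_le_mul_of_nonneg_left h4 (by positivity)
      _ = _ := by ring
  have hs := hxy.mul_left (|ε⁻¹| * (2 * Real.pi) * Real.exp (|ε⁻¹| * S))
  refine ⟨Summable.of_norm_bounded hs hb, ?_⟩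
  rw [hS, ← tsum_mul_left, ← Real.norm_eq_abs]
  exact tsum_of_norm_bounded hs.hasSum hb

theorem measurable_mixDeriv [SFinite μ] (h : BoundedFamily c C) {Ω : Type*} [MeasurableSpace Ω]
    {X Y : Ω → ℕ+ → ℝ} (hX : Measurable X) (hY : Measurable Y) :
    Measurable fun p : ℝ × Ω => mixDeriv μ c ε p.1 (X p.2) (Y p.2) := by
  refine Measurable.tsum fun k => Measurable.mul ?_ (Measurable.const_mul ?_ _)
  · exact (measurable_pi_apply k).comp (measurable_rotSin hX hY)
  · exact (h.measurable_mixCoef k).comp (measurable_rotCos hX hY)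

theorem measurable_mixDeriv_left [SFinite μ] (h : BoundedFamily c C) (x y : ℕ+ → ℝ) :
    Measurable fun t => mixDeriv μ c ε t x y := by
  have h1 : Measurable fun t => rotCos t x y := measurable_pi_lambda _ fun k =>
    (continuous_iff_continuousAt.2 fun t => (hasDerivAt_rotCos t x y k).continuousAt).measurable
  refine Measurable.tsum fun k => Measurable.mul ?_
    (((h.measurable_mixCoef k).comp h1).const_mul _)
  unfold rotSin
  fun_prop

theorem intervalIntegrable_mixDeriv [IsProbabilityMeasure μ] (h : BoundedFamily c C)
    (hxy : Summable fun k : ℕ+ => (k : ℝ) * C k * (|x k| + |y k|)) (a b : ℝ) :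
    IntervalIntegrable (fun t => mixDeriv μ c ε t x y) volume a b := by
  rw [intervalIntegrable_iff]
  refine Measure.integrableOn_of_bounded (M := |ε⁻¹| * (2 * Real.pi) *
      Real.exp (|ε⁻¹| * ∑' k : ℕ+, (k : ℝ) * C k * (|x k| + |y k|)) *
        ∑' k : ℕ+, (k : ℝ) * C k * (|x k| + |y k|)) (by simp [uIoc])
    (h.measurable_mixDeriv_left x y).aestronglyMeasurable (ae_of_all _ fun t => ?_)
  rw [Real.norm_eq_abs]
  exact (h.abs_mixDeriv_le hxy t).2

/-- Integration by parts in the shift parameter. -/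
theorem integral_sq_mul_mixLik [IsProbabilityMeasure μ] (h : BoundedFamily c C)
    (hxy : Summable fun k : ℕ+ => (k : ℝ) * C k * (|x k| + |y k|)) {τ : ℝ} {r r' : ℝ → ℝ}
    (hr : ∀ t, HasDerivAt r (r' t) t) (hr' : Continuous r') (hrτ : r τ = 0) (hrτ' : r (-τ) = 0)
    (u : ℝ) :
    ∫ t in (-τ)..τ, r t ^ 2 * mixLik μ c ε (rotCos t x y) =
      ∫ t in (-τ)..τ, (u - t) * (r t * (2 * r' t * mixLik μ c ε (rotCos t x y) +
        r t * mixDeriv μ c ε t x y)) := by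
  have hq := h.hasDerivAt_mixLik (μ := μ) (ε := ε) hxy
  have hrc : Continuous r := continuous_iff_continuousAt.2 fun t => (hr t).continuousAt
  have hqc : Continuous fun t => mixLik μ c ε (rotCos t x y) :=
    continuous_iff_continuousAt.2 fun t => (hq t).continuousAt
  have hd := h.intervalIntegrable_mixDeriv (μ := μ) (ε := ε) hxy (-τ) τ
  have i1 : IntervalIntegrable (fun t => r t ^ 2 * mixLik μ c ε (rotCos t x y)) volume (-τ) τ :=
    ((hrc.pow 2).mul hqc).intervalIntegrable _ _
  have i2 : IntervalIntegrable (fun t => (u - t) * (r t * (2 * r' t * mixLik μ c ε (rotCos t x y) +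
        r t * mixDeriv μ c ε t x y))) volume (-τ) τ := by
    have : (fun t => (u - t) * (r t * (2 * r' t * mixLik μ c ε (rotCos t x y) +
        r t * mixDeriv μ c ε t x y))) =
        (fun t => (u - t) * (r t * (2 * r' t * mixLik μ c ε (rotCos t x y)))) +
          fun t => ((u - t) * r t ^ 2) * mixDeriv μ c ε t x y := by
      funext t
      simp only [Pi.add_apply]
      ring
    rw [this]
    refine IntervalIntegrable.add (Continuous.intervalIntegrable (by fun_prop) _ _) ?_
    exact hd.continuousOn_mul (Continuous.continuousOn (by fun_prop))
  -- The boundary values of this primitive vanish with `r`. The number `u` is constant in `t`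
  -- because, under the reference noise, the data and hence the estimate do not depend on the shift.
  have hderiv : ∀ t, HasDerivAt (fun t => (u - t) * (r t ^ 2 * mixLik μ c ε (rotCos t x y)))
      ((u - t) * (r t * (2 * r' t * mixLik μ c ε (rotCos t x y) +
        r t * mixDeriv μ c ε t x y)) - r t ^ 2 * mixLik μ c ε (rotCos t x y)) t := by
    intro t
    have h1 : HasDerivAt (fun t => u - t) (-1) t := by
      simpa using (hasDerivAt_id t).const_sub u
    have := h1.mul (((hr t).pow 2).mul (hq t))
    refine this.congr_deriv ?_
    simp only [Pi.pow_apply, Nat.cast_ofNat, Pi.mul_apply]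
    ring
  have := intervalIntegral.integral_eq_sub_of_hasDerivAt (fun t _ => hderiv t) (i2.sub i1)
  rw [intervalIntegral.integral_sub i2 i1, hrτ, hrτ'] at this
  simp only [ne_eq, OfNat.ofNat_ne_zero, not_false_eq_true, zero_pow, zero_mul, mul_zero,
    sub_zero] at this
  linarith

end BoundedFamily

/-! ### Van Trees inequality with a nuisance signal -/

theorem measurable_rotCos_right {Ω : Type*} [MeasurableSpace Ω] {x y : Ω → ℕ+ → ℝ}
    (hx : Measurable x) (hy : Measurable y) (θ : ℝ) :
    Measurable fun ω => rotCos θ (x ω) (y ω) := by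
  refine measurable_pi_lambda _ fun k => ?_
  have h1 : Measurable fun ω => x ω k := (measurable_pi_apply k).comp hx
  have h2 : Measurable fun ω => y ω k := (measurable_pi_apply k).comp hy
  exact (h1.const_mul _).add (h2.const_mul _)

theorem measurable_rotSin_right {Ω : Type*} [MeasurableSpace Ω] {x y : Ω → ℕ+ → ℝ}
    (hx : Measurable x) (hy : Measurable y) (θ : ℝ) :
    Measurable fun ω => rotSin θ (x ω) (y ω) := by
  refine measurable_pi_lambda _ fun k => ?_
  have h1 : Measurable fun ω => x ω k := (measurable_pi_apply k).comp hx
  have h2 : Measurable fun ω => y ω k := (measurable_pi_apply k).comp hy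
  exact (h1.const_mul _).add (h2.const_mul _)

theorem ofReal_integral_le_lintegral {α : Type*} [MeasurableSpace α] {μ : Measure α} (f : α → ℝ) :
    ENNReal.ofReal (∫ x, f x ∂μ) ≤ ∫⁻ x, ENNReal.ofReal (f x) ∂μ := by
  by_cases hf : Integrable f μ
  · rw [integral_eq_lintegral_pos_part_sub_lintegral_neg_part hf]
    exact (ENNReal.ofReal_le_ofReal (sub_le_self _ ENNReal.toReal_nonneg)).trans
      ENNReal.ofReal_toReal_le
  · simp [integral_undef hf]

theorem lintegral_Ioc_ofReal {g : ℝ → ℝ} (hg : Continuous g) (h0 : ∀ t, 0 ≤ g t) {a b : ℝ}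
    (hab : a ≤ b) :
    ∫⁻ t in Ioc a b, ENNReal.ofReal (g t) = ENNReal.ofReal (∫ t in a..b, g t) := by
  rw [intervalIntegral.integral_of_le hab]
  exact (ofReal_integral_eq_lintegral_ofReal (hg.intervalIntegrable a b).1 (ae_of_all _ h0)).symm

namespace BoundedFamily

variable {V Ω : Type*} [MeasurableSpace V] [MeasurableSpace Ω] {μ : Measure V} {P : Measure Ω}
  [IsProbabilityMeasure μ] [IsProbabilityMeasure P] {c : V → ℕ+ → ℝ} {C : ℕ+ → ℝ} {ε : ℝ}
  {y : ℕ+ → ℝ} {X Y : Ω → ℕ+ → ℝ} {bmin bmax : ℝ}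

/-- The first factor is the conditional second moment of 2r'q + rq' given the rotated data. Dividing
by G = `mixInfo` turns the bound q(G - W) on the squared posterior means into q minus qW/G;
comparing q/G with 1/bmax for this deficit and with 1/bmin for the prior term gives the claim. -/
theorem conditional_score_le (h : BoundedFamily c C) (hε : 0 < ε)
    (hy : Summable fun k => C k * |y k|) (hbmin : 0 < bmin) (hmin : ∀ v, bmin ≤ derivSq (c v))
    (hmax : ∀ v, derivSq (c v) ≤ bmax) (K : Finset ℕ+) (r r' : ℝ) :
    (ENNReal.ofReal ((2 * r' * mixLik μ c ε y) ^ 2) + ∑' k : ℕ+, ENNReal.ofReal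
        ((r * (ε⁻¹ * (2 * Real.pi * (k : ℕ)) * mixCoef μ c ε k y)) ^ 2)) *
        ENNReal.ofReal (ε ^ 2 / mixInfo μ c ε y) +
      ENNReal.ofReal (r ^ 2 / bmax) *
        ENNReal.ofReal (∑ k ∈ K, (2 * Real.pi * (k : ℕ)) ^ 2 * mixVar μ c ε k y) ≤
      ENNReal.ofReal (4 * r' ^ 2 * ε ^ 2 / bmin + r ^ 2) * ENNReal.ofReal (mixLik μ c ε y) := by
  have hq := h.mixLik_pos (μ := μ) (ε := ε) hy
  have hG1 := h.le_mixInfo (μ := μ) (ε := ε) hy hmin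
  have hG2 := h.mixInfo_le (μ := μ) (ε := ε) hy hmax
  have hle := fun F => h.sum_sq_mixCoef_add_le (μ := μ) (ε := ε) hy F K
  have hW : 0 ≤ ∑ k ∈ K, (2 * Real.pi * (k : ℕ)) ^ 2 * mixVar μ c ε k y :=
    Finset.sum_nonneg fun k _ => mul_nonneg (by positivity) (mixVar_nonneg k)
  have hWG := hle ∅
  rw [Finset.sum_empty, zero_add] at hWG
  generalize (∑ k ∈ K, (2 * Real.pi * ((k : ℕ) : ℝ)) ^ 2 * mixVar μ c ε k y) = W at *
  generalize mixInfo μ c ε y = G at *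
  generalize mixLik μ c ε y = q at *
  have hG : 0 < G := lt_of_lt_of_le (mul_pos hbmin hq) hG1
  have hbmax : 0 < bmax := by
    by_contra hcon
    have : bmax * q ≤ 0 := mul_nonpos_of_nonpos_of_nonneg (not_lt.1 hcon) hq.le
    linarith
  have htsum : ∑' k : ℕ+, ENNReal.ofReal
        ((r * (ε⁻¹ * (2 * Real.pi * (k : ℕ)) * mixCoef μ c ε k y)) ^ 2) ≤
      ENNReal.ofReal (r ^ 2 * (ε ^ 2)⁻¹ * (q * (G - W))) := by
    rw [ENNReal.tsum_eq_iSup_sum]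
    refine iSup_le fun F => ?_
    rw [← ENNReal.ofReal_sum_of_nonneg fun _ _ => sq_nonneg _]
    refine ENNReal.ofReal_le_ofReal ?_
    have h1 : ∑ k ∈ F, (r * (ε⁻¹ * (2 * Real.pi * (k : ℕ)) * mixCoef μ c ε k y)) ^ 2 =
        r ^ 2 * (ε ^ 2)⁻¹ *
          (q * ∑ k ∈ F, (2 * Real.pi * (k : ℕ)) ^ 2 * (mixCoef μ c ε k y ^ 2 / q)) := by
      rw [Finset.mul_sum, Finset.mul_sum]
      refine Finset.sum_congr rfl fun k _ => ?_
      field_simp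
    rw [h1]
    have := hle F
    refine mul_le_mul_of_nonneg_left (mul_le_mul_of_nonneg_left ?_ hq.le) (by positivity)
    linarith
  have hGW : 0 ≤ G - W := by linarith
  refine (add_le_add_left (mul_le_mul_left (add_le_add_right htsum _) _) _).trans ?_
  rw [← ENNReal.ofReal_add (sq_nonneg _) (by positivity), ← ENNReal.ofReal_mul (by positivity),
    ← ENNReal.ofReal_mul (by positivity), ← ENNReal.ofReal_mul (by positivity),
    ← ENNReal.ofReal_add (by positivity) (by positivity)]
  refine ENNReal.ofReal_le_ofReal ?_
  -- The three terms are the shift prior's contribution, the first-order information, and the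
  -- surplus of the exact deficit over the one claimed.
  have e1 : ((2 * r' * q) ^ 2 + r ^ 2 * (ε ^ 2)⁻¹ * (q * (G - W))) * (ε ^ 2 / G) +
      r ^ 2 / bmax * W = 4 * r' ^ 2 * ε ^ 2 * q * (q / G) + r ^ 2 * q -
        r ^ 2 * W * (q / G - 1 / bmax) := by
    field_simp
    ring
  have h1 : q / G ≤ 1 / bmin := by
    rw [div_le_div_iff₀ hG hbmin]
    linarith
  have h2 : 1 / bmax ≤ q / G := by
    rw [div_le_div_iff₀ hbmax hG]
    linarith
  have h3 : 0 ≤ r ^ 2 * W * (q / G - 1 / bmax) := mul_nonneg (by positivity) (by linarith)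
  have h4 : 4 * r' ^ 2 * ε ^ 2 * q * (q / G) ≤ 4 * r' ^ 2 * ε ^ 2 * q * (1 / bmin) :=
    mul_le_mul_of_nonneg_left h1 (by positivity)
  have e2 : (4 * r' ^ 2 * ε ^ 2 / bmin + r ^ 2) * q =
      4 * r' ^ 2 * ε ^ 2 * q * (1 / bmin) + r ^ 2 * q := by ring
  rw [e1, e2]
  linarith

theorem lintegral_mixLik (h : BoundedFamily c C) (hX : Measurable X) (hY : Measurable Y)
    (hgood : ∀ ω, Summable fun k : ℕ+ => (k : ℝ) * C k * (|X ω k| + |Y ω k|)) (θ : ℝ)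
    (hone : ∀ v, ∫⁻ ω, ENNReal.ofReal (likelihood ε (c v) (rotCos θ (X ω) (Y ω))) ∂P = 1) :
    ∫⁻ ω, ENNReal.ofReal (mixLik μ c ε (rotCos θ (X ω) (Y ω))) ∂P = 1 := by
  have hm : Measurable fun p : Ω × V =>
      ENNReal.ofReal (likelihood ε (c p.2) (rotCos θ (X p.1) (Y p.1))) := by
    refine (h.measurable_likelihood.comp (Measurable.prodMk ?_ measurable_snd)).ennreal_ofReal
    exact (measurable_rotCos_right hX hY θ).comp measurable_fst
  have e : ∀ ω, ENNReal.ofReal (mixLik μ c ε (rotCos θ (X ω) (Y ω))) =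
      ∫⁻ v, ENNReal.ofReal (likelihood ε (c v) (rotCos θ (X ω) (Y ω))) ∂μ := fun ω =>
    ofReal_integral_eq_lintegral_ofReal (h.integrable_likelihood (h.summable_rotCos (hgood ω) θ))
      (ae_of_all _ fun v => (likelihood_pos _ _ _).le)
  simp_rw [e]
  rw [lintegral_lintegral_swap hm.aemeasurable]
  simp [hone]

/-- The loss carries the Fisher information of the random signal, so averaging it at fixed data
gives the weight `mixInfo` rather than a constant multiple of `mixLik`. -/
theorem lintegral_sq_mul_mixInfo_le (h : BoundedFamily c C) (hX : Measurable X) (hY : Measurable Y)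
    (hgood : ∀ ω, Summable fun k : ℕ+ => (k : ℝ) * C k * (|X ω k| + |Y ω k|)) (θ : ℝ)
    {U : Ω → ℝ} (hU : Measurable U) {R : ℝ≥0∞}
    (hrisk : ∀ v, ∫⁻ ω, ENNReal.ofReal ((U ω - θ) ^ 2 * (derivSq (c v) / ε ^ 2)) *
      ENNReal.ofReal (likelihood ε (c v) (rotCos θ (X ω) (Y ω))) ∂P ≤ R) :
    ∫⁻ ω, ENNReal.ofReal ((U ω - θ) ^ 2 * (mixInfo μ c ε (rotCos θ (X ω) (Y ω)) / ε ^ 2)) ∂P ≤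
      R := by
  have hm : Measurable fun p : Ω × V => ENNReal.ofReal ((U p.1 - θ) ^ 2 * (derivSq (c p.2) / ε ^ 2))
      * ENNReal.ofReal (likelihood ε (c p.2) (rotCos θ (X p.1) (Y p.1))) := by
    refine Measurable.mul (Measurable.ennreal_ofReal (Measurable.mul ?_ ?_)) ?_
    · exact ((hU.comp measurable_fst).sub_const θ).pow_const 2
    · exact (h.measurable_derivSq.comp measurable_snd).div_const _
    refine (h.measurable_likelihood.comp (Measurable.prodMk ?_ measurable_snd)).ennreal_ofReal
    exact (measurable_rotCos_right hX hY θ).comp measurable_fst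
  have e : ∀ ω, ENNReal.ofReal ((U ω - θ) ^ 2 * (mixInfo μ c ε (rotCos θ (X ω) (Y ω)) / ε ^ 2)) =
      ∫⁻ v, ENNReal.ofReal ((U ω - θ) ^ 2 * (derivSq (c v) / ε ^ 2)) *
        ENNReal.ofReal (likelihood ε (c v) (rotCos θ (X ω) (Y ω))) ∂μ := by
    intro ω
    have e1 : (U ω - θ) ^ 2 * (mixInfo μ c ε (rotCos θ (X ω) (Y ω)) / ε ^ 2) =
        ∫ v, (U ω - θ) ^ 2 / ε ^ 2 * (derivSq (c v) *
          likelihood ε (c v) (rotCos θ (X ω) (Y ω))) ∂μ := by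
      rw [integral_const_mul, mixInfo]
      ring
    rw [e1, ofReal_integral_eq_lintegral_ofReal
      ((h.integrable_derivSq (h.summable_rotCos (hgood ω) θ)).const_mul _)
      (ae_of_all _ fun v => mul_nonneg (by positivity)
        (mul_nonneg (derivSq_nonneg _) (likelihood_pos _ _ _).le))]
    refine lintegral_congr fun v => ?_
    rw [← ENNReal.ofReal_mul (mul_nonneg (sq_nonneg _)
      (div_nonneg (derivSq_nonneg _) (sq_nonneg _)))]
    congr 1
    ring
  simp_rw [e]
  rw [lintegral_lintegral_swap hm.aemeasurable]
  refine (lintegral_mono hrisk).trans ?_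
  simp

/-- Conditioning on the rotated data and integrating the pointwise bound against a mixed likelihood
of mass one leaves the expected posterior variance as a deficit. -/
theorem lintegral_score_le (h : BoundedFamily c C) (hε : 0 < ε) (hX : Measurable X)
    (hY : Measurable Y)
    (hgood : ∀ ω, Summable fun k : ℕ+ => (k : ℝ) * C k * (|X ω k| + |Y ω k|)) (θ : ℝ)
    (hbmin : 0 < bmin) (hmin : ∀ v, bmin ≤ derivSq (c v)) (hmax : ∀ v, derivSq (c v) ≤ bmax)
    (hone : ∀ v, ∫⁻ ω, ENNReal.ofReal (likelihood ε (c v) (rotCos θ (X ω) (Y ω))) ∂P = 1)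
    (hind : IndepFun (fun ω => rotCos θ (X ω) (Y ω)) (fun ω => rotSin θ (X ω) (Y ω)) P)
    (hs2 : ∀ k, MemLp (fun ω => rotSin θ (X ω) (Y ω) k) 2 P)
    (hs0 : ∀ k, ∫ ω, rotSin θ (X ω) (Y ω) k ∂P = 0)
    (hss : ∀ j k, ∫ ω, rotSin θ (X ω) (Y ω) j * rotSin θ (X ω) (Y ω) k ∂P = if j = k then 1 else 0)
    {K : Finset ℕ+} {EV : ℝ} (hEV0 : 0 ≤ EV)
    (hEV : ENNReal.ofReal EV ≤ ∫⁻ ω, ENNReal.ofReal (∑ k ∈ K, (2 * Real.pi * (k : ℕ)) ^ 2 *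
      mixVar μ c ε k (rotCos θ (X ω) (Y ω))) ∂P) (r r' : ℝ) :
    ∫⁻ ω, ENNReal.ofReal ((2 * r' * mixLik μ c ε (rotCos θ (X ω) (Y ω)) +
        r * mixDeriv μ c ε θ (X ω) (Y ω)) ^ 2) *
        ENNReal.ofReal (ε ^ 2 / mixInfo μ c ε (rotCos θ (X ω) (Y ω))) ∂P ≤
      ENNReal.ofReal (4 * r' ^ 2 * ε ^ 2 / bmin + r ^ 2 * (1 - EV / bmax)) := by
  have hZ := measurable_rotCos_right hX hY θ
  have hS := measurable_rotSin_right hX hY θ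
  have hbmax : 0 < bmax := by
    obtain ⟨v⟩ : Nonempty V := nonempty_of_isProbabilityMeasure μ
    exact hbmin.trans_le ((hmin v).trans (hmax v))
  have e : ∀ ω, r * mixDeriv μ c ε θ (X ω) (Y ω) = ∑' k : ℕ+, rotSin θ (X ω) (Y ω) k *
      (r * (ε⁻¹ * (2 * Real.pi * (k : ℕ)) * mixCoef μ c ε k (rotCos θ (X ω) (Y ω)))) := by
    intro ω
    rw [mixDeriv, ← tsum_mul_left]
    exact tsum_congr fun k => by ring
  have h1 := lintegral_sq_add_tsum_mul_le (P := P) (Z := fun ω => rotCos θ (X ω) (Y ω))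
    (s := fun k ω => rotSin θ (X ω) (Y ω) k) hZ (fun k => (measurable_pi_apply k).comp hS)
    hind hs2 hs0 hss (b := fun y => 2 * r' * mixLik μ c ε y)
    (A := fun k y => r * (ε⁻¹ * (2 * Real.pi * (k : ℕ)) * mixCoef μ c ε k y))
    (H := fun y => ENNReal.ofReal (ε ^ 2 / mixInfo μ c ε y))
    (h.measurable_mixLik.const_mul _) (fun k => ((h.measurable_mixCoef k).const_mul _).const_mul _)
    (h.measurable_mixInfo.const_div _).ennreal_ofReal (fun ω => by
      refine ((h.abs_mixDeriv_le (μ := μ) (ε := ε) (hgood ω) θ).1.mul_left r).congr fun k => ?_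
      ring)
  simp_rw [e]
  refine h1.trans ?_
  set A : Ω → ℝ≥0∞ := fun ω =>
    (ENNReal.ofReal ((2 * r' * mixLik μ c ε (rotCos θ (X ω) (Y ω))) ^ 2) +
      ∑' k : ℕ+, ENNReal.ofReal
        ((r * (ε⁻¹ * (2 * Real.pi * (k : ℕ)) * mixCoef μ c ε k (rotCos θ (X ω) (Y ω)))) ^ 2)) *
      ENNReal.ofReal (ε ^ 2 / mixInfo μ c ε (rotCos θ (X ω) (Y ω))) with hA
  set B : Ω → ℝ≥0∞ := fun ω => ENNReal.ofReal (∑ k ∈ K, (2 * Real.pi * (k : ℕ)) ^ 2 *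
      mixVar μ c ε k (rotCos θ (X ω) (Y ω))) with hB
  have hmB : Measurable B := (Finset.measurable_fun_sum _ fun k _ =>
      ((h.measurable_mixVar k).comp hZ).const_mul _).ennreal_ofReal
  have hint : ∫⁻ ω, A ω ∂P + ENNReal.ofReal (r ^ 2 / bmax) * ∫⁻ ω, B ω ∂P ≤
      ENNReal.ofReal (4 * r' ^ 2 * ε ^ 2 / bmin + r ^ 2) := by
    rw [← lintegral_const_mul' _ _ ENNReal.ofReal_ne_top,
      ← lintegral_add_right _ (hmB.const_mul _)]
    calc ∫⁻ ω, (A ω + ENNReal.ofReal (r ^ 2 / bmax) * B ω) ∂P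
        ≤ ∫⁻ ω, ENNReal.ofReal (4 * r' ^ 2 * ε ^ 2 / bmin + r ^ 2) *
            ENNReal.ofReal (mixLik μ c ε (rotCos θ (X ω) (Y ω))) ∂P :=
          lintegral_mono fun ω => h.conditional_score_le (μ := μ) hε
            (h.summable_rotCos (hgood ω) θ) hbmin hmin hmax K r r'
      _ = _ := by
          rw [lintegral_const_mul' _ _ ENNReal.ofReal_ne_top,
            h.lintegral_mixLik (μ := μ) hX hY hgood θ hone,
            mul_one]
  have h2 := (add_le_add_right (mul_le_mul_right hEV (ENNReal.ofReal (r ^ 2 / bmax))) _).trans hint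
  rw [← ENNReal.ofReal_mul (by positivity)] at h2
  have h3 := ENNReal.le_sub_of_add_le_right ENNReal.ofReal_ne_top h2
  rw [← ENNReal.ofReal_sub _ (by positivity)] at h3
  refine h3.trans (ENNReal.ofReal_le_ofReal (le_of_eq ?_))
  ring

/-- A weighted van Trees inequality with a nuisance signal: the normalized Bayes risk of estimating
the shift exceeds one by the posterior variance of the derivative of the signal. -/
theorem van_trees (h : BoundedFamily c C) (hε : 0 < ε) (hX : Measurable X)
    (hY : Measurable Y)
    (hgood : ∀ ω, Summable fun k : ℕ+ => (k : ℝ) * C k * (|X ω k| + |Y ω k|))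
    (hbmin : 0 < bmin) (hmin : ∀ v, bmin ≤ derivSq (c v)) (hmax : ∀ v, derivSq (c v) ≤ bmax)
    (hone : ∀ θ v, ∫⁻ ω, ENNReal.ofReal (likelihood ε (c v) (rotCos θ (X ω) (Y ω))) ∂P = 1)
    (hind : ∀ θ, IndepFun (fun ω => rotCos θ (X ω) (Y ω)) (fun ω => rotSin θ (X ω) (Y ω)) P)
    (hs2 : ∀ θ k, MemLp (fun ω => rotSin θ (X ω) (Y ω) k) 2 P)
    (hs0 : ∀ θ k, ∫ ω, rotSin θ (X ω) (Y ω) k ∂P = 0)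
    (hss : ∀ θ j k,
      ∫ ω, rotSin θ (X ω) (Y ω) j * rotSin θ (X ω) (Y ω) k ∂P = if j = k then 1 else 0)
    {K : Finset ℕ+} {EV : ℝ} (hEV0 : 0 ≤ EV)
    (hEV : ∀ θ, ENNReal.ofReal EV ≤ ∫⁻ ω, ENNReal.ofReal (∑ k ∈ K, (2 * Real.pi * (k : ℕ)) ^ 2 *
      mixVar μ c ε k (rotCos θ (X ω) (Y ω))) ∂P)
    {τ : ℝ} (hτ : 0 < τ) {r r' : ℝ → ℝ}
    (hr : ∀ t, HasDerivAt r (r' t) t) (hr' : Continuous r') (hrτ : r τ = 0) (hrτ' : r (-τ) = 0)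
    (hr1 : ∫ t in (-τ)..τ, r t ^ 2 = 1)
    {U : Ω → ℝ} (hU : Measurable U) {R : ℝ≥0∞}
    (hrisk : ∀ θ ∈ Icc (-τ) τ, ∀ v, ∫⁻ ω, ENNReal.ofReal ((U ω - θ) ^ 2 * (derivSq (c v) / ε ^ 2)) *
      ENNReal.ofReal (likelihood ε (c v) (rotCos θ (X ω) (Y ω))) ∂P ≤ R) {a : ℝ} (ha : 0 < a) :
    2 ≤ ENNReal.ofReal a * R + ENNReal.ofReal (a⁻¹ *
      (ε ^ 2 * (∫ t in (-τ)..τ, 4 * r' t ^ 2) / bmin + (1 - EV / bmax))) := by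
  have hbmax : 0 < bmax := by
    obtain ⟨v⟩ : Nonempty V := nonempty_of_isProbabilityMeasure μ
    exact hbmin.trans_le ((hmin v).trans (hmax v))
  have hrc : Continuous r := continuous_iff_continuousAt.2 fun t => (hr t).continuousAt
  have hττ : -τ ≤ τ := by linarith
  set ν : Measure ℝ := volume.restrict (Ioc (-τ) τ) with hν
  set q : ℝ → Ω → ℝ := fun t ω => mixLik μ c ε (rotCos t (X ω) (Y ω)) with hqdef
  set q' : ℝ → Ω → ℝ := fun t ω => mixDeriv μ c ε t (X ω) (Y ω) with hqdef'
  set G : ℝ → Ω → ℝ := fun t ω => mixInfo μ c ε (rotCos t (X ω) (Y ω)) with hGdef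
  have hmZ := measurable_rotCos hX hY
  have hmq : Measurable fun p : ℝ × Ω => q p.1 p.2 := h.measurable_mixLik.comp hmZ
  have hmq' : Measurable fun p : ℝ × Ω => q' p.1 p.2 := h.measurable_mixDeriv hX hY
  have hmG : Measurable fun p : ℝ × Ω => G p.1 p.2 := h.measurable_mixInfo.comp hmZ
  have hmr : Measurable fun p : ℝ × Ω => r p.1 := hrc.measurable.comp measurable_fst
  have hmr' : Measurable fun p : ℝ × Ω => r' p.1 := hr'.measurable.comp measurable_fst
  have hmU : Measurable fun p : ℝ × Ω => U p.2 := hU.comp measurable_snd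
  have hqpos : ∀ t ω, 0 < q t ω := fun t ω => h.mixLik_pos (h.summable_rotCos (hgood ω) t)
  have hGpos : ∀ t ω, 0 < G t ω := fun t ω =>
    (mul_pos hbmin (hqpos t ω)).trans_le (h.le_mixInfo (h.summable_rotCos (hgood ω) t) hmin)
  set T1 : ℝ → Ω → ℝ≥0∞ := fun t ω =>
    ENNReal.ofReal (a * r t ^ 2) * ENNReal.ofReal ((U ω - t) ^ 2 * (G t ω / ε ^ 2)) with hT1
  set T2 : ℝ → Ω → ℝ≥0∞ := fun t ω => ENNReal.ofReal a⁻¹ *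
    (ENNReal.ofReal ((2 * r' t * q t ω + r t * q' t ω) ^ 2) * ENNReal.ofReal (ε ^ 2 / G t ω))
    with hT2
  have hmT1 : Measurable fun p : ℝ × Ω => T1 p.1 p.2 := by
    simp only [hT1]
    fun_prop
  have hmT2 : Measurable fun p : ℝ × Ω => T2 p.1 p.2 := by
    simp only [hT2]
    fun_prop
  -- This is 2AB ≤ A² + B² with relative weight aG/ε², so that the first square is exactly the
  -- averaged loss. The constant `a` stays free until the end.
  have hpt : ∀ t ω, ENNReal.ofReal (2 * ((U ω - t) * (r t * (2 * r' t * q t ω + r t * q' t ω)))) ≤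
      T1 t ω + T2 t ω := by
    intro t ω
    have hG := hGpos t ω
    simp only [hT1, hT2]
    rw [← ENNReal.ofReal_mul (by positivity), ← ENNReal.ofReal_mul (by positivity),
      ← ENNReal.ofReal_mul (by positivity), ← ENNReal.ofReal_add (by positivity) (by positivity)]
    refine ENNReal.ofReal_le_ofReal ?_
    generalize 2 * r' t * q t ω + r t * q' t ω = B
    generalize G t ω = g at *
    have := sq_nonneg ((U ω - t) * r t * (a * g) - B * ε ^ 2)
    have e : a * r t ^ 2 * ((U ω - t) ^ 2 * (g / ε ^ 2)) + a⁻¹ * (B ^ 2 * (ε ^ 2 / g)) -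
        2 * ((U ω - t) * (r t * B)) =
        ((U ω - t) * r t * (a * g) - B * ε ^ 2) ^ 2 / (a * g * ε ^ 2) := by
      field_simp
      ring
    have : 0 ≤ ((U ω - t) * r t * (a * g) - B * ε ^ 2) ^ 2 / (a * g * ε ^ 2) := by positivity
    linarith
  -- The shift density times the mixed likelihood has total mass one; integration by parts is
  -- applied to this mass.
  have hone' : ∫⁻ ω, ENNReal.ofReal (∫ t in (-τ)..τ, r t ^ 2 * q t ω) ∂P = 1 := by
    have e1 : ∀ ω, ENNReal.ofReal (∫ t in (-τ)..τ, r t ^ 2 * q t ω) =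
        ∫⁻ t, ENNReal.ofReal (r t ^ 2 * q t ω) ∂ν := by
      intro ω
      have hqc : Continuous fun t => q t ω := continuous_iff_continuousAt.2 fun t =>
        (h.hasDerivAt_mixLik (hgood ω) t).continuousAt
      exact (lintegral_Ioc_ofReal ((hrc.pow 2).mul hqc)
        (fun t => mul_nonneg (sq_nonneg _) (hqpos t ω).le) hττ).symm
    simp_rw [e1]
    rw [lintegral_lintegral_swap (by fun_prop)]
    have e2 : ∀ t, ∫⁻ ω, ENNReal.ofReal (r t ^ 2 * q t ω) ∂P = ENNReal.ofReal (r t ^ 2) := by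
      intro t
      simp_rw [ENNReal.ofReal_mul (sq_nonneg (r t))]
      have hm : Measurable fun ω => ENNReal.ofReal (q t ω) :=
        (hmq.comp (measurable_const.prodMk measurable_id)).ennreal_ofReal
      rw [lintegral_const_mul _ hm, h.lintegral_mixLik hX hY hgood t (hone t), mul_one]
    simp_rw [e2]
    rw [hν, lintegral_Ioc_ofReal (g := fun t => r t ^ 2) (hrc.pow 2) (fun t => sq_nonneg _) hττ, hr1]
    simp
  have hmain : (2 : ℝ≥0∞) ≤ ∫⁻ ω, ∫⁻ t, (T1 t ω + T2 t ω) ∂ν ∂P := by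
    calc (2 : ℝ≥0∞) = ENNReal.ofReal 2 *
          ∫⁻ ω, ENNReal.ofReal (∫ t in (-τ)..τ, r t ^ 2 * q t ω) ∂P := by
          rw [hone']
          simp
      _ ≤ ∫⁻ ω, ENNReal.ofReal 2 * ENNReal.ofReal (∫ t in (-τ)..τ, r t ^ 2 * q t ω) ∂P :=
          lintegral_const_mul_le _ _
      _ ≤ ∫⁻ ω, ∫⁻ t, (T1 t ω + T2 t ω) ∂ν ∂P := by
          refine lintegral_mono fun ω => ?_
          rw [← ENNReal.ofReal_mul (by norm_num),
            h.integral_sq_mul_mixLik (hgood ω) hr hr' hrτ hrτ' (U ω),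
            ← intervalIntegral.integral_const_mul, intervalIntegral.integral_of_le hττ]
          exact (ofReal_integral_le_lintegral _).trans (lintegral_mono fun t => hpt t ω)
  rw [lintegral_lintegral_swap (f := fun ω t => T1 t ω + T2 t ω)
    ((hmT1.add hmT2).comp measurable_swap).aemeasurable] at hmain
  have hsplit : ∀ t, ∫⁻ ω, (T1 t ω + T2 t ω) ∂P = ∫⁻ ω, T1 t ω ∂P + ∫⁻ ω, T2 t ω ∂P := fun t =>
    lintegral_add_left (hmT1.comp (measurable_const.prodMk measurable_id)) _
  have hb1 : ∀ t ∈ Ioc (-τ) τ, ∫⁻ ω, T1 t ω ∂P ≤ ENNReal.ofReal (a * r t ^ 2) * R := by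
    intro t ht
    simp only [hT1]
    rw [lintegral_const_mul']
    · gcongr
      exact h.lintegral_sq_mul_mixInfo_le hX hY hgood t hU (hrisk t ⟨ht.1.le, ht.2⟩)
    · exact ENNReal.ofReal_ne_top
  have hb2 : ∀ t, ∫⁻ ω, T2 t ω ∂P ≤ ENNReal.ofReal a⁻¹ *
      ENNReal.ofReal (4 * r' t ^ 2 * ε ^ 2 / bmin + r t ^ 2 * (1 - EV / bmax)) := by
    intro t
    simp only [hT2]
    rw [lintegral_const_mul' _ _ ENNReal.ofReal_ne_top]
    gcongr
    exact h.lintegral_score_le hε hX hY hgood t hbmin hmin hmax (hone t) (hind t) (hs2 t) (hs0 t)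
      (hss t) hEV0 (hEV t) (r t) (r' t)
  -- A posterior variance cannot exceed the second moment. The resulting sign of 1 - EV/bmax is
  -- needed to integrate the bound over the shift in `ENNReal`.
  have hEVle : EV ≤ bmax := by
    have h1 : ENNReal.ofReal EV ≤ ENNReal.ofReal bmax := by
      refine (hEV 0).trans ?_
      calc _ ≤ ∫⁻ ω, ENNReal.ofReal bmax *
              ENNReal.ofReal (mixLik μ c ε (rotCos 0 (X ω) (Y ω))) ∂P := by
            refine lintegral_mono fun ω => ?_
            rw [← ENNReal.ofReal_mul hbmax.le]
            refine ENNReal.ofReal_le_ofReal ?_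
            have h1 := h.sum_sq_mixCoef_add_le (μ := μ) (ε := ε) (h.summable_rotCos (hgood ω) 0) ∅ K
            rw [Finset.sum_empty, zero_add] at h1
            exact h1.trans (h.mixInfo_le (h.summable_rotCos (hgood ω) 0) hmax)
        _ = ENNReal.ofReal bmax := by
            rw [lintegral_const_mul' _ _ ENNReal.ofReal_ne_top,
              h.lintegral_mixLik hX hY hgood 0 (hone 0), mul_one]
    exact (ENNReal.ofReal_le_ofReal_iff hbmax.le).1 h1
  have hEV1 : 0 ≤ 1 - EV / bmax := by
    rw [sub_nonneg, div_le_one hbmax]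
    exact hEVle
  have hf1 : ∫⁻ t, ENNReal.ofReal (a * r t ^ 2) * R ∂ν = ENNReal.ofReal a * R := by
    have hm : Measurable fun t => ENNReal.ofReal (a * r t ^ 2) :=
      (((hrc.pow 2).measurable).const_mul a).ennreal_ofReal
    rw [lintegral_mul_const _ hm, hν, lintegral_Ioc_ofReal (g := fun t => a * r t ^ 2)
      (by fun_prop) (fun t => by positivity) hττ, intervalIntegral.integral_const_mul, hr1, mul_one]
  have hf2 : ∫⁻ t, ENNReal.ofReal a⁻¹ *
      ENNReal.ofReal (4 * r' t ^ 2 * ε ^ 2 / bmin + r t ^ 2 * (1 - EV / bmax)) ∂ν =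
      ENNReal.ofReal (a⁻¹ *
      (ε ^ 2 * (∫ t in (-τ)..τ, 4 * r' t ^ 2) / bmin + (1 - EV / bmax))) := by
    have hc1 : Continuous fun t => 4 * r' t ^ 2 * ε ^ 2 / bmin := by fun_prop
    have hc2 : Continuous fun t => r t ^ 2 * (1 - EV / bmax) := by fun_prop
    rw [lintegral_const_mul' _ _ ENNReal.ofReal_ne_top, hν, lintegral_Ioc_ofReal
      (g := fun t => 4 * r' t ^ 2 * ε ^ 2 / bmin + r t ^ 2 * (1 - EV / bmax)) (hc1.add hc2)
      (fun t => add_nonneg (by positivity) (mul_nonneg (sq_nonneg _) hEV1)) hττ,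
      ← ENNReal.ofReal_mul (by positivity)]
    congr 2
    rw [intervalIntegral.integral_add (hc1.intervalIntegrable _ _) (hc2.intervalIntegrable _ _),
      intervalIntegral.integral_mul_const, hr1, one_mul, intervalIntegral.integral_div,
      intervalIntegral.integral_mul_const]
    ring
  refine hmain.trans ?_
  have hm : Measurable fun t => ENNReal.ofReal (a * r t ^ 2) * R :=
    (((hrc.pow 2).measurable).const_mul a).ennreal_ofReal.mul_const _
  rw [← hf1, ← hf2, ← lintegral_add_left hm]
  refine setLIntegral_mono' measurableSet_Ioc fun t ht => ?_
  rw [hsplit]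
  exact add_le_add (hb1 t ht) (hb2 t)

end BoundedFamily

/-! ### Trigonometric basis and cosine series -/

/-- The function `√2 cos(2πkt)`. -/
def cosFun (k : ℕ+) : ℝ →ᵇ ℝ :=
  BoundedContinuousFunction.ofNormedAddCommGroup
    (fun t => √2 * Real.cos (2 * Real.pi * (k : ℕ) * t)) (by fun_prop) (√2) fun t => by
      rw [Real.norm_eq_abs, abs_mul, abs_of_nonneg (Real.sqrt_nonneg 2)]
      exact mul_le_of_le_one_right (Real.sqrt_nonneg 2) (Real.abs_cos_le_one _)

/-- The function `√2 sin(2πkt)`. -/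
def sinFun (k : ℕ+) : ℝ →ᵇ ℝ :=
  BoundedContinuousFunction.ofNormedAddCommGroup
    (fun t => √2 * Real.sin (2 * Real.pi * (k : ℕ) * t)) (by fun_prop) (√2) fun t => by
      rw [Real.norm_eq_abs, abs_mul, abs_of_nonneg (Real.sqrt_nonneg 2)]
      exact mul_le_of_le_one_right (Real.sqrt_nonneg 2) (Real.abs_sin_le_one _)

theorem cosFun_apply (k : ℕ+) (t : ℝ) :
    cosFun k t = √2 * Real.cos (2 * Real.pi * (k : ℕ) * t) := rfl

theorem sinFun_apply (k : ℕ+) (t : ℝ) :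
    sinFun k t = √2 * Real.sin (2 * Real.pi * (k : ℕ) * t) := rfl

theorem norm_cosFun_le (k : ℕ+) : ‖cosFun k‖ ≤ √2 :=
  BoundedContinuousFunction.norm_ofNormedAddCommGroup_le _ (Real.sqrt_nonneg 2) _

theorem norm_sinFun_le (k : ℕ+) : ‖sinFun k‖ ≤ √2 :=
  BoundedContinuousFunction.norm_ofNormedAddCommGroup_le _ (Real.sqrt_nonneg 2) _

/-- A bounded continuous function as a test function. -/
def toTest : (ℝ →ᵇ ℝ) →L[ℝ] TestFun := BoundedContinuousFunction.toLp 2 unitVolume ℝ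

theorem coeFn_toTest (g : ℝ →ᵇ ℝ) : toTest g =ᵐ[unitVolume] g :=
  BoundedContinuousFunction.coeFn_toLp 2 unitVolume ℝ g

theorem inner_toTest (φ : TestFun) (g : ℝ →ᵇ ℝ) :
    inner ℝ φ (toTest g) = ∫ t in Icc (-1 / 2 : ℝ) (1 / 2), φ t * g t := by
  rw [L2.inner_def]
  refine integral_congr_ae ?_
  filter_upwards [coeFn_toTest g] with t ht
  rw [ht]
  simp [mul_comm]

theorem inner_toTest_toTest (f g : ℝ →ᵇ ℝ) :
    inner ℝ (toTest f) (toTest g) = ∫ t in (-1 / 2 : ℝ)..(1 / 2), f t * g t := by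
  rw [inner_toTest, intervalIntegral.integral_of_le (by norm_num), integral_Icc_eq_integral_Ioc]
  refine integral_congr_ae ?_
  have := ae_restrict_of_ae_restrict_of_subset
    (Ioc_subset_Icc_self : Ioc (-1 / 2 : ℝ) (1 / 2) ⊆ _) (coeFn_toTest f)
  filter_upwards [this] with t ht
  rw [ht]

theorem integral_cos_two_pi_int (m : ℤ) :
    ∫ t in (-1 / 2 : ℝ)..(1 / 2), Real.cos (2 * Real.pi * m * t) = if m = 0 then 1 else 0 := by
  split_ifs with hm
  · subst hm
    norm_num
  · have hm' : 2 * Real.pi * (m : ℝ) ≠ 0 := by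
      have : (m : ℝ) ≠ 0 := by exact_mod_cast hm
      positivity
    rw [intervalIntegral.integral_comp_mul_left (fun x => Real.cos x) hm', integral_cos]
    have h1 : 2 * Real.pi * (m : ℝ) * (1 / 2) = m * Real.pi := by ring
    have h2 : 2 * Real.pi * (m : ℝ) * (-1 / 2) = -(m * Real.pi) := by ring
    rw [h1, h2, Real.sin_neg, Real.sin_int_mul_pi]
    simp

theorem integral_sin_two_pi_int (m : ℤ) :
    ∫ t in (-1 / 2 : ℝ)..(1 / 2), Real.sin (2 * Real.pi * m * t) = 0 := by
  by_cases hm : m = 0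
  · simp [hm]
  · have hm' : 2 * Real.pi * (m : ℝ) ≠ 0 := by
      have : (m : ℝ) ≠ 0 := by exact_mod_cast hm
      positivity
    rw [intervalIntegral.integral_comp_mul_left (fun x => Real.sin x) hm', integral_sin]
    have h1 : 2 * Real.pi * (m : ℝ) * (1 / 2) = m * Real.pi := by ring
    have h2 : 2 * Real.pi * (m : ℝ) * (-1 / 2) = -(m * Real.pi) := by ring
    rw [h1, h2, Real.cos_neg]
    simp

theorem inner_cosFun_cosFun (j k : ℕ+) :
    inner ℝ (toTest (cosFun j)) (toTest (cosFun k)) = if j = k then (1 : ℝ) else 0 := by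
  rw [inner_toTest_toTest]
  have e : ∀ t, cosFun j t * cosFun k t =
      Real.cos (2 * Real.pi * (((j : ℕ) : ℤ) - ((k : ℕ) : ℤ) : ℤ) * t) +
        Real.cos (2 * Real.pi * (((j : ℕ) : ℤ) + ((k : ℕ) : ℤ) : ℤ) * t) := by
    intro t
    push_cast
    rw [cosFun_apply, cosFun_apply, mul_sub, mul_add, sub_mul, add_mul, Real.cos_sub, Real.cos_add]
    have := Real.mul_self_sqrt (show (0 : ℝ) ≤ 2 by norm_num)
    linear_combination (Real.cos (2 * Real.pi * (j : ℕ) * t) *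
      Real.cos (2 * Real.pi * (k : ℕ) * t)) * this
  simp_rw [e]
  rw [intervalIntegral.integral_add (Continuous.intervalIntegrable (by fun_prop) _ _)
    (Continuous.intervalIntegrable (by fun_prop) _ _), integral_cos_two_pi_int,
    integral_cos_two_pi_int]
  have h1 : ((j : ℕ) : ℤ) + ((k : ℕ) : ℤ) ≠ 0 := by
    have := j.pos
    omega
  rw [if_neg h1, add_zero]
  congr 1
  rw [sub_eq_zero, eq_iff_iff, Nat.cast_inj, PNat.coe_inj]

theorem inner_sinFun_sinFun (j k : ℕ+) :
    inner ℝ (toTest (sinFun j)) (toTest (sinFun k)) = if j = k then (1 : ℝ) else 0 := by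
  rw [inner_toTest_toTest]
  have e : ∀ t, sinFun j t * sinFun k t =
      Real.cos (2 * Real.pi * (((j : ℕ) : ℤ) - ((k : ℕ) : ℤ) : ℤ) * t) -
        Real.cos (2 * Real.pi * (((j : ℕ) : ℤ) + ((k : ℕ) : ℤ) : ℤ) * t) := by
    intro t
    push_cast
    rw [sinFun_apply, sinFun_apply, mul_sub, mul_add, sub_mul, add_mul, Real.cos_sub, Real.cos_add]
    have := Real.mul_self_sqrt (show (0 : ℝ) ≤ 2 by norm_num)
    linear_combination (Real.sin (2 * Real.pi * (j : ℕ) * t) *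
      Real.sin (2 * Real.pi * (k : ℕ) * t)) * this
  simp_rw [e]
  rw [intervalIntegral.integral_sub (Continuous.intervalIntegrable (by fun_prop) _ _)
    (Continuous.intervalIntegrable (by fun_prop) _ _), integral_cos_two_pi_int,
    integral_cos_two_pi_int]
  have h1 : ((j : ℕ) : ℤ) + ((k : ℕ) : ℤ) ≠ 0 := by
    have := j.pos
    omega
  rw [if_neg h1, sub_zero]
  congr 1
  rw [sub_eq_zero, eq_iff_iff, Nat.cast_inj, PNat.coe_inj]

theorem inner_cosFun_sinFun (j k : ℕ+) :
    inner ℝ (toTest (cosFun j)) (toTest (sinFun k)) = (0 : ℝ) := by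
  rw [inner_toTest_toTest]
  have e : ∀ t, cosFun j t * sinFun k t =
      Real.sin (2 * Real.pi * (((j : ℕ) : ℤ) + ((k : ℕ) : ℤ) : ℤ) * t) -
        Real.sin (2 * Real.pi * (((j : ℕ) : ℤ) - ((k : ℕ) : ℤ) : ℤ) * t) := by
    intro t
    push_cast
    rw [cosFun_apply, sinFun_apply, mul_sub, mul_add, sub_mul, add_mul, Real.sin_sub, Real.sin_add]
    have := Real.mul_self_sqrt (show (0 : ℝ) ≤ 2 by norm_num)
    linear_combination (Real.cos (2 * Real.pi * (j : ℕ) * t) *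
      Real.sin (2 * Real.pi * (k : ℕ) * t)) * this
  simp_rw [e]
  rw [intervalIntegral.integral_sub (Continuous.intervalIntegrable (by fun_prop) _ _)
    (Continuous.intervalIntegrable (by fun_prop) _ _), integral_sin_two_pi_int,
    integral_sin_two_pi_int, sub_zero]

/-- The trigonometric series with cosine coefficients `a` and sine coefficients `b`. -/
def trigSeries (a b : ℕ+ → ℝ) : ℝ →ᵇ ℝ := ∑' k, (a k • cosFun k + b k • sinFun k)

section TrigSeries

variable {a b : ℕ+ → ℝ}

theorem hasSum_trigSeries (h : Summable fun k => |a k| + |b k|) :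
    HasSum (fun k => a k • cosFun k + b k • sinFun k) (trigSeries a b) := by
  refine Summable.hasSum (Summable.of_norm_bounded (h.mul_right (√2)) fun k => ?_)
  refine (norm_add_le _ _).trans ?_
  rw [norm_smul, norm_smul, Real.norm_eq_abs, Real.norm_eq_abs, add_mul]
  gcongr
  · exact norm_cosFun_le k
  · exact norm_sinFun_le k

theorem hasSum_trigSeries_apply (h : Summable fun k => |a k| + |b k|) (t : ℝ) :
    HasSum (fun k => a k * cosFun k t + b k * sinFun k t) (trigSeries a b t) := by
  have := (hasSum_trigSeries h).mapL (BoundedContinuousFunction.evalCLM ℝ t)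
  simpa using this

theorem hasSum_toTest_trigSeries (h : Summable fun k => |a k| + |b k|) :
    HasSum (fun k => a k • toTest (cosFun k) + b k • toTest (sinFun k))
      (toTest (trigSeries a b)) := by
  have := (hasSum_trigSeries h).mapL toTest
  simpa using this

theorem inner_cosFun_trigSeries (h : Summable fun k => |a k| + |b k|) (j : ℕ+) :
    inner ℝ (toTest (cosFun j)) (toTest (trigSeries a b)) = a j := by
  have h1 := (hasSum_toTest_trigSeries h).mapL (innerSL ℝ (toTest (cosFun j)))
  have h2 : ∀ k : ℕ+, innerSL ℝ (toTest (cosFun j))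
      (a k • toTest (cosFun k) + b k • toTest (sinFun k)) = if k = j then a j else 0 := by
    intro k
    rw [innerSL_apply_apply, inner_add_right, inner_smul_right, inner_smul_right,
      inner_cosFun_cosFun, inner_cosFun_sinFun]
    by_cases hk : k = j
    · subst hk
      simp
    · simp [hk, Ne.symm hk]
  simp only [h2] at h1
  have h3 := hasSum_ite_eq j (a j)
  rw [← innerSL_apply_apply ℝ]
  exact h1.unique h3

theorem inner_sinFun_trigSeries (h : Summable fun k => |a k| + |b k|) (j : ℕ+) :
    inner ℝ (toTest (sinFun j)) (toTest (trigSeries a b)) = b j := by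
  have h1 := (hasSum_toTest_trigSeries h).mapL (innerSL ℝ (toTest (sinFun j)))
  have h2 : ∀ k : ℕ+, innerSL ℝ (toTest (sinFun j))
      (a k • toTest (cosFun k) + b k • toTest (sinFun k)) = if k = j then b j else 0 := by
    intro k
    rw [innerSL_apply_apply, inner_add_right, inner_smul_right, inner_smul_right,
      inner_sinFun_sinFun, real_inner_comm, inner_cosFun_sinFun]
    by_cases hk : k = j
    · subst hk
      simp
    · simp [hk, Ne.symm hk]
  simp only [h2] at h1
  have h3 := hasSum_ite_eq j (b j)
  rw [← innerSL_apply_apply ℝ]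
  exact h1.unique h3

theorem hasSum_norm_sq_trigSeries (h : Summable fun k => |a k| + |b k|) :
    HasSum (fun k => a k ^ 2 + b k ^ 2) (‖toTest (trigSeries a b)‖ ^ 2) := by
  have h1 := (hasSum_toTest_trigSeries h).mapL (innerSL ℝ (toTest (trigSeries a b)))
  rw [innerSL_apply_apply, real_inner_self_eq_norm_sq] at h1
  refine h1.congr_fun fun k => ?_
  rw [innerSL_apply_apply, inner_add_right, inner_smul_right, inner_smul_right,
    real_inner_comm, inner_cosFun_trigSeries h, real_inner_comm, inner_sinFun_trigSeries h]
  ring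

theorem integral_trigSeries_sq (h : Summable fun k => |a k| + |b k|) :
    ∫ t in (-1 / 2 : ℝ)..(1 / 2), trigSeries a b t ^ 2 = ∑' k, (a k ^ 2 + b k ^ 2) := by
  rw [(hasSum_norm_sq_trigSeries h).tsum_eq, ← real_inner_self_eq_norm_sq, inner_toTest_toTest]
  simp_rw [sq]

end TrigSeries

/-- The cosine series `√2 ∑ c_k cos(2πkt)`. -/
def cosSeries (c : ℕ+ → ℝ) (t : ℝ) : ℝ := ∑' k, c k * cosFun k t

section CosSeries

variable {c : ℕ+ → ℝ}

theorem summable_abs_of_weighted (hc : Summable fun k : ℕ+ => (k : ℝ) * |c k|) :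
    Summable fun k => |c k| :=
  Summable.of_nonneg_of_le (fun _ => abs_nonneg _)
    (fun k => le_mul_of_one_le_left (abs_nonneg _) (one_le_pnat_cast k)) hc

theorem summable_cosSeries (hc : Summable fun k => |c k|) (t : ℝ) :
    Summable fun k => c k * cosFun k t := by
  refine Summable.of_norm_bounded (hc.mul_right (√2)) fun k => ?_
  rw [Real.norm_eq_abs, abs_mul]
  refine mul_le_mul_of_nonneg_left ?_ (abs_nonneg _)
  exact ((cosFun k).norm_coe_le_norm t).trans (norm_cosFun_le k)

/-- By the addition formula a shift turns c_k into the pair (c_k cos, c_k sin) of the angle 2πkθ.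
Pairing it with the noise produces c_k times `rotCos`. -/
theorem cosSeries_sub (hc : Summable fun k => |c k|) (t θ : ℝ) :
    (Summable fun k : ℕ+ => |c k * Real.cos (2 * Real.pi * (k : ℕ) * θ)| +
      |c k * Real.sin (2 * Real.pi * (k : ℕ) * θ)|) ∧
    cosSeries c (t - θ) = trigSeries (fun k => c k * Real.cos (2 * Real.pi * (k : ℕ) * θ))
      (fun k => c k * Real.sin (2 * Real.pi * (k : ℕ) * θ)) t := by
  have hs : Summable fun k : ℕ+ => |c k * Real.cos (2 * Real.pi * (k : ℕ) * θ)| +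
      |c k * Real.sin (2 * Real.pi * (k : ℕ) * θ)| := by
    refine Summable.of_nonneg_of_le (fun k => by positivity) (fun k => ?_) (hc.mul_right 2)
    rw [abs_mul, abs_mul]
    have h1 := mul_le_of_le_one_right (abs_nonneg (c k))
      (Real.abs_cos_le_one (2 * Real.pi * (k : ℕ) * θ))
    have h2 := mul_le_of_le_one_right (abs_nonneg (c k))
      (Real.abs_sin_le_one (2 * Real.pi * (k : ℕ) * θ))
    linarith
  refine ⟨hs, ?_⟩
  rw [← (hasSum_trigSeries_apply hs t).tsum_eq]
  refine tsum_congr fun k => ?_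
  rw [cosFun_apply, cosFun_apply, sinFun_apply, mul_sub, Real.cos_sub]
  ring

theorem cosCoeff_cosSeries (hc : Summable fun k => |c k|) (k : ℕ+) :
    cosCoeff (cosSeries c) k = c k := by
  have hs : Summable fun k => |c k| + |(fun _ : ℕ+ => (0 : ℝ)) k| := by simpa using hc
  have h1 : ∀ t, cosSeries c t = trigSeries c (fun _ => 0) t := by
    intro t
    rw [← (hasSum_trigSeries_apply hs t).tsum_eq]
    exact tsum_congr fun _ => by simp
  rw [← inner_cosFun_trigSeries hs k, inner_toTest_toTest, cosCoeff,
    ← intervalIntegral.integral_const_mul]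
  refine intervalIntegral.integral_congr fun t _ => ?_
  simp only [h1, cosFun_apply]
  ring

theorem tendsto_sum_Icc {g : ℕ → ℝ} {s : ℝ} (h : HasSum (fun k : ℕ+ => g k) s) :
    Tendsto (fun n => ∑ k ∈ Finset.Icc 1 n, g k) atTop (𝓝 s) := by
  have h1 : HasSum (fun n : ℕ => g (n + 1)) s := by
    have := (Equiv.pnatEquivNat.symm.hasSum_iff (f := fun k : ℕ+ => g k)).2 h
    exact this
  have h2 := h1.tendsto_sum_nat
  refine h2.congr fun n => ?_
  induction n with
  | zero => simp
  | succ n ih => rw [Finset.sum_range_succ, Finset.sum_Icc_succ_top (by omega), ih]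

theorem hasCosineExpansion_cosSeries (hc : Summable fun k => |c k|) :
    HasCosineExpansion (cosSeries c) := by
  intro t
  have h1 : HasSum (fun k : ℕ+ => √2 * (cosCoeff (cosSeries c) k *
      Real.cos (2 * Real.pi * (k : ℕ) * t))) (cosSeries c t) := by
    refine (summable_cosSeries hc t).hasSum.congr_fun fun k => ?_
    rw [cosCoeff_cosSeries hc, cosFun_apply]
    ring
  have := tendsto_sum_Icc
    (g := fun k => √2 * (cosCoeff (cosSeries c) k * Real.cos (2 * Real.pi * k * t))) h1
  simpa only [Finset.mul_sum] using this

theorem HasCosineExpansion.eq_cosSeries {f : ℝ → ℝ} (hf : HasCosineExpansion f)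
    (hs : Summable fun k : ℕ+ => |cosCoeff f k|) : f = cosSeries fun k => cosCoeff f k := by
  funext t
  refine tendsto_nhds_unique (hf t) ?_
  have h1 : HasSum (fun k : ℕ+ => √2 * (cosCoeff f k *
      Real.cos (2 * Real.pi * (k : ℕ) * t))) (cosSeries (fun k => cosCoeff f k) t) := by
    refine (summable_cosSeries hs t).hasSum.congr_fun fun k => ?_
    rw [cosFun_apply]
    ring
  have := tendsto_sum_Icc
    (g := fun k => √2 * (cosCoeff f k * Real.cos (2 * Real.pi * k * t))) h1
  simpa only [Finset.mul_sum] using this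

/-- Weighted summability permits termwise differentiation, and Parseval's identity for the resulting
sine series gives the value. -/
theorem fisherInfo_cosSeries (hc : Summable fun k : ℕ+ => (k : ℝ) * |c k|) (ε : ℝ) :
    fisherInfo ε (cosSeries c) = derivSq c / ε ^ 2 := by
  have hs : Summable fun k : ℕ+ => |(fun _ => (0 : ℝ)) k| + |-(2 * Real.pi * (k : ℕ) * c k)| := by
    refine (hc.mul_left (2 * Real.pi)).congr fun k => ?_
    rw [abs_zero, zero_add, abs_neg, abs_mul,
      abs_of_nonneg (show (0 : ℝ) ≤ 2 * Real.pi * (k : ℕ) by positivity)]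
    ring
  have hd : ∀ t, HasDerivAt (cosSeries c)
      (trigSeries (fun _ => 0) (fun k : ℕ+ => -(2 * Real.pi * (k : ℕ) * c k)) t) t := by
    intro t
    rw [← (hasSum_trigSeries_apply hs t).tsum_eq]
    refine hasDerivAt_tsum (u := fun k : ℕ+ => 2 * Real.pi * √2 * ((k : ℝ) * |c k|))
      (g := fun k t => c k * cosFun k t)
      (g' := fun k t => 0 * cosFun k t + -(2 * Real.pi * (k : ℕ) * c k) * sinFun k t) (y₀ := 0)
      (hc.mul_left _) (fun k t => ?_) (fun k t => ?_)
      (summable_cosSeries (summable_abs_of_weighted hc) 0) t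
    · have h0 : HasDerivAt (fun t : ℝ => 2 * Real.pi * (k : ℕ) * t) (2 * Real.pi * (k : ℕ)) t := by
        simpa using (hasDerivAt_id t).const_mul (2 * Real.pi * ((k : ℕ) : ℝ))
      refine ((h0.cos.const_mul (√2)).const_mul (c k)).congr_deriv ?_
      rw [sinFun_apply]
      ring
    · rw [zero_mul, zero_add, Real.norm_eq_abs, abs_mul, abs_neg, abs_mul,
        abs_of_nonneg (show (0 : ℝ) ≤ 2 * Real.pi * (k : ℕ) by positivity)]
      have : |sinFun k t| ≤ √2 := ((sinFun k).norm_coe_le_norm t).trans (norm_sinFun_le k)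
      calc 2 * Real.pi * (k : ℕ) * |c k| * |sinFun k t| ≤ 2 * Real.pi * (k : ℕ) * |c k| * √2 :=
            mul_le_mul_of_nonneg_left this (by positivity)
        _ = _ := by ring
  rw [fisherInfo]
  simp_rw [fun t => (hd t).deriv]
  rw [integral_trigSeries_sq hs, derivSq, mul_comm, ← div_eq_mul_inv]
  congr 1
  exact tsum_congr fun k => by ring

theorem sobolevSq_eq (f : ℝ → ℝ) (n : ℕ) :
    sobolevSq f n = ∑' k : ℕ+, ENNReal.ofReal ((2 * Real.pi * (k : ℕ)) ^ (2 * n) * cosCoeff f k ^ 2) := by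
  refine tsum_congr fun k => ?_
  congr 2
  rw [← Real.rpow_natCast]
  push_cast
  rfl

/-- The inequality k|c_k| = (k²|c_k|)(1/k) ≤ k⁴c_k² + 1/k² converts the bound on the second
derivative into the summability used for all noise series. -/
theorem summable_weighted_of_sobolevSq {f : ℝ → ℝ} (hf : sobolevSq f 2 ≠ ∞) :
    Summable fun k : ℕ+ => (k : ℝ) * |cosCoeff f k| := by
  have h0 := sobolevSq_eq f 2
  push_cast at h0
  rw [h0] at hf
  have h1 := ENNReal.summable_toReal hf
  have h2 : Summable fun k : ℕ+ => 1 / ((k : ℕ) : ℝ) ^ 2 :=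
    (Real.summable_one_div_nat_pow.2 (by norm_num : 1 < 2)).comp_injective PNat.coe_injective
  refine Summable.of_nonneg_of_le (fun k => by positivity) (fun k => ?_) (h1.add h2)
  rw [ENNReal.toReal_ofReal (by positivity)]
  have hk := one_le_pnat_cast k
  set x : ℝ := (k : ℝ) with hx
  have hpi : 1 ≤ (2 * Real.pi) ^ 4 := one_le_pow₀ (by linarith [Real.pi_gt_three])
  have h3 : x ^ 4 * cosCoeff f k ^ 2 ≤ (2 * Real.pi * x) ^ (2 * 2) * cosCoeff f k ^ 2 := by
    have h5 : 0 ≤ x ^ 4 * cosCoeff f k ^ 2 := by positivity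
    calc x ^ 4 * cosCoeff f k ^ 2 ≤ (2 * Real.pi) ^ 4 * (x ^ 4 * cosCoeff f k ^ 2) :=
          le_mul_of_one_le_left h5 hpi
      _ = _ := by ring
  have h4 : x * |cosCoeff f k| ≤ x ^ 4 * cosCoeff f k ^ 2 + 1 / x ^ 2 := by
    have h5 : (x ^ 2 * |cosCoeff f k|) ^ 2 = x ^ 4 * cosCoeff f k ^ 2 := by
      rw [mul_pow, sq_abs]
      ring
    have h6 : x * |cosCoeff f k| = (x ^ 2 * |cosCoeff f k|) * (1 / x) := by
      field_simp
    have h7 : 1 / x ^ 2 = (1 / x) ^ 2 := by ring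
    rw [← h5, h6, h7]
    nlinarith [sq_nonneg (x ^ 2 * |cosCoeff f k| - 1 / x), sq_nonneg (x ^ 2 * |cosCoeff f k|),
      sq_nonneg (1 / x)]
  exact h4.trans (by gcongr)

end CosSeries

/-! ### Noise coordinates and the likelihood of a shifted signal -/

section Noise

variable {Ω : Type*} {N : TestFun → Ω → ℝ}

/-- The sum that controls the convergence of noise series with coefficients bounded by `C`. -/
def noiseSum (N : TestFun → Ω → ℝ) (C : ℕ+ → ℝ) (ω : Ω) : ℝ≥0∞ :=
  ∑' k : ℕ+, ENNReal.ofReal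
    ((k : ℝ) * C k * (|N (toTest (cosFun k)) ω| + |N (toTest (sinFun k)) ω|))

/-- The noise in the coordinates `√2 cos(2πkt)`, set to zero where noise series diverge. -/
def noiseCos (N : TestFun → Ω → ℝ) (C : ℕ+ → ℝ) (ω : Ω) (k : ℕ+) : ℝ :=
  {ω | noiseSum N C ω < ∞}.indicator (N (toTest (cosFun k))) ω

/-- The noise in the coordinates `√2 sin(2πkt)`, set to zero where noise series diverge. -/
def noiseSin (N : TestFun → Ω → ℝ) (C : ℕ+ → ℝ) (ω : Ω) (k : ℕ+) : ℝ :=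
  {ω | noiseSum N C ω < ∞}.indicator (N (toTest (sinFun k))) ω

/-- The shift by `θ` of the cosine series with coefficients `c`, as a test function. -/
def shiftTest (c : ℕ+ → ℝ) (θ : ℝ) : TestFun :=
  toTest (trigSeries (fun k => c k * Real.cos (2 * Real.pi * (k : ℕ) * θ))
    (fun k => c k * Real.sin (2 * Real.pi * (k : ℕ) * θ)))

theorem observation_cosSeries {c : ℕ+ → ℝ} (hc : Summable fun k => |c k|) (ε θ : ℝ) (ω : Ω) :
    observation N ε θ (cosSeries c) ω = fun φ => inner ℝ φ (shiftTest c θ) + ε * N φ ω := by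
  funext φ
  rw [observation, shiftTest, inner_toTest]
  simp_rw [fun t => (cosSeries_sub hc t θ).2]

theorem norm_sq_shiftTest {c : ℕ+ → ℝ} (hc : Summable fun k => |c k|) (θ : ℝ) :
    ‖shiftTest c θ‖ ^ 2 = ∑' k, c k ^ 2 := by
  rw [shiftTest, ← (hasSum_norm_sq_trigSeries (cosSeries_sub hc 0 θ).1).tsum_eq]
  refine tsum_congr fun k => ?_
  rw [mul_pow, mul_pow, ← mul_add, Real.cos_sq_add_sin_sq, mul_one]

namespace IsWhiteNoise

variable [MeasurableSpace Ω] {P : Measure Ω}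

theorem lintegral_abs_le (hN : IsWhiteNoise N P) [IsProbabilityMeasure P] {φ : TestFun}
    (hφ : inner ℝ φ φ = (1 : ℝ)) : ∫⁻ ω, ENNReal.ofReal |N φ ω| ∂P ≤ ENNReal.ofReal 2 := by
  calc ∫⁻ ω, ENNReal.ofReal |N φ ω| ∂P ≤ ∫⁻ ω, ENNReal.ofReal (1 + N φ ω * N φ ω) ∂P := by
        refine lintegral_mono fun ω => ENNReal.ofReal_le_ofReal ?_
        rw [← abs_mul_abs_self (N φ ω)]
        nlinarith [sq_nonneg (|N φ ω| - 1), abs_nonneg (N φ ω)]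
    _ = ENNReal.ofReal 2 := by
        have i : Integrable (fun ω => N φ ω * N φ ω) P :=
          (hN.memLp_two φ).integrable_mul (hN.memLp_two φ)
        refine (ofReal_integral_eq_lintegral_ofReal ((integrable_const 1).add i)
          (ae_of_all _ fun ω => add_nonneg zero_le_one (mul_self_nonneg _))).symm.trans ?_
        congr 1
        refine (integral_add (integrable_const 1) i).trans ?_
        rw [hN.integral_mul, hφ, integral_const, probReal_univ, one_smul]
        norm_num

variable {C : ℕ+ → ℝ}

theorem measurable_noiseSum (hN : IsWhiteNoise N P) (C : ℕ+ → ℝ) : Measurable (noiseSum N C) := by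
  have := hN.measurable
  unfold noiseSum
  fun_prop

theorem ae_noiseSum_lt_top (hN : IsWhiteNoise N P) [IsProbabilityMeasure P] (hC : ∀ k, 0 ≤ C k)
    (hCs : Summable fun k : ℕ+ => (k : ℝ) * C k) : ∀ᵐ ω ∂P, noiseSum N C ω < ∞ := by
  have hm := hN.measurable
  refine ae_lt_top (hN.measurable_noiseSum C) (ne_top_of_le_ne_top (b := ∑' k : ℕ+,
    ENNReal.ofReal (4 * ((k : ℝ) * C k))) ?_ ?_)
  · exact (hCs.mul_left 4).tsum_ofReal_ne_top
  · unfold noiseSum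
    rw [lintegral_tsum fun k => by fun_prop]
    refine ENNReal.tsum_le_tsum fun k => ?_
    have hk : 0 ≤ (k : ℝ) * C k := mul_nonneg (by positivity) (hC k)
    calc ∫⁻ ω, ENNReal.ofReal ((k : ℝ) * C k *
          (|N (toTest (cosFun k)) ω| + |N (toTest (sinFun k)) ω|)) ∂P
        = ENNReal.ofReal ((k : ℝ) * C k) * (∫⁻ ω, ENNReal.ofReal |N (toTest (cosFun k)) ω| ∂P +
          ∫⁻ ω, ENNReal.ofReal |N (toTest (sinFun k)) ω| ∂P) := by
          rw [← lintegral_add_left (by fun_prop), ← lintegral_const_mul _ (by fun_prop)]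
          refine lintegral_congr fun ω => ?_
          rw [ENNReal.ofReal_mul hk, ENNReal.ofReal_add (abs_nonneg _) (abs_nonneg _)]
      _ ≤ ENNReal.ofReal ((k : ℝ) * C k) * (ENNReal.ofReal 2 + ENNReal.ofReal 2) := by
          gcongr
          · exact hN.lintegral_abs_le ((inner_cosFun_cosFun k k).trans (if_pos rfl))
          · exact hN.lintegral_abs_le ((inner_sinFun_sinFun k k).trans (if_pos rfl))
      _ = ENNReal.ofReal (4 * ((k : ℝ) * C k)) := by
          rw [← ENNReal.ofReal_add (by norm_num) (by norm_num), ← ENNReal.ofReal_mul hk]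
          congr 1
          ring

theorem measurable_noiseCos (hN : IsWhiteNoise N P) (C : ℕ+ → ℝ) : Measurable (noiseCos N C) :=
  measurable_pi_lambda _ fun _ => (hN.measurable _).indicator
    (measurableSet_lt (hN.measurable_noiseSum C) measurable_const)

theorem measurable_noiseSin (hN : IsWhiteNoise N P) (C : ℕ+ → ℝ) : Measurable (noiseSin N C) :=
  measurable_pi_lambda _ fun _ => (hN.measurable _).indicator
    (measurableSet_lt (hN.measurable_noiseSum C) measurable_const)

theorem ae_noise_eq (hN : IsWhiteNoise N P) [IsProbabilityMeasure P] (hC : ∀ k, 0 ≤ C k)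
    (hCs : Summable fun k : ℕ+ => (k : ℝ) * C k) :
    ∀ᵐ ω ∂P, noiseCos N C ω = (fun k => N (toTest (cosFun k)) ω) ∧
      noiseSin N C ω = fun k => N (toTest (sinFun k)) ω := by
  filter_upwards [hN.ae_noiseSum_lt_top hC hCs] with ω hω
  exact ⟨funext fun k => indicator_of_mem (s := {ω | noiseSum N C ω < ∞}) hω _,
    funext fun k => indicator_of_mem (s := {ω | noiseSum N C ω < ∞}) hω _⟩

end IsWhiteNoise

/-- Setting the coordinates to zero on the null event of divergence gives summability for every ω,
so the pathwise calculus in the shift needs no exceptional sets. -/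
theorem summable_noise {C : ℕ+ → ℝ} (hC : ∀ k, 0 ≤ C k) (ω : Ω) :
    Summable fun k : ℕ+ => (k : ℝ) * C k * (|noiseCos N C ω k| + |noiseSin N C ω k|) := by
  by_cases hω : noiseSum N C ω < ∞
  · have h1 := ENNReal.summable_toReal hω.ne
    refine h1.congr fun k => ?_
    rw [noiseCos, noiseSin, indicator_of_mem (s := {ω | noiseSum N C ω < ∞}) hω,
      indicator_of_mem (s := {ω | noiseSum N C ω < ∞}) hω, ENNReal.toReal_ofReal]
    exact mul_nonneg (mul_nonneg (by positivity) (hC k)) (by positivity)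
  · refine summable_zero.congr fun k => ?_
    rw [noiseCos, noiseSin, indicator_of_notMem (s := {ω | noiseSum N C ω < ∞}) hω,
      indicator_of_notMem (s := {ω | noiseSum N C ω < ∞}) hω]
    simp

theorem summable_weighted_of_le {c C : ℕ+ → ℝ} {M : ℝ} (hc : ∀ k, |c k| ≤ M * C k)
    (hCs : Summable fun k : ℕ+ => (k : ℝ) * C k) : Summable fun k : ℕ+ => (k : ℝ) * |c k| := by
  refine Summable.of_nonneg_of_le (fun k => by positivity) (fun k => ?_) (hCs.mul_left M)
  rw [mul_left_comm]
  exact mul_le_mul_of_nonneg_left (hc k) (by positivity)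

theorem summable_mul_rotCos {c C x y : ℕ+ → ℝ} {M : ℝ}
    (hc : ∀ k, |c k| ≤ M * C k)
    (h : Summable fun k : ℕ+ => (k : ℝ) * C k * (|x k| + |y k|)) (θ : ℝ) :
    Summable fun k => c k * rotCos θ x y k := by
  refine Summable.of_norm_bounded (h.mul_left M) fun k => ?_
  rw [Real.norm_eq_abs, abs_mul]
  have h1 : |rotCos θ x y k| ≤ |x k| + |y k| := by
    refine (abs_add_le _ _).trans ?_
    rw [abs_mul, abs_mul]
    exact add_le_add (mul_le_of_le_one_left (abs_nonneg _) (Real.abs_cos_le_one _))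
      (mul_le_of_le_one_left (abs_nonneg _) (Real.abs_sin_le_one _))
  have h2 : |c k| ≤ M * ((k : ℝ) * C k) := by
    have h3 := mul_le_mul_of_nonneg_left (hc k) (show (0 : ℝ) ≤ (k : ℝ) by positivity)
    have h4 := le_mul_of_one_le_left (abs_nonneg (c k)) (one_le_pnat_cast k)
    linarith
  rw [← mul_assoc]
  exact mul_le_mul h2 h1 (abs_nonneg _) ((abs_nonneg _).trans h2)

namespace IsWhiteNoise

variable [MeasurableSpace Ω] {P : Measure Ω}

variable {c C : ℕ+ → ℝ} {M : ℝ}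

/-- The noise tested against a shifted signal is rewritten as a pathwise series in the rotated
coordinates, the only place where the shift then enters. -/
theorem ae_shiftTest_eq (hN : IsWhiteNoise N P) [IsProbabilityMeasure P]
    (hC : ∀ k, 0 ≤ C k) (hc : ∀ k, |c k| ≤ M * C k)
    (hCs : Summable fun k : ℕ+ => (k : ℝ) * C k) (θ : ℝ) :
    N (shiftTest c θ) =ᵐ[P] fun ω => ∑' k, c k * rotCos θ (noiseCos N C ω) (noiseSin N C ω) k := by
  have hcs := summable_abs_of_weighted (summable_weighted_of_le hc hCs)
  have hterm : ∀ᵐ ω ∂P, ∀ k : ℕ+,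
      N ((c k * Real.cos (2 * Real.pi * (k : ℕ) * θ)) • toTest (cosFun k) +
        (c k * Real.sin (2 * Real.pi * (k : ℕ) * θ)) • toTest (sinFun k)) ω =
      c k * rotCos θ (noiseCos N C ω) (noiseSin N C ω) k := by
    rw [ae_all_iff]
    intro k
    filter_upwards [hN.ae_eq_combination (c k * Real.cos (2 * Real.pi * (k : ℕ) * θ))
      (c k * Real.sin (2 * Real.pi * (k : ℕ) * θ)) (toTest (cosFun k)) (toTest (sinFun k)),
      hN.ae_noise_eq hC hCs] with ω h1 h2
    rw [h1, h2.1, h2.2, rotCos]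
    ring
  have h := hN.ae_eq_tsum (hasSum_toTest_trigSeries (cosSeries_sub hcs 0 θ).1) (by
    filter_upwards [hterm] with ω hω
    simp_rw [hω]
    exact summable_mul_rotCos hc (summable_noise hC ω) θ)
  filter_upwards [h, hterm] with ω h1 h2
  rw [shiftTest, h1]
  exact tsum_congr h2

/-- The Cameron–Martin formula in coordinates: the data become pure noise, the same for all shifts
and signals, and all dependence moves into the likelihood. The drift must be nonzero, since its
direction is split off from the noise. -/
theorem lintegral_observation (hN : IsWhiteNoise N P) [IsProbabilityMeasure P]
    (hC : ∀ k, 0 ≤ C k) (hc : ∀ k, |c k| ≤ M * C k)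
    (hCs : Summable fun k : ℕ+ => (k : ℝ) * C k) (hc0 : c ≠ 0) {ε : ℝ}
    (hε : ε ≠ 0) (θ : ℝ) {F : (TestFun → ℝ) → ℝ≥0∞} (hF : Measurable F) :
    ∫⁻ ω, F (observation N ε θ (cosSeries c) ω) ∂P = ∫⁻ ω, F (fun φ => ε * N φ ω) *
      ENNReal.ofReal (likelihood ε c (rotCos θ (noiseCos N C ω) (noiseSin N C ω))) ∂P := by
  have hcs := summable_abs_of_weighted (summable_weighted_of_le hc hCs)
  have hs0 : shiftTest c θ ≠ 0 := by
    intro h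
    have h1 := norm_sq_shiftTest hcs θ
    rw [h, norm_zero] at h1
    have hsq : Summable fun k => c k ^ 2 := by
      simpa using summable_sq_of_summable (fun k => abs_nonneg (c k)) hcs
    have h2 := (hsq.hasSum_iff.2 h1.symm)
    rw [zero_pow two_ne_zero, hasSum_zero_iff_of_nonneg fun k => sq_nonneg _] at h2
    refine hc0 (funext fun k => ?_)
    simpa using congrFun h2 k
  simp_rw [observation_cosSeries hcs]
  rw [hN.lintegral_drift hs0 hε hF]
  refine lintegral_congr_ae ?_
  filter_upwards [hN.ae_shiftTest_eq hC hc hCs θ] with ω hω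
  rw [hω, norm_sq_shiftTest hcs, likelihood]

theorem lintegral_likelihood (hN : IsWhiteNoise N P) [IsProbabilityMeasure P]
    (hC : ∀ k, 0 ≤ C k) (hc : ∀ k, |c k| ≤ M * C k)
    (hCs : Summable fun k : ℕ+ => (k : ℝ) * C k) (hc0 : c ≠ 0) {ε : ℝ}
    (hε : ε ≠ 0) (θ : ℝ) :
    ∫⁻ ω, ENNReal.ofReal (likelihood ε c (rotCos θ (noiseCos N C ω) (noiseSin N C ω))) ∂P = 1 := by
  have := hN.lintegral_observation hC hc hCs hc0 hε θ (F := fun _ => 1) measurable_const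
  simpa using this.symm

theorem normalizedRisk_cosSeries (hN : IsWhiteNoise N P) [IsProbabilityMeasure P]
    (hC : ∀ k, 0 ≤ C k) (hc : ∀ k, |c k| ≤ M * C k)
    (hCs : Summable fun k : ℕ+ => (k : ℝ) * C k) (hc0 : c ≠ 0) {ε : ℝ}
    (hε : ε ≠ 0) (θ : ℝ) {T : (TestFun → ℝ) → ℝ} (hT : Measurable T) :
    normalizedRisk P N T ε θ (cosSeries c) =
      ∫⁻ ω, ENNReal.ofReal ((T (fun φ => ε * N φ ω) - θ) ^ 2 * (derivSq c / ε ^ 2)) *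
        ENNReal.ofReal (likelihood ε c (rotCos θ (noiseCos N C ω) (noiseSin N C ω))) ∂P := by
  have hcs := summable_weighted_of_le hc hCs
  rw [normalizedRisk, fisherInfo_cosSeries hcs]
  exact hN.lintegral_observation hC hc hCs hc0 hε θ
    (F := fun x => ENNReal.ofReal ((T x - θ) ^ 2 * (derivSq c / ε ^ 2))) (by fun_prop)

theorem indepFun_rot_noise (hN : IsWhiteNoise N P) [IsProbabilityMeasure P] (hC : ∀ k, 0 ≤ C k)
    (hCs : Summable fun k : ℕ+ => (k : ℝ) * C k) (θ : ℝ) :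
    IndepFun (fun ω => rotCos θ (noiseCos N C ω) (noiseSin N C ω))
      (fun ω => rotSin θ (noiseCos N C ω) (noiseSin N C ω)) P := by
  refine (hN.indepFun_rotation inner_cosFun_cosFun inner_sinFun_sinFun inner_cosFun_sinFun θ).congr
    ?_ ?_ <;>
  filter_upwards [hN.ae_noise_eq hC hCs] with ω h <;> rw [h.1, h.2]

theorem ae_rotSin_noise (hN : IsWhiteNoise N P) [IsProbabilityMeasure P] (hC : ∀ k, 0 ≤ C k)
    (hCs : Summable fun k : ℕ+ => (k : ℝ) * C k) (θ : ℝ) :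
    ∀ᵐ ω ∂P, rotSin θ (fun k => N (toTest (cosFun k)) ω) (fun k => N (toTest (sinFun k)) ω) =
      rotSin θ (noiseCos N C ω) (noiseSin N C ω) := by
  filter_upwards [hN.ae_noise_eq hC hCs] with ω h
  rw [h.1, h.2]

theorem memLp_rotSin_noise (hN : IsWhiteNoise N P) [IsProbabilityMeasure P] (hC : ∀ k, 0 ≤ C k)
    (hCs : Summable fun k : ℕ+ => (k : ℝ) * C k) (θ : ℝ) (k : ℕ+) :
    MemLp (fun ω => rotSin θ (noiseCos N C ω) (noiseSin N C ω) k) 2 P := by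
  have h : MemLp (fun ω => rotSin θ (fun k => N (toTest (cosFun k)) ω)
      (fun k => N (toTest (sinFun k)) ω) k) 2 P :=
    ((hN.memLp_two _).const_mul _).add ((hN.memLp_two _).const_mul _)
  refine h.ae_eq ?_
  filter_upwards [hN.ae_rotSin_noise hC hCs θ] with ω hω
  rw [hω]

theorem integral_rotSin_noise (hN : IsWhiteNoise N P) [IsProbabilityMeasure P]
    (hC : ∀ k, 0 ≤ C k) (hCs : Summable fun k : ℕ+ => (k : ℝ) * C k) (θ : ℝ) (k : ℕ+) :
    ∫ ω, rotSin θ (noiseCos N C ω) (noiseSin N C ω) k ∂P = 0 := by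
  rw [← hN.integral_rotSin (e := fun k => toTest (cosFun k)) (d := fun k => toTest (sinFun k)) θ k]
  refine integral_congr_ae ?_
  filter_upwards [hN.ae_rotSin_noise hC hCs θ] with ω hω
  rw [hω]

theorem integral_rotSin_noise_mul (hN : IsWhiteNoise N P) [IsProbabilityMeasure P]
    (hC : ∀ k, 0 ≤ C k) (hCs : Summable fun k : ℕ+ => (k : ℝ) * C k) (θ : ℝ) (j k : ℕ+) :
    ∫ ω, rotSin θ (noiseCos N C ω) (noiseSin N C ω) j *
      rotSin θ (noiseCos N C ω) (noiseSin N C ω) k ∂P = if j = k then 1 else 0 := by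
  rw [← hN.integral_rotSin_mul inner_cosFun_cosFun inner_sinFun_sinFun inner_cosFun_sinFun θ j k]
  refine integral_congr_ae ?_
  filter_upwards [hN.ae_rotSin_noise hC hCs θ] with ω hω
  rw [hω]

end IsWhiteNoise

end Noise

/-! ### Gaussian priors on finitely many coefficients -/

/-- Under a centred Gaussian weight tilted by a Gaussian likelihood, no point approximates the
parameter better than the posterior variance. -/
theorem le_lintegral_tilted_gaussian {s : ℝ≥0} (hs : s ≠ 0) {ε : ℝ} (hε : 0 < ε) (t a : ℝ) :
    ENNReal.ofReal (ε ^ 2 * (s / (s + ε ^ 2))) *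
        ∫⁻ x, ENNReal.ofReal (Real.exp (t * x - x ^ 2 / (2 * ε ^ 2))) ∂gaussianReal 0 s ≤
      ∫⁻ x, ENNReal.ofReal ((x - a) ^ 2) *
        ENNReal.ofReal (Real.exp (t * x - x ^ 2 / (2 * ε ^ 2))) ∂gaussianReal 0 s := by
  have hs' : (0 : ℝ) < s := by
    have := s.coe_nonneg
    exact lt_of_le_of_ne this fun h => hs (by exact_mod_cast h.symm)
  -- `h` is the conjugate posterior variance (1/s + 1/ε²)⁻¹, and m = th is the posterior mean.
  -- Completing the square identifies the tilted law with N(m, h) up to the factor `D`.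
  set h : ℝ≥0 := ⟨ε ^ 2 * (s / (s + ε ^ 2)), by positivity⟩ with hh
  have hhv : (h : ℝ) = ε ^ 2 * (s / (s + ε ^ 2)) := rfl
  have hh0 : (0 : ℝ) < h := by rw [hhv]; positivity
  have hh1 : h ≠ 0 := fun h0 => by simp [h0] at hh0
  set m : ℝ := t * h with hm
  have key : ∀ x, Real.exp (t * x - x ^ 2 / (2 * ε ^ 2)) * gaussianPDFReal 0 s x =
      ((√(2 * Real.pi * s))⁻¹ * √(2 * Real.pi * h) * Real.exp (m ^ 2 / (2 * h))) *
        gaussianPDFReal m h x := by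
    intro x
    rw [gaussianPDFReal, gaussianPDFReal]
    have hpi : √(2 * Real.pi * h) ≠ 0 := by positivity
    have e1 : t * x - x ^ 2 / (2 * ε ^ 2) + -(x - 0) ^ 2 / (2 * s) =
        m ^ 2 / (2 * h) + -(x - m) ^ 2 / (2 * h) := by
      rw [hm, hhv]
      field_simp
      ring
    calc _ = (√(2 * Real.pi * s))⁻¹ *
          Real.exp (t * x - x ^ 2 / (2 * ε ^ 2) + -(x - 0) ^ 2 / (2 * s)) := by
          rw [Real.exp_add]
          ring
      _ = _ := by
          rw [e1, Real.exp_add]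
          field_simp
  set D := (√(2 * Real.pi * s))⁻¹ * √(2 * Real.pi * h) * Real.exp (m ^ 2 / (2 * h)) with hD
  have hD0 : 0 ≤ D := by positivity
  have change : ∀ {G : ℝ → ℝ≥0∞}, Measurable G →
      ∫⁻ x, G x * ENNReal.ofReal (Real.exp (t * x - x ^ 2 / (2 * ε ^ 2))) ∂gaussianReal 0 s =
        ENNReal.ofReal D * ∫⁻ x, G x ∂gaussianReal m h := by
    intro G hG
    rw [gaussianReal_of_var_ne_zero _ hs, gaussianReal_of_var_ne_zero _ hh1,
      lintegral_withDensity_eq_lintegral_mul _ (measurable_gaussianPDF _ _) (by fun_prop),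
      lintegral_withDensity_eq_lintegral_mul _ (measurable_gaussianPDF _ _) hG,
      ← lintegral_const_mul _ ((measurable_gaussianPDF _ _).mul hG)]
    refine lintegral_congr fun x => ?_
    simp only [Pi.mul_apply, gaussianPDF]
    rw [← mul_assoc (ENNReal.ofReal D), ← ENNReal.ofReal_mul hD0, ← key x,
      ENNReal.ofReal_mul (Real.exp_pos _).le]
    ring
  have h1 := change (G := fun _ => 1) measurable_const
  simp only [one_mul, lintegral_const, measure_univ, mul_one] at h1
  rw [h1, change (by fun_prop), mul_comm]
  gcongr
  have i : Integrable (fun x => (x - a) ^ 2) (gaussianReal m h) :=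
    ((memLp_id_gaussianReal 2).sub (memLp_const a)).integrable_sq
  rw [← ofReal_integral_eq_lintegral_ofReal i (ae_of_all _ fun x => sq_nonneg _)]
  refine ENNReal.ofReal_le_ofReal ?_
  have h2 : Var[fun x => id x - a; gaussianReal m h] = h := by
    rw [variance_sub_const aestronglyMeasurable_id, variance_id_gaussianReal]
  rw [← hhv, ← h2]
  exact variance_le_expectation_sq (by fun_prop)

section Sieve

variable {K : Finset ℕ+}

/-- Extension by zero of a finite coefficient vector. -/
def extendCoef (v : K → ℝ) (k : ℕ+) : ℝ := if h : k ∈ K then v ⟨k, h⟩ else 0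

theorem extendCoef_coe (v : K → ℝ) (k : K) : extendCoef v k = v k := dif_pos k.2

theorem extendCoef_of_notMem (v : K → ℝ) {k : ℕ+} (hk : k ∉ K) : extendCoef v k = 0 := dif_neg hk

theorem measurable_extendCoef (k : ℕ+) : Measurable fun v : K → ℝ => extendCoef v k := by
  unfold extendCoef
  split_ifs with h
  · exact measurable_pi_apply _
  · exact measurable_const

theorem summable_extendCoef {g : ℕ+ → ℝ → ℝ} (hg : ∀ k, g k 0 = 0) (v : K → ℝ) :
    Summable fun k => g k (extendCoef v k) :=
  summable_of_ne_finset_zero (s := K) fun k hk => by rw [extendCoef_of_notMem v hk, hg]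

theorem tsum_extendCoef {g : ℕ+ → ℝ → ℝ} (hg : ∀ k, g k 0 = 0) (v : K → ℝ) :
    ∑' k, g k (extendCoef v k) = ∑ k : K, g k (v k) := by
  rw [tsum_eq_sum (s := K) fun k hk => by rw [extendCoef_of_notMem v hk, hg],
    ← Finset.sum_coe_sort]
  exact Finset.sum_congr rfl fun k _ => by rw [extendCoef_coe]

/-- The exponent is quadratic without cross terms between distinct frequencies, so the likelihood is
a product over coordinates and posterior independence survives. -/
theorem likelihood_add_extendCoef {ε : ℝ} (hε : ε ≠ 0) {b y : ℕ+ → ℝ}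
    (hb : Summable fun k => b k ^ 2) (hby : Summable fun k => b k * y k) (v : K → ℝ) :
    likelihood ε (b + extendCoef v) y = likelihood ε b y *
      Real.exp (∑ k : K, ((ε⁻¹ * y k - b k / ε ^ 2) * v k - v k ^ 2 / (2 * ε ^ 2))) := by
  rw [likelihood, likelihood, ← Real.exp_add]
  congr 1
  have h1 : ∑' k, (b + extendCoef v) k * y k = ∑' k, b k * y k + ∑ k : K, v k * y k := by
    rw [← tsum_extendCoef (g := fun k x => x * y k) (fun k => zero_mul _) v,
      ← hby.tsum_add (summable_extendCoef (g := fun k x => x * y k) (fun k => zero_mul _) v)]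
    exact tsum_congr fun k => by rw [Pi.add_apply]; ring
  have h2 : ∑' k, (b + extendCoef v) k ^ 2 =
      ∑' k, b k ^ 2 + ∑ k : K, (2 * b k * v k + v k ^ 2) := by
    rw [← tsum_extendCoef (g := fun k x => 2 * b k * x + x ^ 2) (fun k => by ring) v,
      ← hb.tsum_add (summable_extendCoef (g := fun k x => 2 * b k * x + x ^ 2)
        (fun k => by ring) v)]
    exact tsum_congr fun k => by rw [Pi.add_apply]; ring
  have h3 : ∑ k : K, ((ε⁻¹ * y k - b k / ε ^ 2) * v k - v k ^ 2 / (2 * ε ^ 2)) =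
      ε⁻¹ * ∑ k : K, v k * y k - (∑ k : K, (2 * b k * v k + v k ^ 2)) / (2 * ε ^ 2) := by
    rw [Finset.mul_sum, Finset.sum_div, ← Finset.sum_sub_distrib]
    refine Finset.sum_congr rfl fun k _ => ?_
    field_simp
    ring
  rw [h1, h2, h3]
  ring

theorem measurable_likelihood_add_extendCoef (ε : ℝ) (b : ℕ+ → ℝ) :
    Measurable fun p : (ℕ+ → ℝ) × (K → ℝ) => likelihood ε (b + extendCoef p.2) p.1 := by
  have hm : ∀ k, Measurable fun p : (ℕ+ → ℝ) × (K → ℝ) => (b + extendCoef p.2) k := fun k =>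
    measurable_const.add ((measurable_extendCoef k).comp measurable_snd)
  refine Real.measurable_exp.comp ((Measurable.const_mul ?_ _).sub (Measurable.div_const ?_ _))
  · exact Measurable.tsum fun k => (hm k).mul ((measurable_pi_apply k).comp measurable_fst)
  · exact Measurable.tsum fun k => (hm k).pow_const 2

theorem measurable_likelihood_add_extendCoef_right (ε : ℝ) (b y : ℕ+ → ℝ) :
    Measurable fun v : K → ℝ => likelihood ε (b + extendCoef v) y := by
  have hm : ∀ k, Measurable fun v : K → ℝ => (b + extendCoef v) k := fun k =>
    measurable_const.add (measurable_extendCoef k)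
  refine Real.measurable_exp.comp ((Measurable.const_mul ?_ _).sub (Measurable.div_const ?_ _))
  · exact Measurable.tsum fun k => (hm k).mul_const _
  · exact Measurable.tsum fun k => (hm k).pow_const 2

/-- The prior under which the coefficients in `K` are independent centred Gaussian with variances
`s`. -/
def gaussianPrior (s : K → ℝ≥0) : Measure (K → ℝ) := Measure.pi fun k => gaussianReal 0 (s k)

instance (s : K → ℝ≥0) : IsProbabilityMeasure (gaussianPrior s) :=
  inferInstanceAs (IsProbabilityMeasure (Measure.pi _))

variable {s : K → ℝ≥0}

/-- Integrating out coordinate `k` alone, the other factors of the likelihood being constant,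
reduces the claim to the one-dimensional conjugate model. The variance there does not depend on the
data. -/
theorem le_lintegral_sq_sub_mul_likelihood (hs : ∀ k, s k ≠ 0) {ε : ℝ} (hε : 0 < ε) {b y : ℕ+ → ℝ}
    (hb : Summable fun k => b k ^ 2) (hby : Summable fun k => b k * y k) (k : K) (a : ℝ) :
    ENNReal.ofReal (ε ^ 2 * (s k / (s k + ε ^ 2))) *
        ∫⁻ v, ENNReal.ofReal (likelihood ε (b + extendCoef v) y) ∂gaussianPrior s ≤
      ∫⁻ v, ENNReal.ofReal ((v k - a) ^ 2) *
        ENNReal.ofReal (likelihood ε (b + extendCoef v) y) ∂gaussianPrior s := by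
  have hm := measurable_likelihood_add_extendCoef_right (K := K) ε b y
  rw [← lintegral_const_mul _ hm.ennreal_ofReal]
  refine lintegral_le_of_lmarginal_le {k} (by fun_prop) (by fun_prop) fun x => ?_
  rw [lmarginal_singleton, lmarginal_singleton]
  set t := ε⁻¹ * y k - b k / ε ^ 2
  set D := likelihood ε b y * Real.exp (∑ j ∈ Finset.univ.erase k,
    ((ε⁻¹ * y j - b j / ε ^ 2) * x j - x j ^ 2 / (2 * ε ^ 2)))
  have hD : 0 ≤ D := mul_nonneg (likelihood_pos _ _ _).le (Real.exp_pos _).le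
  have h1 : ∀ r, ENNReal.ofReal (likelihood ε (b + extendCoef (Function.update x k r)) y) =
      ENNReal.ofReal D * ENNReal.ofReal (Real.exp (t * r - r ^ 2 / (2 * ε ^ 2))) := by
    intro r
    rw [← ENNReal.ofReal_mul hD, likelihood_add_extendCoef hε.ne' hb hby,
      ← Finset.add_sum_erase _ _ (Finset.mem_univ k), Real.exp_add, Function.update_self]
    congr 1
    rw [mul_left_comm, mul_comm]
    congr 3
    refine Finset.sum_congr rfl fun j hj => ?_
    rw [Function.update_of_ne (Finset.ne_of_mem_erase hj)]
  simp only [h1, Function.update_self]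
  have h2 := mul_le_mul_right (le_lintegral_tilted_gaussian (hs k) hε t a) (ENNReal.ofReal D)
  rw [← lintegral_const_mul _ (by fun_prop), ← lintegral_const_mul _ (by fun_prop),
    ← lintegral_const_mul _ (by fun_prop)] at h2
  convert h2 using 2 <;> funext r <;> ring

end Sieve

section Sieve

variable {K : Finset ℕ+} {s : K → ℝ≥0} {A : Set (K → ℝ)} {b : ℕ+ → ℝ} {δ ε D : ℝ} {y : ℕ+ → ℝ}

/-- The signals `b + v`, where `v` ranges over the coefficient vectors in `A`. -/
def sieve (b : ℕ+ → ℝ) (A : Set (K → ℝ)) (v : K → ℝ) : ℕ+ → ℝ := b + A.indicator extendCoef v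

/-- The common bound of the coefficients of a sieve. -/
def sieveBound (b : ℕ+ → ℝ) (K : Finset ℕ+) (δ : ℝ) (k : ℕ+) : ℝ := |b k| + if k ∈ K then δ else 0

theorem sieve_of_mem {v : K → ℝ} (hv : v ∈ A) : sieve b A v = b + extendCoef v := by
  rw [sieve, indicator_of_mem hv]

theorem sieve_of_notMem {v : K → ℝ} (hv : v ∉ A) : sieve b A v = b := by
  rw [sieve, indicator_of_notMem hv, add_zero]

theorem summable_sieveBound (hb : Summable fun k : ℕ+ => (k : ℝ) * |b k|) (K : Finset ℕ+) (δ : ℝ) :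
    Summable fun k : ℕ+ => (k : ℝ) * sieveBound b K δ k := by
  have h : Summable fun k : ℕ+ => (k : ℝ) * if k ∈ K then δ else 0 :=
    summable_of_ne_finset_zero (s := K) fun k hk => by rw [if_neg hk, mul_zero]
  exact (hb.add h).congr fun k => (mul_add _ _ _).symm

/-- Outside `A` the perturbation is dropped, so the bounds hold for every `v` and not only almost
surely under the conditioned prior. -/
theorem boundedFamily_sieve (hA : MeasurableSet A) (hδ : 0 ≤ δ) (hAδ : ∀ v ∈ A, ∀ k, |v k| ≤ δ)
    (hb : Summable fun k : ℕ+ => (k : ℝ) * |b k|) :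
    BoundedFamily (sieve b A) (sieveBound b K δ) where
  measurable k := by
    have h : Measurable fun v : K → ℝ => b k + A.indicator (fun v => extendCoef v k) v :=
      measurable_const.add ((measurable_extendCoef k).indicator hA)
    have e : (fun v => sieve b A v k) = fun v => b k + A.indicator (fun v => extendCoef v k) v := by
      funext v
      by_cases hv : v ∈ A
      · rw [sieve_of_mem hv, indicator_of_mem hv, Pi.add_apply]
      · rw [sieve_of_notMem hv, indicator_of_notMem hv, add_zero]
    rw [e]
    exact h
  nonneg k := by
    unfold sieveBound
    positivity
  le v k := by
    unfold sieveBound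
    by_cases hv : v ∈ A
    · rw [sieve_of_mem hv, Pi.add_apply]
      refine (abs_add_le _ _).trans (add_le_add le_rfl ?_)
      by_cases hk : k ∈ K
      · rw [if_pos hk, show extendCoef v k = v ⟨k, hk⟩ from dif_pos hk]
        exact hAδ v hv _
      · rw [if_neg hk, extendCoef_of_notMem v hk, abs_zero]
    · rw [sieve_of_notMem hv]
      exact le_add_of_nonneg_right (by positivity)
  summable := summable_sieveBound hb K δ

/-- Jensen's inequality: the weighted ball of squared radius `D` is convex and contains all
perturbations, hence also their posterior mean. The pointwise form is x² ≥ 2ax - a², integrated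
against the likelihood. -/
theorem sum_sq_posterior_mean_le {μ : Measure (K → ℝ)} [IsProbabilityMeasure μ]
    (h : BoundedFamily (sieve b A) (sieveBound b K δ))
    (hy : Summable fun k => sieveBound b K δ k * |y k|) (hD : 0 ≤ D)
    (hAD : ∀ v ∈ A, ∑ k : K, (2 * Real.pi * (k : ℕ)) ^ 2 * v k ^ 2 ≤ D) :
    ∑ k : K, (2 * Real.pi * (k : ℕ)) ^ 2 *
      (mixCoef μ (sieve b A) ε k y / mixLik μ (sieve b A) ε y - b k) ^ 2 ≤ D := by
  have hq := h.mixLik_pos (μ := μ) (ε := ε) hy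
  set q := mixLik μ (sieve b A) ε y with hqdef
  set a : K → ℝ := fun k => mixCoef μ (sieve b A) ε k y / q - b k with ha
  have i0 := h.integrable_likelihood (μ := μ) (ε := ε) hy
  have i1 := fun k => h.integrable_coef (μ := μ) (ε := ε) hy k
  have hpt : ∀ v, ∑ k : K, (((2 * Real.pi * (k : ℕ)) ^ 2 * (2 * a k)) *
        (sieve b A v k * likelihood ε (sieve b A v) y) -
      ((2 * Real.pi * (k : ℕ)) ^ 2 * (2 * a k * b k + a k ^ 2)) * likelihood ε (sieve b A v) y) ≤
      D * likelihood ε (sieve b A v) y := by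
    intro v
    have hl := (likelihood_pos ε (sieve b A v) y).le
    have h1 : ∑ k : K, (2 * Real.pi * (k : ℕ)) ^ 2 * (sieve b A v k - b k) ^ 2 ≤ D := by
      by_cases hv : v ∈ A
      · rw [sieve_of_mem hv]
        refine le_trans (le_of_eq (Finset.sum_congr rfl fun k _ => ?_)) (hAD v hv)
        rw [Pi.add_apply, add_sub_cancel_left, extendCoef_coe]
      · rw [sieve_of_notMem hv]
        simpa using hD
    refine le_trans ?_ (mul_le_mul_of_nonneg_right h1 hl)
    rw [Finset.sum_mul]
    refine Finset.sum_le_sum fun k _ => ?_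
    have h2 : 0 ≤ (2 * Real.pi * (k : ℕ)) ^ 2 * (sieve b A v k - b k - a k) ^ 2 *
      likelihood ε (sieve b A v) y := by positivity
    nlinarith
  have i2 : ∀ k : K, Integrable (fun v => ((2 * Real.pi * (k : ℕ)) ^ 2 * (2 * a k)) *
      (sieve b A v k * likelihood ε (sieve b A v) y) -
      ((2 * Real.pi * (k : ℕ)) ^ 2 * (2 * a k * b k + a k ^ 2)) * likelihood ε (sieve b A v) y) μ :=
    fun k => ((i1 k).const_mul _).sub (i0.const_mul _)
  have h2 := integral_mono (integrable_finsetSum Finset.univ fun k _ => i2 k) (i0.const_mul D) hpt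
  rw [integral_finsetSum _ fun k _ => i2 k, integral_const_mul] at h2
  refine le_of_mul_le_mul_right (le_trans (le_of_eq ?_) h2) hq
  rw [Finset.sum_mul]
  refine Finset.sum_congr rfl fun k _ => ?_
  rw [integral_sub ((i1 k).const_mul _) (i0.const_mul _), integral_const_mul, integral_const_mul]
  change _ * a k ^ 2 * q = _ * mixCoef μ (sieve b A) ε k y - _ * q
  have h3 : mixCoef μ (sieve b A) ε k y = (a k + b k) * q := by
    simp only [ha, sub_add_cancel]
    rw [div_mul_cancel₀ _ hq.ne']
  rw [h3]
  ring

/-- For the unconditioned prior no centre beats the conjugate posterior variance, in particular not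
the posterior mean of the conditioned prior. On `A` the resulting error is at most the conditioned
posterior variance. On the complement the centre is bounded by `D`, and (x - y)² ≤ 2x² + 2y² gives
the remainder. -/
theorem le_mixVar_add_lintegral_compl (hA : MeasurableSet A) (hA0 : gaussianPrior s A ≠ 0)
    (hs : ∀ k, s k ≠ 0) (hε : 0 < ε) (h : BoundedFamily (sieve b A) (sieveBound b K δ))
    (hb : Summable fun k => b k ^ 2) (hby : Summable fun k => b k * y k)
    (hy : Summable fun k => sieveBound b K δ k * |y k|) (hD : 0 ≤ D)
    (hAD : ∀ v ∈ A, ∑ k : K, (2 * Real.pi * (k : ℕ)) ^ 2 * v k ^ 2 ≤ D) :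
    ENNReal.ofReal (∑ k : K, (2 * Real.pi * (k : ℕ)) ^ 2 * (ε ^ 2 * (s k / (s k + ε ^ 2)))) *
        ∫⁻ v, ENNReal.ofReal (likelihood ε (b + extendCoef v) y) ∂gaussianPrior s ≤
      ENNReal.ofReal (∑ k ∈ K, (2 * Real.pi * (k : ℕ)) ^ 2 *
          mixVar ((gaussianPrior s)[|A]) (sieve b A) ε k y) +
        ∫⁻ v in Aᶜ, ENNReal.ofReal (2 * D + 2 * ∑ k : K, (2 * Real.pi * (k : ℕ)) ^ 2 * v k ^ 2) *
          ENNReal.ofReal (likelihood ε (b + extendCoef v) y) ∂gaussianPrior s := by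
  set γ := gaussianPrior s with hγ
  have : IsProbabilityMeasure (γ[|A]) := cond_isProbabilityMeasure hA0
  set c := sieve b A with hc
  set m : K → ℝ := fun k => mixCoef (γ[|A]) c ε k y / mixLik (γ[|A]) c ε y with hm
  have hmean := sum_sq_posterior_mean_le (μ := γ[|A]) (ε := ε) h hy hD hAD
  have hml := measurable_likelihood_add_extendCoef_right (K := K) ε b y
  calc _ = ∑ k : K, ENNReal.ofReal ((2 * Real.pi * (k : ℕ)) ^ 2) *
        (ENNReal.ofReal (ε ^ 2 * (s k / (s k + ε ^ 2))) *
          ∫⁻ v, ENNReal.ofReal (likelihood ε (b + extendCoef v) y) ∂γ) := by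
        rw [ENNReal.ofReal_sum_of_nonneg (fun k _ => by positivity), Finset.sum_mul]
        refine Finset.sum_congr rfl fun k _ => ?_
        rw [ENNReal.ofReal_mul (by positivity), mul_assoc]
    _ ≤ ∑ k : K, ENNReal.ofReal ((2 * Real.pi * (k : ℕ)) ^ 2) *
        ∫⁻ v, ENNReal.ofReal ((v k - (m k - b k)) ^ 2) *
          ENNReal.ofReal (likelihood ε (b + extendCoef v) y) ∂γ := by
        refine Finset.sum_le_sum fun k _ => ?_
        gcongr
        exact le_lintegral_sq_sub_mul_likelihood hs hε hb hby k _
    _ = ∫⁻ v, ENNReal.ofReal (∑ k : K, (2 * Real.pi * (k : ℕ)) ^ 2 * (v k - (m k - b k)) ^ 2) *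
          ENNReal.ofReal (likelihood ε (b + extendCoef v) y) ∂γ := by
        have e : ∀ v : K → ℝ, ENNReal.ofReal (∑ k : K, (2 * Real.pi * (k : ℕ)) ^ 2 *
            (v k - (m k - b k)) ^ 2) * ENNReal.ofReal (likelihood ε (b + extendCoef v) y) =
            ∑ k : K, ENNReal.ofReal ((2 * Real.pi * (k : ℕ)) ^ 2) *
              (ENNReal.ofReal ((v k - (m k - b k)) ^ 2) *
                ENNReal.ofReal (likelihood ε (b + extendCoef v) y)) := by
          intro v
          rw [ENNReal.ofReal_sum_of_nonneg fun k _ => by positivity, Finset.sum_mul]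
          refine Finset.sum_congr rfl fun k _ => ?_
          rw [ENNReal.ofReal_mul (by positivity), mul_assoc]
        simp_rw [e]
        rw [lintegral_finsetSum _ fun k _ => by fun_prop]
        refine Finset.sum_congr rfl fun k _ => ?_
        rw [← lintegral_const_mul _ (by fun_prop)]
    _ = ∫⁻ v in A, ENNReal.ofReal (∑ k : K, (2 * Real.pi * (k : ℕ)) ^ 2 * (v k - (m k - b k)) ^ 2) *
          ENNReal.ofReal (likelihood ε (b + extendCoef v) y) ∂γ +
        ∫⁻ v in Aᶜ, ENNReal.ofReal (∑ k : K, (2 * Real.pi * (k : ℕ)) ^ 2 *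
          (v k - (m k - b k)) ^ 2) * ENNReal.ofReal (likelihood ε (b + extendCoef v) y) ∂γ :=
        (lintegral_add_compl _ hA).symm
    _ ≤ _ := by
        refine add_le_add ?_ (lintegral_mono fun v => ?_)
        · have iV : ∀ k : K, Integrable (fun v => (c v k - m k) ^ 2 * likelihood ε (c v) y)
              (γ[|A]) := fun k =>
            h.integrable_mul_likelihood hy (((h.measurable k).sub_const _).pow_const 2)
              (B := (sieveBound b K δ k + |m k|) ^ 2) fun v => by
                rw [abs_pow]
                refine pow_le_pow_left₀ (abs_nonneg _) ((abs_sub _ _).trans ?_) 2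
                exact add_le_add (h.le v k) le_rfl
          have e : ∑ k ∈ K, (2 * Real.pi * (k : ℕ)) ^ 2 * mixVar (γ[|A]) c ε k y =
              ∫ v, ∑ k : K, (2 * Real.pi * (k : ℕ)) ^ 2 *
                ((c v k - m k) ^ 2 * likelihood ε (c v) y) ∂γ[|A] := by
            rw [integral_finsetSum _ fun k _ => (iV k).const_mul _, ← Finset.sum_coe_sort]
            refine Finset.sum_congr rfl fun k _ => ?_
            rw [integral_const_mul]
            rfl
          have hnn : ∀ v, 0 ≤ ∑ k : K, (2 * Real.pi * (k : ℕ)) ^ 2 *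
              ((c v k - m k) ^ 2 * likelihood ε (c v) y) := fun v =>
            Finset.sum_nonneg fun k _ =>
              mul_nonneg (sq_nonneg _) (mul_nonneg (sq_nonneg _) (likelihood_pos _ _ _).le)
          rw [e, ofReal_integral_eq_lintegral_ofReal
            (integrable_finsetSum _ fun k _ => (iV k).const_mul _) (ae_of_all _ hnn),
            ProbabilityTheory.cond, lintegral_smul_measure, smul_eq_mul]
          -- Conditioning divides by the prior mass of `A`, which is at most one, so it can only
          -- enlarge the posterior variance.
          refine le_trans (le_of_eq ?_) (le_mul_of_one_le_left' (ENNReal.one_le_inv.2 prob_le_one))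
          refine setLIntegral_congr_fun hA fun v hv => ?_
          rw [← ENNReal.ofReal_mul (Finset.sum_nonneg fun k _ => by positivity), Finset.sum_mul, hc,
            sieve_of_mem hv]
          congr 1
          refine Finset.sum_congr rfl fun k _ => ?_
          rw [Pi.add_apply, extendCoef_coe]
          ring
        · gcongr
          calc ∑ k : K, (2 * Real.pi * (k : ℕ)) ^ 2 * (v k - (m k - b k)) ^ 2
              ≤ ∑ k : K, (2 * ((2 * Real.pi * (k : ℕ)) ^ 2 * (m k - b k) ^ 2) +
                2 * ((2 * Real.pi * (k : ℕ)) ^ 2 * v k ^ 2)) := by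
                refine Finset.sum_le_sum fun k _ => ?_
                have h2 : 0 ≤ (2 * Real.pi * (k : ℕ)) ^ 2 * (v k + (m k - b k)) ^ 2 := by positivity
                linarith
            _ ≤ _ := by
                rw [Finset.sum_add_distrib, ← Finset.mul_sum, ← Finset.mul_sum]
                linarith

theorem lintegral_lintegral_mul_eq {Ω Y V : Type*} [MeasurableSpace Ω] [MeasurableSpace Y]
    [MeasurableSpace V] {P : Measure Ω} [SFinite P] {ν : Measure V} [SFinite ν] {Z : Ω → Y}
    (hZ : Measurable Z) {F : Y → V → ℝ≥0∞} (hF : Measurable (Function.uncurry F))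
    (hone : ∀ v, ∫⁻ ω, F (Z ω) v ∂P = 1) {G : V → ℝ≥0∞} (hG : Measurable G) :
    ∫⁻ ω, ∫⁻ v, G v * F (Z ω) v ∂ν ∂P = ∫⁻ v, G v ∂ν := by
  have hm : Measurable fun p : Ω × V => F (Z p.1) p.2 :=
    hF.comp ((hZ.comp measurable_fst).prodMk measurable_snd)
  rw [lintegral_lintegral_swap (((hG.comp measurable_snd).mul hm).aemeasurable)]
  refine lintegral_congr fun v => ?_
  have hv : Measurable fun ω => F (Z ω) v := hm.comp measurable_prodMk_right
  rw [lintegral_const_mul _ hv, hone, mul_one]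

/-- The expected posterior variance under the conditioned Gaussian prior. -/
theorem le_lintegral_mixVar {Ω : Type*} [MeasurableSpace Ω] {P : Measure Ω} [IsProbabilityMeasure P]
    {Z : Ω → ℕ+ → ℝ} (hZm : Measurable Z) (hA : MeasurableSet A) (hA0 : gaussianPrior s A ≠ 0)
    (hs : ∀ k, s k ≠ 0) (hε : 0 < ε) (h : BoundedFamily (sieve b A) (sieveBound b K δ))
    (hb : Summable fun k => b k ^ 2) (hby : ∀ ω, Summable fun k => b k * Z ω k)
    (hy : ∀ ω, Summable fun k => sieveBound b K δ k * |Z ω k|) (hD : 0 ≤ D)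
    (hAD : ∀ v ∈ A, ∑ k : K, (2 * Real.pi * (k : ℕ)) ^ 2 * v k ^ 2 ≤ D)
    (hone : ∀ v : K → ℝ, ∫⁻ ω, ENNReal.ofReal (likelihood ε (b + extendCoef v) (Z ω)) ∂P = 1)
    {q : ℝ} (hq0 : 0 ≤ q)
    (hq : ∫⁻ v in Aᶜ, ENNReal.ofReal (2 * D + 2 * ∑ k : K, (2 * Real.pi * (k : ℕ)) ^ 2 * v k ^ 2)
      ∂gaussianPrior s ≤ ENNReal.ofReal q) :
    ENNReal.ofReal (∑ k : K, (2 * Real.pi * (k : ℕ)) ^ 2 * (ε ^ 2 * (s k / (s k + ε ^ 2))) - q) ≤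
      ∫⁻ ω, ENNReal.ofReal (∑ k ∈ K, (2 * Real.pi * (k : ℕ)) ^ 2 *
        mixVar ((gaussianPrior s)[|A]) (sieve b A) ε k (Z ω)) ∂P := by
  set γ := gaussianPrior s with hγ
  have : IsProbabilityMeasure (γ[|A]) := cond_isProbabilityMeasure hA0
  have hF : Measurable (Function.uncurry fun (y : ℕ+ → ℝ) (v : K → ℝ) =>
      ENNReal.ofReal (likelihood ε (b + extendCoef v) y)) :=
    (measurable_likelihood_add_extendCoef ε b).ennreal_ofReal
  -- Each likelihood has expectation one, so by Fubini's theorem expectations over the data reduce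
  -- to integrals over the prior.
  have h1 := lintegral_lintegral_mul_eq (P := P) (ν := γ) hZm hF hone
    (G := fun _ => 1) measurable_const
  simp only [one_mul, lintegral_one, measure_univ] at h1
  have : IsProbabilityMeasure γ := inferInstanceAs (IsProbabilityMeasure (gaussianPrior s))
  obtain ⟨ν, hν⟩ : ∃ ν, ν = γ.restrict Aᶜ := ⟨_, rfl⟩
  have : IsFiniteMeasure ν := hν ▸ inferInstance
  rw [← hν] at hq
  have h2 := lintegral_lintegral_mul_eq (P := P) (ν := ν) hZm hF hone
    (G := fun v => ENNReal.ofReal (2 * D + 2 * ∑ k : K, (2 * Real.pi * (k : ℕ)) ^ 2 * v k ^ 2))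
    (by fun_prop)
  have hmix : Measurable fun ω => ENNReal.ofReal (∑ k ∈ K, (2 * Real.pi * (k : ℕ)) ^ 2 *
      mixVar (γ[|A]) (sieve b A) ε k (Z ω)) :=
    (Finset.measurable_fun_sum K fun k _ =>
      ((h.measurable_mixVar k).comp hZm).const_mul _).ennreal_ofReal
  have hFZ : Measurable fun ω => ∫⁻ v, ENNReal.ofReal (likelihood ε (b + extendCoef v) (Z ω)) ∂γ :=
    (hF.lintegral_prod_right' (ν := γ)).comp hZm
  rw [ENNReal.ofReal_sub _ hq0, tsub_le_iff_right]
  refine le_trans ?_ (add_le_add le_rfl (h2.le.trans hq))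
  rw [← lintegral_add_left hmix, hν]
  refine le_trans (le_of_eq ?_) (lintegral_mono fun ω => le_mixVar_add_lintegral_compl hA hA0 hs hε h
    hb (hby ω) (hy ω) hD hAD)
  rw [lintegral_const_mul _ hFZ, h1, mul_one]

end Sieve

/-! ### Prior of the shift and the Bayes risk bound -/

/-- The square root of a prior density of the shift on `[-τ, τ]`. -/
def shiftPrior (τ t : ℝ) : ℝ := (√τ)⁻¹ * Real.cos (Real.pi / (2 * τ) * t)

/-- The derivative of `shiftPrior`. -/
def shiftPriorDeriv (τ t : ℝ) : ℝ :=
  (√τ)⁻¹ * (-Real.sin (Real.pi / (2 * τ) * t) * (Real.pi / (2 * τ)))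

/-- The Fisher information of the prior of the shift. -/
def priorInfo (τ : ℝ) : ℝ := ∫ t in (-τ)..τ, 4 * shiftPriorDeriv τ t ^ 2

theorem hasDerivAt_shiftPrior (τ t : ℝ) : HasDerivAt (shiftPrior τ) (shiftPriorDeriv τ t) t := by
  have h : HasDerivAt (fun t => Real.pi / (2 * τ) * t) (Real.pi / (2 * τ)) t := by
    simpa using (hasDerivAt_id t).const_mul (Real.pi / (2 * τ))
  exact h.cos.const_mul _

theorem continuous_shiftPriorDeriv (τ : ℝ) : Continuous (shiftPriorDeriv τ) := by
  unfold shiftPriorDeriv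
  fun_prop

theorem shiftPrior_right {τ : ℝ} (hτ : 0 < τ) : shiftPrior τ τ = 0 := by
  have : Real.pi / (2 * τ) * τ = Real.pi / 2 := by field_simp
  rw [shiftPrior, this, Real.cos_pi_div_two, mul_zero]

theorem shiftPrior_left {τ : ℝ} (hτ : 0 < τ) : shiftPrior τ (-τ) = 0 := by
  have h := shiftPrior_right hτ
  rw [shiftPrior] at h ⊢
  rwa [mul_neg, Real.cos_neg]

theorem integral_shiftPrior_sq {τ : ℝ} (hτ : 0 < τ) : ∫ t in (-τ)..τ, shiftPrior τ t ^ 2 = 1 := by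
  have hc : Real.pi / (2 * τ) ≠ 0 := by positivity
  simp_rw [shiftPrior, mul_pow]
  rw [intervalIntegral.integral_const_mul,
    intervalIntegral.integral_comp_mul_left (fun x => Real.cos x ^ 2) hc, integral_cos_sq]
  have h1 : Real.pi / (2 * τ) * τ = Real.pi / 2 := by field_simp
  rw [mul_neg, h1, Real.cos_neg, Real.cos_pi_div_two, inv_pow, Real.sq_sqrt hτ.le, smul_eq_mul]
  field_simp
  ring

section Sieve

variable {K : Finset ℕ+} {s : K → ℝ≥0} {A : Set (K → ℝ)} {b : ℕ+ → ℝ} {δ ε D : ℝ}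

theorem sieve_apply_of_notMem {k : ℕ+} (hk : k ∉ K) (v : K → ℝ) : sieve b A v k = b k := by
  by_cases hv : v ∈ A
  · rw [sieve_of_mem hv, Pi.add_apply, extendCoef_of_notMem v hk, add_zero]
  · rw [sieve_of_notMem hv]

/-- The comparison with the unconditioned prior involves vectors outside `A`, where no uniform bound
holds. A factor depending on `v` is enough to make the noise series converge. -/
theorem abs_add_extendCoef_le (hδ : 0 < δ) (v : K → ℝ) (k : ℕ+) :
    |(b + extendCoef v) k| ≤ (1 + (∑ j, |v j|) / δ) * sieveBound b K δ k := by
  have hS : 0 ≤ (∑ j, |v j|) / δ := div_nonneg (Finset.sum_nonneg fun j _ => abs_nonneg _) hδ.le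
  have hb := abs_nonneg (b k)
  rw [Pi.add_apply, sieveBound]
  refine (abs_add_le _ _).trans ?_
  by_cases hk : k ∈ K
  · rw [if_pos hk, show extendCoef v k = v ⟨k, hk⟩ from dif_pos hk]
    have h1 : |v ⟨k, hk⟩| ≤ (∑ j, |v j|) / δ * δ := by
      rw [div_mul_cancel₀ _ hδ.ne']
      exact Finset.single_le_sum (f := fun j => |v j|) (fun j _ => abs_nonneg _) (Finset.mem_univ _)
    nlinarith [mul_nonneg hS hb]
  · rw [if_neg hk, extendCoef_of_notMem v hk, abs_zero]
    nlinarith [mul_nonneg hS hb]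

/-- The inequality (x + y)² ≤ (1 + g)x² + (1 + g⁻¹)y² keeps the leading constant near the
unperturbed value, provided `D` is small compared with g². -/
theorem derivSq_sieve_le (hb : Summable fun k : ℕ+ => (2 * Real.pi * (k : ℕ)) ^ 2 * b k ^ 2)
    (hD : 0 ≤ D) (hAD : ∀ v ∈ A, ∑ k : K, (2 * Real.pi * (k : ℕ)) ^ 2 * v k ^ 2 ≤ D) {g : ℝ}
    (hg : 0 < g) (v : K → ℝ) :
    derivSq (sieve b A v) ≤ (1 + g) * derivSq b + (1 + g⁻¹) * D := by
  have hg' : 0 < g⁻¹ := by positivity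
  by_cases hv : v ∈ A
  · rw [sieve_of_mem hv]
    have hs := summable_extendCoef (g := fun k x => (2 * Real.pi * (k : ℕ)) ^ 2 * x ^ 2)
      (fun k => by ring) v
    have hpt : ∀ k : ℕ+, (2 * Real.pi * (k : ℕ)) ^ 2 * (b + extendCoef v) k ^ 2 ≤
        (1 + g) * ((2 * Real.pi * (k : ℕ)) ^ 2 * b k ^ 2) +
          (1 + g⁻¹) * ((2 * Real.pi * (k : ℕ)) ^ 2 * extendCoef v k ^ 2) := by
      intro k
      have h1 : (b k + extendCoef v k) ^ 2 ≤
          (1 + g) * b k ^ 2 + (1 + g⁻¹) * extendCoef v k ^ 2 := by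
        have h2 : 0 ≤ g⁻¹ * (g * b k - extendCoef v k) ^ 2 := by positivity
        have h3 : g⁻¹ * (g * b k - extendCoef v k) ^ 2 =
            g * b k ^ 2 - 2 * b k * extendCoef v k + g⁻¹ * extendCoef v k ^ 2 := by
          field_simp
          ring
        nlinarith
      rw [Pi.add_apply]
      have := mul_le_mul_of_nonneg_left h1 (sq_nonneg (2 * Real.pi * ((k : ℕ) : ℝ)))
      linarith
    have hsum := (hb.mul_left (1 + g)).add (hs.mul_left (1 + g⁻¹))
    rw [derivSq]
    refine (Summable.tsum_le_tsum hpt (Summable.of_nonneg_of_le (fun k => by positivity) hpt hsum)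
      hsum).trans ?_
    rw [(hb.mul_left (1 + g)).tsum_add (hs.mul_left (1 + g⁻¹)), tsum_mul_left, tsum_mul_left,
      tsum_extendCoef (g := fun k x => (2 * Real.pi * (k : ℕ)) ^ 2 * x ^ 2) (fun k => by ring)]
    have := hAD v hv
    rw [derivSq]
    gcongr
  · rw [sieve_of_notMem hv]
    have h1 := derivSq_nonneg b
    nlinarith [mul_nonneg hg.le h1, mul_nonneg hg'.le hD]

variable {Ω : Type*} [MeasurableSpace Ω] {P : Measure Ω} [IsProbabilityMeasure P]
  {N : TestFun → Ω → ℝ}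

/-- The second order lower bound for the Bayes risk of the shift, for a Gaussian prior on the signal
conditioned on a set. -/
theorem IsWhiteNoise.le_risk_sieve (hN : IsWhiteNoise N P)
    (hb : Summable fun k : ℕ+ => (k : ℝ) * |b k|) {ρ : ℝ} (hρ : 0 < ρ) (hb1 : ρ ≤ b 1 ^ 2)
    (hK : 1 ∉ K) (hs : ∀ k, s k ≠ 0) (hA : MeasurableSet A) (hA0 : gaussianPrior s A ≠ 0)
    (hδ : 0 < δ) (hAδ : ∀ v ∈ A, ∀ k, |v k| ≤ δ) (hD : 0 ≤ D)
    (hAD : ∀ v ∈ A, ∑ k : K, (2 * Real.pi * (k : ℕ)) ^ 2 * v k ^ 2 ≤ D)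
    {q : ℝ} (hq0 : 0 ≤ q)
    (hq : ∫⁻ v in Aᶜ, ENNReal.ofReal (2 * D + 2 * ∑ k : K, (2 * Real.pi * (k : ℕ)) ^ 2 * v k ^ 2)
      ∂gaussianPrior s ≤ ENNReal.ofReal q) (hε : 0 < ε) {E : ℝ} (hE0 : 0 ≤ E)
    (hE : E ≤ ∑ k : K, (2 * Real.pi * (k : ℕ)) ^ 2 * (ε ^ 2 * (s k / (s k + ε ^ 2))) - q)
    {g : ℝ} (hg : 0 < g) {τ : ℝ} (hτ : 0 < τ) {T : (TestFun → ℝ) → ℝ} (hT : Measurable T)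
    {R : ℝ≥0∞}
    (hR : ∀ θ ∈ Icc (-τ) τ, ∀ v, normalizedRisk P N T ε θ (cosSeries (sieve b A v)) ≤ R) :
    ENNReal.ofReal (1 + E / ((1 + g) * derivSq b + (1 + g⁻¹) * D) -
      ε ^ 2 * priorInfo τ / ((2 * Real.pi) ^ 2 * ρ)) ≤ R := by
  have hF := boundedFamily_sieve hA hδ.le hAδ hb
  have : IsProbabilityMeasure ((gaussianPrior s)[|A]) := cond_isProbabilityMeasure hA0
  have hCs := hF.summable
  have hC := hF.nonneg
  have hbsq : Summable fun k => b k ^ 2 := by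
    simpa using summable_sq_of_summable (fun k => abs_nonneg (b k)) (summable_abs_of_weighted hb)
  have hbd : Summable fun k : ℕ+ => (2 * Real.pi * (k : ℕ)) ^ 2 * b k ^ 2 := by
    have := (summable_sq_of_summable (fun k : ℕ+ => mul_nonneg (by positivity) (abs_nonneg (b k)))
      hb).mul_left ((2 * Real.pi) ^ 2)
    refine this.congr fun k => ?_
    rw [← sq_abs (b k)]
    ring
  have hb10 : b 1 ≠ 0 := fun h => by
    rw [h] at hb1
    norm_num at hb1
    linarith
  have hc : ∀ v k, |sieve b A v k| ≤ 1 * sieveBound b K δ k := fun v k => by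
    rw [one_mul]
    exact hF.le v k
  have hc0 : ∀ v : K → ℝ, sieve b A v ≠ 0 := fun v h =>
    hb10 (by rw [← sieve_apply_of_notMem (A := A) (b := b) hK v, h, Pi.zero_apply])
  have hc0' : ∀ v : K → ℝ, b + extendCoef v ≠ 0 := fun v h => hb10 (by
    have := congrFun h 1
    rwa [Pi.add_apply, extendCoef_of_notMem v hK, add_zero] at this)
  have hgood := fun ω => summable_noise (N := N) hC ω
  set X := noiseCos N (sieveBound b K δ) with hX
  set Y := noiseSin N (sieveBound b K δ) with hY
  have hXm : Measurable X := hN.measurable_noiseCos _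
  have hYm : Measurable Y := hN.measurable_noiseSin _
  -- Frequency 1 is not perturbed, so its coefficient alone bounds the information from below
  -- uniformly.
  have hmin : ∀ v, (2 * Real.pi) ^ 2 * ρ ≤ derivSq (sieve b A v) := fun v => by
    have h1 := (hF.summable_deriv v).le_tsum 1 fun k _ => by positivity
    refine le_trans ?_ h1
    rw [sieve_apply_of_notMem hK]
    simp only [PNat.one_coe, Nat.cast_one, mul_one]
    gcongr
  set d := ε ^ 2 * priorInfo τ / ((2 * Real.pi) ^ 2 * ρ) +
    (1 - E / ((1 + g) * derivSq b + (1 + g⁻¹) * D)) with hd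
  have hvt : ∀ a : ℝ, 0 < a → 2 ≤ ENNReal.ofReal a * R + ENNReal.ofReal (a⁻¹ * d) := by
    intro a ha
    refine hF.van_trees (μ := (gaussianPrior s)[|A]) (bmin := (2 * Real.pi) ^ 2 * ρ) (P := P)
      (bmax := (1 + g) * derivSq b + (1 + g⁻¹) * D) hε hXm hYm hgood (by positivity) hmin
      (derivSq_sieve_le hbd hD hAD hg)
      (fun θ v => hN.lintegral_likelihood hC (hc v) hCs (hc0 v) hε.ne' θ)
      (hN.indepFun_rot_noise hC hCs) (hN.memLp_rotSin_noise hC hCs) (hN.integral_rotSin_noise hC hCs)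
      (hN.integral_rotSin_noise_mul hC hCs) (K := K) hE0 (fun θ => ?_) hτ (hasDerivAt_shiftPrior τ)
      (continuous_shiftPriorDeriv τ) (shiftPrior_right hτ) (shiftPrior_left hτ)
      (integral_shiftPrior_sq hτ) (U := fun ω => T fun φ => ε * N φ ω) ?_ (R := R) ?_ ha
    · refine (ENNReal.ofReal_le_ofReal hE).trans ?_
      refine le_lintegral_mixVar (hZm := (measurable_rotCos_right hXm hYm θ)) hA hA0 hs hε hF hbsq
        (fun ω => ?_) (fun ω => ?_) hD hAD (fun v => ?_) hq0 hq
      · exact summable_mul_rotCos (M := 1) (fun k => by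
          rw [one_mul]
          exact le_add_of_nonneg_right (by positivity)) (hgood ω) θ
      · have := (summable_mul_rotCos (c := sieveBound b K δ) (M := 1)
          (fun k => by rw [abs_of_nonneg (hC k), one_mul]) (hgood ω) θ).abs
        refine this.congr fun k => ?_
        rw [abs_mul, abs_of_nonneg (hC k)]
      · exact hN.lintegral_likelihood hC (abs_add_extendCoef_le hδ v) hCs (hc0' v) hε.ne' θ
    · have hm := hN.measurable
      exact hT.comp (measurable_pi_lambda _ fun φ => (hm φ).const_mul _)
    · intro θ hθ v
      rw [← hN.normalizedRisk_cosSeries hC (hc v) hCs (hc0 v) hε.ne' θ hT]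
      exact hR θ hθ v
  have hgoal : 1 + E / ((1 + g) * derivSq b + (1 + g⁻¹) * D) -
    ε ^ 2 * priorInfo τ / ((2 * Real.pi) ^ 2 * ρ) = 2 - d := by rw [hd]; ring
  rw [hgoal]
  by_cases hRtop : R = ∞
  · rw [hRtop]
    exact le_top
  lift R to ℝ≥0 using hRtop
  have hreal : ∀ a : ℝ, 0 < a → 2 ≤ a * R + max (a⁻¹ * d) 0 := by
    intro a ha
    have h1 := hvt a ha
    rw [← ENNReal.ofReal_coe_nnreal, ← ENNReal.ofReal_mul ha.le,
      show ENNReal.ofReal (a⁻¹ * d) = ENNReal.ofReal (max (a⁻¹ * d) 0) by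
        simp [ENNReal.ofReal, Real.toNNReal],
      ← ENNReal.ofReal_add (by positivity) (le_max_right _ _),
      show (2 : ℝ≥0∞) = ENNReal.ofReal 2 by simp] at h1
    exact (ENNReal.ofReal_le_ofReal_iff (by positivity)).1 h1
  rw [← ENNReal.ofReal_coe_nnreal]
  refine ENNReal.ofReal_le_ofReal ?_
  have hR0 := R.coe_nonneg
  rcases le_or_gt d 0 with hd0 | hd0
  -- For d ≤ 0 the second term vanishes and a = 1/(R + 1) would give 2 ≤ R/(R + 1).
  · exfalso
    have h1 := hreal (1 / (R + 1)) (by positivity)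
    rw [max_eq_right (mul_nonpos_of_nonneg_of_nonpos (by positivity) hd0), add_zero, one_div,
      inv_mul_eq_div, le_div_iff₀ (by positivity)] at h1
    linarith
  -- The choice a = d gives R ≥ 1/d, and 1/d ≥ 2 - d.
  · have h1 := hreal d hd0
    rw [inv_mul_cancel₀ hd0.ne', max_eq_left zero_le_one] at h1
    by_contra! h2
    nlinarith [sq_nonneg (d - 1), mul_lt_mul_of_pos_left h2 hd0]

end Sieve

/-! ### Moments and concentration of the prior -/

theorem lintegral_exp_gaussianReal {v : ℝ≥0} (hv : v ≠ 0) (a : ℝ) :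
    ∫⁻ x, ENNReal.ofReal (Real.exp (a * x)) ∂gaussianReal 0 v =
      ENNReal.ofReal (Real.exp (a ^ 2 * v / 2)) := by
  have h := lintegral_gaussianReal_shift hv a (G := fun _ => 1) measurable_const
  simp only [one_mul, lintegral_one, measure_univ] at h
  have e : ∀ x, ENNReal.ofReal (Real.exp (a * x)) = ENNReal.ofReal (Real.exp (a ^ 2 * v / 2)) *
      ENNReal.ofReal (Real.exp (a * x - a ^ 2 * v / 2)) := by
    intro x
    rw [← ENNReal.ofReal_mul (Real.exp_pos _).le, ← Real.exp_add]
    congr 2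
    ring
  simp_rw [e]
  rw [lintegral_const_mul _ (by fun_prop), ← h, mul_one]

/-- The bound x⁴/24 ≤ e^|x| at scale 1/√v gives 48·e^(1/2) ≤ 48·5/3 = 80. The sharp constant 3 is
not needed. -/
theorem lintegral_pow_four_gaussianReal_le {v : ℝ≥0} (hv : v ≠ 0) :
    ∫⁻ x, ENNReal.ofReal (x ^ 4) ∂gaussianReal 0 v ≤ ENNReal.ofReal (80 * (v : ℝ) ^ 2) := by
  have hv' : (0 : ℝ) < v := NNReal.coe_pos.2 (pos_iff_ne_zero.2 hv)
  set r := (√(v : ℝ))⁻¹ with hr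
  have hr2 : r ^ 2 * v = 1 := by
    rw [hr, inv_pow, Real.sq_sqrt hv'.le, inv_mul_cancel₀ hv'.ne']
  have hpt : ∀ x : ℝ, x ^ 4 ≤
      24 * (v : ℝ) ^ 2 * Real.exp (r * x) + 24 * (v : ℝ) ^ 2 * Real.exp (-r * x) := by
    intro x
    have h1 := Real.pow_div_factorial_le_exp _ (abs_nonneg (r * x)) 4
    have h2 : Real.exp |r * x| ≤ Real.exp (r * x) + Real.exp (-r * x) := by
      rcases abs_cases (r * x) with h | h <;> rw [h.1]
      · linarith [Real.exp_pos (-r * x)]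
      · rw [neg_mul]
        linarith [Real.exp_pos (r * x)]
    have h3 : x ^ 4 = 24 * (v : ℝ) ^ 2 * (|r * x| ^ 4 / (Nat.factorial 4 : ℕ)) := by
      have h4 : |r * x| ^ 4 = r ^ 4 * x ^ 4 := by
        rw [← mul_pow, Even.pow_abs (by decide)]
      have h5 : Nat.factorial 4 = 24 := rfl
      rw [h4, h5]
      push_cast
      have h6 : (v : ℝ) ^ 2 * r ^ 4 = 1 := by
        calc (v : ℝ) ^ 2 * r ^ 4 = (r ^ 2 * v) ^ 2 := by ring
          _ = 1 := by rw [hr2, one_pow]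
      linear_combination (-x ^ 4) * h6
    rw [h3, ← mul_add]
    exact mul_le_mul_of_nonneg_left (h1.trans h2) (by positivity)
  have hexp : Real.exp (1 / 2) ≤ 5 / 3 := by
    have h1 : Real.exp (1 / 2) ^ 2 = Real.exp 1 := by
      rw [← Real.exp_nat_mul]
      norm_num
    have h2 := Real.exp_one_lt_d9
    refine le_of_sq_le_sq ?_ (by norm_num)
    rw [h1]
    norm_num
    linarith
  calc ∫⁻ x, ENNReal.ofReal (x ^ 4) ∂gaussianReal 0 v
      ≤ ∫⁻ x, (ENNReal.ofReal (24 * (v : ℝ) ^ 2) * ENNReal.ofReal (Real.exp (r * x)) +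
          ENNReal.ofReal (24 * (v : ℝ) ^ 2) * ENNReal.ofReal (Real.exp (-r * x)))
          ∂gaussianReal 0 v := by
        refine lintegral_mono fun x => ?_
        rw [← ENNReal.ofReal_mul (by positivity), ← ENNReal.ofReal_mul (by positivity),
          ← ENNReal.ofReal_add (by positivity) (by positivity)]
        exact ENNReal.ofReal_le_ofReal (hpt x)
    _ = ENNReal.ofReal (24 * (v : ℝ) ^ 2 * Real.exp (1 / 2) +
          24 * (v : ℝ) ^ 2 * Real.exp (1 / 2)) := by
        rw [lintegral_add_left (by fun_prop), lintegral_const_mul _ (by fun_prop),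
          lintegral_const_mul _ (by fun_prop), lintegral_exp_gaussianReal hv,
          lintegral_exp_gaussianReal hv, neg_sq, hr2, ← ENNReal.ofReal_mul (by positivity),
          ← ENNReal.ofReal_add (by positivity) (by positivity)]
    _ ≤ _ := by
        refine ENNReal.ofReal_le_ofReal ?_
        nlinarith [sq_nonneg (v : ℝ)]

section Prior

variable {K : Finset ℕ+} {s : K → ℝ≥0}

theorem lintegral_pow_four_prior_le (hs : ∀ k, s k ≠ 0) (k : K) :
    ∫⁻ v, ENNReal.ofReal (v k ^ 4) ∂gaussianPrior s ≤ ENNReal.ofReal (80 * (s k : ℝ) ^ 2) := by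
  have h := (measurePreserving_eval (fun k => gaussianReal 0 (s k)) k).lintegral_comp
    (f := fun x => ENNReal.ofReal (x ^ 4)) (by fun_prop)
  exact h.le.trans (lintegral_pow_four_gaussianReal_le (hs k))

theorem aestronglyMeasurable_sq_prior (k : K) :
    AEStronglyMeasurable (fun v : K → ℝ => v k ^ 2) (gaussianPrior s) := by
  have : Measurable fun v : K → ℝ => v k ^ 2 := by fun_prop
  exact this.aestronglyMeasurable

theorem memLp_sq_prior (hs : ∀ k, s k ≠ 0) (k : K) :
    MemLp (fun v : K → ℝ => v k ^ 2) 2 (gaussianPrior s) := by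
  have hm := aestronglyMeasurable_sq_prior (s := s) k
  rw [memLp_two_iff_integrable_sq hm]
  refine ⟨hm.pow 2, ?_⟩
  rw [hasFiniteIntegral_iff_ofReal (ae_of_all _ fun v => sq_nonneg _)]
  refine lt_of_le_of_lt (le_of_eq (lintegral_congr fun v => ?_))
    ((lintegral_pow_four_prior_le hs k).trans_lt ENNReal.ofReal_lt_top)
  congr 1
  ring

theorem integral_sq_prior (k : K) : ∫ v, v k ^ 2 ∂gaussianPrior s = s k := by
  have h : ∫ v, v k ^ 2 ∂gaussianPrior s = ∫ x, x ^ 2 ∂gaussianReal 0 (s k) :=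
    integral_comp_eval (μ := fun k => gaussianReal 0 (s k)) (f := fun x : ℝ => x ^ 2)
      (Measurable.aestronglyMeasurable (by fun_prop))
  rw [h]
  have h2 := variance_id_gaussianReal (μ := 0) (v := s k)
  rw [variance_of_integral_eq_zero aemeasurable_id (by simp)] at h2
  exact h2

theorem variance_sq_prior_le (hs : ∀ k, s k ≠ 0) (k : K) :
    Var[fun v : K → ℝ => v k ^ 2; gaussianPrior s] ≤ 80 * (s k : ℝ) ^ 2 := by
  refine (variance_le_expectation_sq (aestronglyMeasurable_sq_prior k)).trans ?_
  have h := lintegral_pow_four_prior_le hs k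
  refine (ENNReal.ofReal_le_ofReal_iff (by positivity)).1 (le_trans (le_of_eq ?_) h)
  refine (ofReal_integral_eq_lintegral_ofReal (memLp_sq_prior hs k).integrable_sq
      (ae_of_all _ fun v => by positivity)).trans (lintegral_congr fun v => ?_)
  congr 1
  ring

/-- Chebyshev's inequality: shrinking the variances by 1 - g leaves a gap gL above the mean, while
the variance of the sum of independent terms is at most 80·M·L. -/
theorem gaussianPrior_ellipsoid_compl_le (hs : ∀ k, s k ≠ 0) {a : K → ℝ} (ha : ∀ k, 0 ≤ a k)
    {L g M : ℝ} (hL : 0 < L) (hg : 0 < g) (hM0 : 0 ≤ M)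
    (hM : ∀ k, a k * s k ≤ M)
    (hm : ∑ k, a k * s k ≤ (1 - g) * L) :
    gaussianPrior s {v | L < ∑ k, a k * v k ^ 2} ≤ ENNReal.ofReal (80 * M / (g ^ 2 * L)) := by
  have hX : ∀ k, MemLp (fun v : K → ℝ => a k * v k ^ 2) 2 (gaussianPrior s) := fun k =>
    (memLp_sq_prior hs k).const_mul _
  set S : (K → ℝ) → ℝ := ∑ k, fun v : K → ℝ => a k * v k ^ 2 with hS
  have hSv : ∀ v, S v = ∑ k, a k * v k ^ 2 := fun v => by rw [hS, Finset.sum_apply]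
  have hSm : MemLp S 2 (gaussianPrior s) := memLp_finsetSum' _ fun k _ => hX k
  have hmean : ∫ v, S v ∂gaussianPrior s = ∑ k, a k * s k := by
    simp_rw [hSv]
    rw [integral_finsetSum _ fun k _ => (hX k).integrable (by norm_num)]
    refine Finset.sum_congr rfl fun k _ => ?_
    rw [integral_const_mul, integral_sq_prior]
  have hind : iIndepFun (fun (k : K) (v : K → ℝ) => a k * v k ^ 2) (gaussianPrior s) :=
    iIndepFun_pi (X := fun (k : K) (x : ℝ) => a k * x ^ 2) fun k => by fun_prop
  have hvar : Var[S; gaussianPrior s] ≤ 80 * M * L := by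
    rw [hS, IndepFun.variance_sum (fun k _ => hX k) fun i _ j _ hij => hind.indepFun hij]
    calc ∑ k, Var[fun v : K → ℝ => a k * v k ^ 2; gaussianPrior s]
        ≤ ∑ k, 80 * M * (a k * s k) := by
          refine Finset.sum_le_sum fun k _ => ?_
          rw [variance_const_mul]
          have h1 := mul_le_mul_of_nonneg_left (variance_sq_prior_le hs k) (sq_nonneg (a k))
          have h2 : 0 ≤ a k * s k := mul_nonneg (ha k) (s k).coe_nonneg
          nlinarith [mul_le_mul_of_nonneg_right (hM k) h2]
      _ ≤ 80 * M * L := by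
          rw [← Finset.mul_sum]
          refine mul_le_mul_of_nonneg_left (hm.trans ?_) (by positivity)
          nlinarith
  calc gaussianPrior s {v | L < ∑ k, a k * v k ^ 2}
      ≤ gaussianPrior s {v | g * L ≤ |S v - ∫ v, S v ∂gaussianPrior s|} := by
        refine measure_mono fun v hv => ?_
        rw [Set.mem_ofPred_eq] at hv ⊢
        rw [hSv, hmean]
        refine le_trans ?_ (le_abs_self _)
        linarith
    _ ≤ ENNReal.ofReal (Var[S; gaussianPrior s] / (g * L) ^ 2) :=
        meas_ge_le_variance_div_sq hSm (by positivity)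
    _ ≤ _ := by
        refine ENNReal.ofReal_le_ofReal ?_
        rw [div_le_div_iff₀ (by positivity) (by positivity)]
        have : 0 ≤ g ^ 2 * L := by positivity
        nlinarith [mul_le_mul_of_nonneg_right hvar this]

theorem gaussianPrior_ball_compl_le (hs : ∀ k, s k ≠ 0) {δ : ℝ} (hδ : 0 < δ) :
    gaussianPrior s {v | δ ^ 2 < ∑ k, v k ^ 2} ≤ ENNReal.ofReal ((∑ k, (s k : ℝ)) / δ ^ 2) := by
  have hX : ∀ k, Integrable (fun v : K → ℝ => v k ^ 2) (gaussianPrior s) := fun k =>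
    (memLp_sq_prior hs k).integrable (by norm_num)
  have h := mul_meas_ge_le_integral_of_nonneg (μ := gaussianPrior s)
    (f := fun v : K → ℝ => ∑ k, v k ^ 2) (ae_of_all _ fun v => by positivity)
    (integrable_finsetSum _ fun k _ => hX k) (δ ^ 2)
  rw [integral_finsetSum _ fun k _ => hX k] at h
  simp_rw [integral_sq_prior] at h
  refine (measure_mono (t := {v | δ ^ 2 ≤ ∑ k, v k ^ 2}) fun v hv => ?_).trans ?_
  · rw [Set.mem_ofPred_eq] at hv ⊢
    exact hv.le
  · rw [← ENNReal.ofReal_toReal (measure_ne_top (gaussianPrior s) _)]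
    refine ENNReal.ofReal_le_ofReal ?_
    rw [le_div_iff₀ (by positivity), mul_comm]
    exact h

/-- A second moment over an unlikely event is small: v² ≤ (l/s)v⁴ + s/(4l) with a free `l` replaces
the Cauchy–Schwarz inequality and avoids square roots of `p`. -/
theorem setLIntegral_sq_prior_le (hs : ∀ k, s k ≠ 0) {B : Set (K → ℝ)} {p : ℝ}
    (hp : gaussianPrior s B ≤ ENNReal.ofReal p) (hp0 : 0 ≤ p) {l : ℝ} (hl : 0 < l) (k : K) :
    ∫⁻ v in B, ENNReal.ofReal (v k ^ 2) ∂gaussianPrior s ≤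
      ENNReal.ofReal (s k * (80 * l + p / (4 * l))) := by
  have hs' : (0 : ℝ) < s k := NNReal.coe_pos.2 (pos_iff_ne_zero.2 (hs k))
  calc ∫⁻ v in B, ENNReal.ofReal (v k ^ 2) ∂gaussianPrior s
      ≤ ∫⁻ v in B, (ENNReal.ofReal (l / s k) * ENNReal.ofReal (v k ^ 4) +
          ENNReal.ofReal (s k / (4 * l))) ∂gaussianPrior s := by
        refine lintegral_mono fun v => ?_
        rw [← ENNReal.ofReal_mul (by positivity), ← ENNReal.ofReal_add (by positivity)
          (by positivity)]
        refine ENNReal.ofReal_le_ofReal ?_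
        have h1 : 0 ≤ l / s k * (v k ^ 2 - s k / (2 * l)) ^ 2 := by positivity
        have h2 : l / s k * (v k ^ 2 - s k / (2 * l)) ^ 2 =
            l / s k * v k ^ 4 + s k / (4 * l) - v k ^ 2 := by
          field_simp
          ring
        linarith
    _ = ENNReal.ofReal (l / s k) * ∫⁻ v in B, ENNReal.ofReal (v k ^ 4) ∂gaussianPrior s +
          ENNReal.ofReal (s k / (4 * l)) * gaussianPrior s B := by
        rw [lintegral_add_left (by fun_prop), lintegral_const_mul _ (by fun_prop),
          setLIntegral_const]
    _ ≤ ENNReal.ofReal (l / s k) * ENNReal.ofReal (80 * (s k : ℝ) ^ 2) +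
          ENNReal.ofReal (s k / (4 * l)) * ENNReal.ofReal p := by
        gcongr
        exact (setLIntegral_le_lintegral _ _).trans (lintegral_pow_four_prior_le hs k)
    _ = _ := by
        rw [← ENNReal.ofReal_mul (by positivity), ← ENNReal.ofReal_mul (by positivity),
          ← ENNReal.ofReal_add (by positivity) (by positivity)]
        congr 1
        field_simp

theorem setLIntegral_quadratic_prior_le (hs : ∀ k, s k ≠ 0) {B : Set (K → ℝ)} {p : ℝ}
    (hp : gaussianPrior s B ≤ ENNReal.ofReal p) (hp0 : 0 ≤ p) {l : ℝ} (hl : 0 < l) {D : ℝ}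
    (hD : 0 ≤ D) {a : K → ℝ} (ha : ∀ k, 0 ≤ a k) :
    ∫⁻ v in B, ENNReal.ofReal (2 * D + 2 * ∑ k, a k * v k ^ 2) ∂gaussianPrior s ≤
      ENNReal.ofReal (2 * D * p + 2 * (∑ k, a k * s k) * (80 * l + p / (4 * l))) := by
  have hl' : 0 ≤ 80 * l + p / (4 * l) := by positivity
  have e : ∀ v : K → ℝ, ENNReal.ofReal (2 * D + 2 * ∑ k, a k * v k ^ 2) =
      ENNReal.ofReal (2 * D) + ∑ k, ENNReal.ofReal (2 * a k) * ENNReal.ofReal (v k ^ 2) := by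
    intro v
    have hs0 : 0 ≤ ∑ k, a k * v k ^ 2 :=
      Finset.sum_nonneg fun k _ => mul_nonneg (ha k) (sq_nonneg _)
    rw [ENNReal.ofReal_add (by positivity) (by positivity), Finset.mul_sum,
      ENNReal.ofReal_sum_of_nonneg fun k _ => by have := ha k; positivity]
    congr 1
    refine Finset.sum_congr rfl fun k _ => ?_
    rw [← ENNReal.ofReal_mul (by have := ha k; positivity), mul_assoc]
  simp_rw [e]
  rw [lintegral_add_left measurable_const, setLIntegral_const,
    lintegral_finsetSum _ fun k _ => by fun_prop]
  calc _ ≤ ENNReal.ofReal (2 * D) * ENNReal.ofReal p +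
        ∑ k, ENNReal.ofReal (2 * a k) * ENNReal.ofReal (s k * (80 * l + p / (4 * l))) := by
        refine add_le_add (mul_le_mul_right hp _) (Finset.sum_le_sum fun k _ => ?_)
        rw [lintegral_const_mul _ (by fun_prop)]
        exact mul_le_mul_right (setLIntegral_sq_prior_le hs hp hp0 hl k) _
    _ = _ := by
        have h1 : ∀ k, 0 ≤ 2 * a k * (s k * (80 * l + p / (4 * l))) := fun k =>
          mul_nonneg (mul_nonneg (by norm_num) (ha k)) (mul_nonneg (s k).coe_nonneg hl')
        have h2 : ∀ k, ENNReal.ofReal (2 * a k) * ENNReal.ofReal (s k * (80 * l + p / (4 * l))) =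
            ENNReal.ofReal (2 * a k * (s k * (80 * l + p / (4 * l)))) := fun k =>
          (ENNReal.ofReal_mul (mul_nonneg (by norm_num) (ha k))).symm
        simp_rw [h2]
        rw [← ENNReal.ofReal_mul (by positivity), ← ENNReal.ofReal_sum_of_nonneg fun k _ => h1 k,
          ← ENNReal.ofReal_add (by positivity) (Finset.sum_nonneg fun k _ => h1 k)]
        congr 2
        rw [Finset.mul_sum, Finset.sum_mul]
        exact Finset.sum_congr rfl fun k _ => by ring

end Prior

/-! ### Pinsker's filter and the minimax value -/

/-- The ratio `(k / w)^(β - 1)`. -/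
def pinskerRatio (β w : ℝ) (k : ℕ+) : ℝ := ((k : ℕ) / w) ^ (β - 1)

/-- The weights `(1 - (k / w)^(β - 1))₊` of the linear minimax filter. -/
def pinskerWeight (β w : ℝ) (k : ℕ+) : ℝ := max (1 - pinskerRatio β w k) 0

/-- The factor `(2πw)^(2β - 2)`. -/
def pinskerScale (β w : ℝ) : ℝ := ((2 * Real.pi * w) ^ (β - 1)) ^ 2

theorem card_le_of_forall_le {K : Finset ℕ+} {w : ℝ} (hw : 0 ≤ w) (hK : ∀ k ∈ K, ((k : ℕ) : ℝ) ≤ w) :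
    (K.card : ℝ) ≤ w := by
  have h1 : K.map ⟨((↑) : ℕ+ → ℕ), PNat.coe_injective⟩ ⊆ Finset.Icc 1 ⌊w⌋₊ := by
    intro m hm
    rw [Finset.mem_map] at hm
    obtain ⟨k, hk, rfl⟩ := hm
    rw [Finset.mem_Icc]
    exact ⟨k.pos, Nat.le_floor (hK k hk)⟩
  have h2 := Finset.card_le_card h1
  rw [Finset.card_map, Nat.card_Icc, Nat.add_sub_cancel] at h2
  exact (Nat.cast_le.2 h2).trans (Nat.floor_le hw)

section Weights

variable {β w : ℝ} {k : ℕ+}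

theorem pinskerRatio_pos (hw : 0 < w) : 0 < pinskerRatio β w k :=
  Real.rpow_pos_of_pos (by positivity) _

theorem pinskerRatio_le_one (hβ : 1 ≤ β) (hw : 0 < w) (hk : (k : ℝ) ≤ w) : pinskerRatio β w k ≤ 1 :=
  Real.rpow_le_one (by positivity) ((div_le_one hw).2 hk) (by linarith)

theorem one_le_pinskerRatio (hβ : 1 ≤ β) (hw : 0 < w) (hk : w ≤ (k : ℝ)) :
    1 ≤ pinskerRatio β w k :=
  Real.one_le_rpow ((one_le_div hw).2 hk) (by linarith)

theorem le_pinskerRatio (hβ : 1 ≤ β) (hw : 0 < w) {x : ℝ} (hx : 0 ≤ x) (hk : x * w ≤ (k : ℝ)) :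
    x ^ (β - 1) ≤ pinskerRatio β w k :=
  Real.rpow_le_rpow hx ((le_div_iff₀ hw).2 hk) (by linarith)

theorem pinskerRatio_le (hβ : 1 ≤ β) (hw : 0 < w) {x : ℝ} (hk : (k : ℝ) ≤ x * w) :
    pinskerRatio β w k ≤ x ^ (β - 1) :=
  Real.rpow_le_rpow (by positivity) ((div_le_iff₀ hw).2 hk) (by linarith)

theorem pinskerWeight_nonneg : 0 ≤ pinskerWeight β w k := le_max_right _ _

theorem pinskerWeight_le_one (hw : 0 < w) : pinskerWeight β w k ≤ 1 :=
  max_le (by linarith [pinskerRatio_pos (β := β) (k := k) hw]) zero_le_one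

theorem pinskerWeight_eq_zero (hβ : 1 ≤ β) (hw : 0 < w) (hk : w ≤ (k : ℝ)) :
    pinskerWeight β w k = 0 :=
  max_eq_right (by linarith [one_le_pinskerRatio hβ hw hk])

theorem pinskerWeight_eq (hβ : 1 ≤ β) (hw : 0 < w) (hk : (k : ℝ) ≤ w) :
    pinskerWeight β w k = 1 - pinskerRatio β w k :=
  max_eq_left (by linarith [pinskerRatio_le_one hβ hw hk])

theorem pinskerWeight_pos (hβ : 1 < β) (hw : 0 < w) (hk : (k : ℝ) < w) :
    0 < pinskerWeight β w k := by
  rw [pinskerWeight_eq hβ.le hw hk.le, sub_pos]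
  exact Real.rpow_lt_one (by positivity) ((div_lt_one hw).2 hk) (by linarith)

theorem pinskerWeight_mul_add (hβ : 1 ≤ β) (hw : 0 < w) :
    pinskerWeight β w k * (pinskerRatio β w k + pinskerWeight β w k) = pinskerWeight β w k := by
  rcases le_total (k : ℝ) w with hk | hk
  · rw [pinskerWeight_eq hβ hw hk]
    ring
  · rw [pinskerWeight_eq_zero hβ hw hk, zero_mul]

theorem one_sub_pinskerWeight_sq_le (hβ : 1 ≤ β) (hw : 0 < w) :
    (1 - pinskerWeight β w k) ^ 2 ≤ pinskerRatio β w k ^ 2 := by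
  rcases le_total (k : ℝ) w with hk | hk
  · rw [pinskerWeight_eq hβ hw hk]
    ring_nf
    exact le_rfl
  · rw [pinskerWeight_eq_zero hβ hw hk]
    exact pow_le_pow_left₀ (by norm_num) (by linarith [one_le_pinskerRatio hβ hw hk]) 2

theorem pinskerScale_pos (hw : 0 < w) : 0 < pinskerScale β w := by
  unfold pinskerScale
  positivity

theorem rpow_two_mul_eq (hw : 0 < w) : (2 * Real.pi * (k : ℕ)) ^ (2 * β) =
    (2 * Real.pi * (k : ℕ)) ^ 2 * (pinskerScale β w * pinskerRatio β w k ^ 2) := by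
  have hk : (0 : ℝ) < (k : ℕ) := by exact_mod_cast k.pos
  have h1 : (2 * Real.pi * (k : ℕ)) ^ (β - 1) =
      (2 * Real.pi * w) ^ (β - 1) * pinskerRatio β w k := by
    rw [pinskerRatio, ← Real.mul_rpow (by positivity) (by positivity)]
    congr 1
    field_simp
  rw [pinskerScale, ← mul_pow, ← h1, ← Real.rpow_natCast _ 2, ← Real.rpow_natCast _ 2,
    ← Real.rpow_mul (by positivity), ← Real.rpow_add (by positivity)]
  congr 1
  push_cast
  ring

/-- The sum whose equation with `L / ε²` determines the cutoff frequency `w`. -/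
def pinskerSum (β w : ℝ) (n : ℕ+) : ℝ := ∑ k ∈ Finset.Icc 1 n, (2 * Real.pi * (k : ℕ)) ^ 2 *
  (pinskerScale β w * (pinskerRatio β w k * pinskerWeight β w k))

/-- The sum `∑ (2πk)² h_k`. -/
def pinskerInfo (β w : ℝ) (n : ℕ+) : ℝ := ∑ k ∈ Finset.Icc 1 n, (2 * Real.pi * (k : ℕ)) ^ 2 *
  pinskerWeight β w k

theorem continuousOn_pinskerSum (β : ℝ) (n : ℕ+) :
    ContinuousOn (fun w => pinskerSum β w n) (Icc 1 (n : ℝ)) := by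
  have h0 : ∀ w ∈ Icc 1 (n : ℝ), w ≠ 0 := fun w hw => by linarith [hw.1]
  have hr : ∀ k : ℕ+, ContinuousOn (fun w => pinskerRatio β w k) (Icc 1 (n : ℝ)) := fun k => by
    unfold pinskerRatio
    refine ContinuousOn.rpow_const (continuousOn_const.div continuousOn_id h0) fun w hw => Or.inl ?_
    have := h0 w hw
    exact div_ne_zero (by exact_mod_cast k.ne_zero) this
  have hs : ContinuousOn (fun w => pinskerScale β w) (Icc 1 (n : ℝ)) := by
    unfold pinskerScale
    refine ContinuousOn.pow (ContinuousOn.rpow_const (by fun_prop) fun w hw => Or.inl ?_) 2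
    have := h0 w hw
    positivity
  unfold pinskerSum
  refine continuousOn_finsetSum _ fun k _ => continuousOn_const.mul (hs.mul ((hr k).mul ?_))
  exact (continuousOn_const.sub (hr k)).sup continuousOn_const

/-- Intermediate value theorem on [1, n]: at w = 1 all weights vanish, and at w = n the term k = 1
alone already exceeds `y`. The truncation at n ≥ w loses nothing, as the weights vanish from w on.
-/
theorem exists_pinskerSum_eq (hβ : 2 ≤ β) {y : ℝ} (hy : 0 ≤ y) :
    ∃ (n : ℕ+) (w : ℝ), 1 ≤ w ∧ w ≤ (n : ℕ) ∧ pinskerSum β w n = y := by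
  -- The lower bound 2 ensures 1 ≤ m/2, so that the ratio at k = 1 is at most 1/2 and the weight at
  -- least 1/2.
  obtain ⟨m, hm⟩ := exists_nat_ge (max y 2)
  have hm2 : (2 : ℝ) ≤ m := (le_max_right _ _).trans hm
  have hmpos : 0 < m := by
    have : (0 : ℝ) < m := by linarith
    exact_mod_cast this
  set n : ℕ+ := ⟨m, hmpos⟩ with hn
  have hnm : ((n : ℕ) : ℝ) = m := rfl
  have hm1 : (1 : ℝ) ≤ (n : ℕ) := by rw [hnm]; linarith
  have h1 : pinskerSum β 1 n = 0 := by
    refine Finset.sum_eq_zero fun k _ => ?_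
    rw [pinskerWeight_eq_zero (by linarith) one_pos (one_le_pnat_cast k)]
    ring
  have h2 : y ≤ pinskerSum β (n : ℕ) n := by
    have hnpos : (0 : ℝ) < (n : ℕ) := by linarith
    have hterm := Finset.single_le_sum (s := Finset.Icc 1 n) (a := 1)
      (f := fun k : ℕ+ => (2 * Real.pi * (k : ℕ)) ^ 2 * (pinskerScale β (n : ℕ) *
        (pinskerRatio β (n : ℕ) k * pinskerWeight β (n : ℕ) k)))
      (fun k _ => mul_nonneg (sq_nonneg _) (mul_nonneg (pinskerScale_pos hnpos).le
        (mul_nonneg (pinskerRatio_pos hnpos).le pinskerWeight_nonneg)))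
      (Finset.mem_Icc.2 ⟨le_rfl, one_le⟩)
    refine le_trans ?_ hterm
    have hpi := Real.pi_gt_three
    have hu : pinskerRatio β (n : ℕ) 1 ≤ 1 / 2 := by
      have h3 := pinskerRatio_le (β := β) (k := 1) (w := (n : ℕ)) (x := 1 / 2) (by linarith) hnpos (by
        rw [hnm]
        norm_num
        linarith)
      refine h3.trans (Real.rpow_le_self_of_le_one (by norm_num) (by norm_num) (by linarith))
    have hh : 1 / 2 ≤ pinskerWeight β (n : ℕ) 1 := le_trans (by linarith) (le_max_left _ _)
    have hG : (m : ℝ) ≤ pinskerScale β (n : ℕ) * pinskerRatio β (n : ℕ) 1 := by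
      have h4 : (2 * Real.pi * (n : ℕ)) ^ (β - 1) * pinskerRatio β (n : ℕ) 1 =
          (2 * Real.pi) ^ (β - 1) := by
        rw [pinskerRatio, ← Real.mul_rpow (by positivity) (by positivity)]
        congr 1
        simp only [PNat.one_coe, Nat.cast_one]
        field_simp
      have h5 : 1 ≤ (2 * Real.pi) ^ (β - 1) := Real.one_le_rpow (by linarith) (by linarith)
      have h6 : (m : ℝ) ≤ (2 * Real.pi * (n : ℕ)) ^ (β - 1) := by
        calc (m : ℝ) ≤ 2 * Real.pi * (n : ℕ) := by rw [hnm]; nlinarith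
          _ ≤ _ := Real.self_le_rpow_of_one_le (by rw [hnm]; nlinarith) (by linarith)
      rw [pinskerScale, sq, mul_assoc, h4]
      nlinarith
    have hpi2 : (2 : ℝ) ≤ (2 * Real.pi * ((1 : ℕ+) : ℕ)) ^ 2 := by
      simp only [PNat.one_coe, Nat.cast_one, mul_one]
      nlinarith
    have h7 : (m : ℝ) * (1 / 2) ≤ pinskerScale β (n : ℕ) *
        (pinskerRatio β (n : ℕ) 1 * pinskerWeight β (n : ℕ) 1) := by
      rw [← mul_assoc]
      exact mul_le_mul hG hh (by norm_num) ((Nat.cast_nonneg m).trans hG)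
    have h8 := mul_le_mul hpi2 h7 (by positivity) (by positivity)
    have h9 := (le_max_left y 2).trans hm
    linarith
  obtain ⟨w, hw, hwy⟩ := intermediate_value_Icc hm1 (continuousOn_pinskerSum β n)
    (show y ∈ Icc _ _ from ⟨by simpa only [h1] using hy, h2⟩)
  exact ⟨n, w, hw.1, hw.2, hwy⟩

/-- The filter h is tested. Since (1 - h)² ≤ u² and u² is (2πk)^(2β-2) divided by the scale, the
bias is at most L/scale uniformly over the ellipsoid. By the equation for w this equals ε²∑(2πk)²uh;
adding the variance ε²∑(2πk)²h² and using h(u + h) = h gives the bound. -/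
theorem pinskerValue_le (hβ : 1 ≤ β) (hw : 0 < w) {n : ℕ+} (hwn : w ≤ (n : ℕ)) {ε L : ℝ}
    (hL : ε ^ 2 * pinskerSum β w n = L) :
    pinskerValue β L ε ≤ ENNReal.ofReal (ε ^ 2 * pinskerInfo β w n) := by
  have hG := pinskerScale_pos (β := β) hw
  have hzero : ∀ k : ℕ+, k ∉ Finset.Icc 1 n → pinskerWeight β w k = 0 := by
    intro k hk
    refine pinskerWeight_eq_zero hβ hw (hwn.trans ?_)
    rw [Finset.mem_Icc, not_and] at hk
    have := not_le.1 (hk one_le)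
    exact_mod_cast this.le
  have hmem : Memℓp (pinskerWeight β w) 2 := by
    refine memℓp_gen (summable_of_ne_finset_zero (s := Finset.Icc 1 n) fun k hk => ?_)
    rw [hzero k hk]
    norm_num
  refine iInf₂_le_of_le _ hmem (iSup₂_le fun f hf => ?_)
  have hL0 : 0 ≤ L := by
    rw [← hL]
    exact mul_nonneg (sq_nonneg _) (Finset.sum_nonneg fun k _ => mul_nonneg (sq_nonneg _)
      (mul_nonneg hG.le (mul_nonneg (pinskerRatio_pos hw).le pinskerWeight_nonneg)))
  calc quadRisk ε f (pinskerWeight β w)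
      ≤ ∑' k : ℕ+, (ENNReal.ofReal (pinskerScale β w)⁻¹ *
          ENNReal.ofReal ((2 * Real.pi * (k : ℕ)) ^ (2 * β) * cosCoeff f k ^ 2) +
          ENNReal.ofReal (ε ^ 2 * ((2 * Real.pi * (k : ℕ)) ^ 2 * pinskerWeight β w k ^ 2))) := by
        refine ENNReal.tsum_le_tsum fun k => ?_
        rw [← ENNReal.ofReal_mul (by positivity), ← ENNReal.ofReal_add (by positivity)
          (by positivity)]
        refine ENNReal.ofReal_le_ofReal ?_
        rw [rpow_two_mul_eq hw]
        have h1 := mul_le_mul_of_nonneg_right (one_sub_pinskerWeight_sq_le (k := k) hβ hw)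
          (show 0 ≤ (2 * Real.pi * ((k : ℕ) : ℝ)) ^ 2 * cosCoeff f k ^ 2 by positivity)
        have h2 : (pinskerScale β w)⁻¹ * ((2 * Real.pi * (k : ℕ)) ^ 2 *
            (pinskerScale β w * pinskerRatio β w k ^ 2) * cosCoeff f k ^ 2) =
            pinskerRatio β w k ^ 2 * ((2 * Real.pi * (k : ℕ)) ^ 2 * cosCoeff f k ^ 2) := by
          field_simp
        rw [h2]
        linarith
    _ = ENNReal.ofReal (pinskerScale β w)⁻¹ * sobolevSq f β +
          ENNReal.ofReal (ε ^ 2 * ∑ k ∈ Finset.Icc 1 n,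
            (2 * Real.pi * (k : ℕ)) ^ 2 * pinskerWeight β w k ^ 2) := by
        rw [ENNReal.tsum_add, ENNReal.tsum_mul_left, sobolevSq]
        congr 1
        rw [tsum_eq_sum (s := Finset.Icc 1 n) fun k hk => by rw [hzero k hk]; simp,
          Finset.mul_sum, ENNReal.ofReal_sum_of_nonneg fun k _ => by positivity]
    _ ≤ ENNReal.ofReal (pinskerScale β w)⁻¹ * ENNReal.ofReal L +
          ENNReal.ofReal (ε ^ 2 * ∑ k ∈ Finset.Icc 1 n,
            (2 * Real.pi * (k : ℕ)) ^ 2 * pinskerWeight β w k ^ 2) := by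
        gcongr
        exact hf.2
    _ = _ := by
        rw [← ENNReal.ofReal_mul (by positivity), ← ENNReal.ofReal_add (by positivity)
          (mul_nonneg (sq_nonneg _) (Finset.sum_nonneg fun k _ => by positivity))]
        congr 1
        rw [← hL, pinskerSum, pinskerInfo, Finset.mul_sum, Finset.mul_sum, Finset.mul_sum,
          Finset.mul_sum, ← Finset.sum_add_distrib]
        refine Finset.sum_congr rfl fun k _ => ?_
        have h3 := pinskerWeight_mul_add (k := k) hβ hw
        have h4 : (pinskerScale β w)⁻¹ * pinskerScale β w = 1 := inv_mul_cancel₀ hG.ne'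
        linear_combination ε ^ 2 * (2 * Real.pi * (k : ℕ)) ^ 2 * h3 +
          ε ^ 2 * (2 * Real.pi * (k : ℕ)) ^ 2 * pinskerRatio β w k * pinskerWeight β w k * h4

end Weights

/-- The number of frequencies between `w / 4` and `w / 2`. -/
theorem div_eight_le_card {w : ℝ} (hw : 8 ≤ w) {n : ℕ+} (hwn : w ≤ (n : ℕ)) :
    w / 8 ≤ (((Finset.Icc 1 n).filter fun k : ℕ+ =>
      w / 4 ≤ ((k : ℕ) : ℝ) ∧ ((k : ℕ) : ℝ) ≤ w / 2).card : ℝ) := by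
  obtain ⟨a, ha⟩ : ∃ a : ℕ+, (a : ℕ) = ⌈w / 4⌉₊ := ⟨⟨_, Nat.ceil_pos.2 (by linarith)⟩, rfl⟩
  obtain ⟨b, hb⟩ : ∃ b : ℕ+, (b : ℕ) = ⌊w / 2⌋₊ := ⟨⟨_, Nat.floor_pos.2 (by linarith)⟩, rfl⟩
  have h1 : Finset.Icc a b ⊆ (Finset.Icc 1 n).filter
      fun k : ℕ+ => w / 4 ≤ ((k : ℕ) : ℝ) ∧ ((k : ℕ) : ℝ) ≤ w / 2 := by
    intro k hk
    rw [Finset.mem_Icc, ← PNat.coe_le_coe, ← PNat.coe_le_coe, ha, hb] at hk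
    have h2 : ((k : ℕ) : ℝ) ≤ w / 2 := (Nat.cast_le.2 hk.2).trans (Nat.floor_le (by linarith))
    rw [Finset.mem_filter, Finset.mem_Icc]
    refine ⟨⟨one_le, ?_⟩, Nat.ceil_le.1 hk.1, h2⟩
    rw [← PNat.coe_le_coe]
    have : ((k : ℕ) : ℝ) ≤ (n : ℕ) := by linarith
    exact_mod_cast this
  have h2 := Finset.card_le_card h1
  rw [PNat.card_Icc, ha, hb] at h2
  refine le_trans ?_ (Nat.cast_le.2 h2)
  have h3 := Nat.lt_floor_add_one (w / 2)
  have h4 := Nat.ceil_lt_add_one (show 0 ≤ w / 4 by linarith)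
  have h5 : ((⌊w / 2⌋₊ + 1 : ℕ) : ℝ) - (⌈w / 4⌉₊ : ℕ) ≤ ((⌊w / 2⌋₊ + 1 - ⌈w / 4⌉₊ : ℕ) : ℝ) := by
    rw [sub_le_iff_le_add, ← Nat.cast_add]
    exact Nat.cast_le.2 (by omega)
  push_cast at h5
  linarith

/-! ### Orders of magnitude and the prior variances -/

section Orders

variable {β w : ℝ} {n : ℕ+}

theorem sum_le_of_le_cutoff {K : Finset ℕ+} {F : ℕ+ → ℝ} {w B : ℝ} (hw : 0 ≤ w) (hB : 0 ≤ B)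
    (hF : ∀ k ∈ K, F k ≤ B) (hK : ∀ k ∈ K, ((k : ℕ) : ℝ) ≤ w) : ∑ k ∈ K, F k ≤ w * B := by
  refine (Finset.sum_le_card_nsmul K F B hF).trans ?_
  rw [nsmul_eq_mul]
  exact mul_le_mul_of_nonneg_right (card_le_of_forall_le hw hK) hB

theorem pinskerTerm_le (hβ : 1 ≤ β) (hw : 0 < w) {k : ℕ+} (hk : (k : ℝ) ≤ w) :
    (2 * Real.pi * (k : ℕ)) ^ 2 * (pinskerScale β w * (pinskerRatio β w k * pinskerWeight β w k)) ≤
      (2 * Real.pi * w) ^ 2 * pinskerScale β w := by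
  have h1 := pinskerScale_pos (β := β) hw
  have h2 : pinskerRatio β w k * pinskerWeight β w k ≤ 1 :=
    mul_le_one₀ (pinskerRatio_le_one hβ hw hk) pinskerWeight_nonneg (pinskerWeight_le_one hw)
  have h3 : (2 * Real.pi * ((k : ℕ) : ℝ)) ^ 2 ≤ (2 * Real.pi * w) ^ 2 := by gcongr
  refine mul_le_mul h3 (mul_le_of_le_one_right h1.le h2) ?_ (sq_nonneg _)
  exact mul_nonneg h1.le (mul_nonneg (pinskerRatio_pos hw).le pinskerWeight_nonneg)

theorem pinskerSum_le (hβ : 1 ≤ β) (hw : 0 < w) :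
    pinskerSum β w n ≤ (2 * Real.pi) ^ 2 * (pinskerScale β w * w ^ 3) := by
  have h0 : pinskerSum β w n = ∑ k ∈ (Finset.Icc 1 n).filter fun k : ℕ+ => ((k : ℕ) : ℝ) ≤ w,
      (2 * Real.pi * (k : ℕ)) ^ 2 *
        (pinskerScale β w * (pinskerRatio β w k * pinskerWeight β w k)) := by
    rw [Finset.sum_filter_of_ne]
    · rfl
    · intro k _ hk
      by_contra hkw
      rw [pinskerWeight_eq_zero hβ hw (not_le.1 hkw).le] at hk
      simp at hk
  rw [h0]
  refine (sum_le_of_le_cutoff hw.le (mul_nonneg (sq_nonneg (2 * Real.pi * w))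
    (pinskerScale_pos (β := β) hw).le) (fun k hk => pinskerTerm_le hβ hw (Finset.mem_filter.1 hk).2)
    fun k hk => (Finset.mem_filter.1 hk).2).trans (le_of_eq ?_)
  ring

theorem half_le_pinskerWeight (hβ : 2 ≤ β) (hw : 0 < w) {k : ℕ+} (hk : (k : ℝ) ≤ w / 2) :
    1 / 2 ≤ pinskerWeight β w k := by
  have h1 := pinskerRatio_le (β := β) (x := 1 / 2) (k := k) (by linarith) hw (by linarith)
  have h2 : (1 / 2 : ℝ) ^ (β - 1) ≤ 1 / 2 :=
    Real.rpow_le_self_of_le_one (by norm_num) (by norm_num) (by linarith)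
  exact le_trans (by linarith) (le_max_left _ _)

/-- The frequencies in [w/4, w/2] suffice: there are at least w/8 of them, with weight at least 1/2
and (2πk)² at least (2πw/4)², and 8·2·16 = 256. -/
theorem le_pinskerInfo (hβ : 2 ≤ β) (hw : 8 ≤ w) (hwn : w ≤ (n : ℕ)) :
    (2 * Real.pi) ^ 2 / 256 * w ^ 3 ≤ pinskerInfo β w n := by
  have hw0 : 0 < w := by linarith
  have hcard := div_eight_le_card hw hwn
  set M := (Finset.Icc 1 n).filter fun k : ℕ+ => w / 4 ≤ ((k : ℕ) : ℝ) ∧ ((k : ℕ) : ℝ) ≤ w / 2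
  calc (2 * Real.pi) ^ 2 / 256 * w ^ 3 = w / 8 * ((2 * Real.pi * (w / 4)) ^ 2 * (1 / 2)) := by ring
    _ ≤ M.card * ((2 * Real.pi * (w / 4)) ^ 2 * (1 / 2)) := by gcongr
    _ ≤ ∑ k ∈ M, (2 * Real.pi * (k : ℕ)) ^ 2 * pinskerWeight β w k := by
        rw [← nsmul_eq_mul]
        refine Finset.card_nsmul_le_sum _ _ _ fun k hk => ?_
        have hk' := (Finset.mem_filter.1 hk).2
        have h1 : (2 * Real.pi * (w / 4)) ^ 2 ≤ (2 * Real.pi * ((k : ℕ) : ℝ)) ^ 2 := by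
          have := hk'.1
          gcongr
        exact mul_le_mul h1 (half_le_pinskerWeight hβ hw0 hk'.2) (by norm_num) (sq_nonneg _)
    _ ≤ _ := Finset.sum_le_sum_of_subset_of_nonneg (Finset.filter_subset _ _) fun k _ _ =>
        mul_nonneg (sq_nonneg _) pinskerWeight_nonneg

theorem le_pinskerSum (hβ : 2 ≤ β) (hw : 8 ≤ w) (hwn : w ≤ (n : ℕ)) :
    (2 * Real.pi) ^ 2 / 256 * (1 / 4) ^ (β - 1) * (pinskerScale β w * w ^ 3) ≤
      pinskerSum β w n := by
  have hw0 : 0 < w := by linarith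
  have hG := pinskerScale_pos (β := β) hw0
  have hcard := div_eight_le_card hw hwn
  set M := (Finset.Icc 1 n).filter fun k : ℕ+ => w / 4 ≤ ((k : ℕ) : ℝ) ∧ ((k : ℕ) : ℝ) ≤ w / 2
  set x : ℝ := (1 / 4) ^ (β - 1) with hx
  have hx0 : 0 ≤ x := by positivity
  calc (2 * Real.pi) ^ 2 / 256 * x * (pinskerScale β w * w ^ 3)
      = w / 8 * ((2 * Real.pi * (w / 4)) ^ 2 * (pinskerScale β w * (x * (1 / 2)))) := by ring
    _ ≤ M.card * ((2 * Real.pi * (w / 4)) ^ 2 * (pinskerScale β w * (x * (1 / 2)))) := by gcongr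
    _ ≤ ∑ k ∈ M, (2 * Real.pi * (k : ℕ)) ^ 2 *
          (pinskerScale β w * (pinskerRatio β w k * pinskerWeight β w k)) := by
        rw [← nsmul_eq_mul]
        refine Finset.card_nsmul_le_sum _ _ _ fun k hk => ?_
        have hk' := (Finset.mem_filter.1 hk).2
        have h1 : (2 * Real.pi * (w / 4)) ^ 2 ≤ (2 * Real.pi * ((k : ℕ) : ℝ)) ^ 2 := by
          have := hk'.1
          gcongr
        have h2 : x ≤ pinskerRatio β w k :=
          le_pinskerRatio (by linarith) hw0 (by norm_num) (by linarith [hk'.1])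
        have h3 := half_le_pinskerWeight hβ hw0 hk'.2
        have h4 := (pinskerRatio_pos (β := β) (k := k) hw0).le
        gcongr
    _ ≤ _ := Finset.sum_le_sum_of_subset_of_nonneg (Finset.filter_subset _ _) fun k _ _ =>
        mul_nonneg (sq_nonneg _) (mul_nonneg hG.le
          (mul_nonneg (pinskerRatio_pos hw0).le pinskerWeight_nonneg))

/-- The frequencies between `κw` and `w`. -/
def sieveFreq (κ w : ℝ) (n : ℕ+) : Finset ℕ+ :=
  (Finset.Icc 1 n).filter fun k => κ * w ≤ ((k : ℕ) : ℝ) ∧ ((k : ℕ) : ℝ) < w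

theorem mem_sieveFreq {κ : ℝ} {k : ℕ+} (hk : k ∈ sieveFreq κ w n) :
    κ * w ≤ ((k : ℕ) : ℝ) ∧ ((k : ℕ) : ℝ) < w := (Finset.mem_filter.1 hk).2

/-- At most κw frequencies are discarded at the bottom, each contributing at most (2πκw)², so the
relative loss is of order κ³. -/
theorem pinskerInfo_le_sum_sieveFreq (hβ : 1 ≤ β) (hw : 0 < w) {κ : ℝ} (hκ : 0 ≤ κ) :
    pinskerInfo β w n ≤ ∑ k ∈ sieveFreq κ w n, (2 * Real.pi * (k : ℕ)) ^ 2 * pinskerWeight β w k +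
      (2 * Real.pi) ^ 2 * κ ^ 3 * w ^ 3 := by
  have h1 : pinskerInfo β w n = ∑ k ∈ (Finset.Icc 1 n).filter (fun k : ℕ+ => ((k : ℕ) : ℝ) < w),
      (2 * Real.pi * (k : ℕ)) ^ 2 * pinskerWeight β w k := by
    rw [Finset.sum_filter_of_ne]
    · rfl
    · intro k _ hk
      by_contra hkw
      rw [pinskerWeight_eq_zero hβ hw (not_lt.1 hkw)] at hk
      simp at hk
  rw [h1, ← Finset.sum_filter_add_sum_filter_not _ (fun k : ℕ+ => κ * w ≤ ((k : ℕ) : ℝ)),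
    Finset.filter_filter, sieveFreq]
  refine add_le_add (le_of_eq (Finset.sum_congr (Finset.filter_congr fun k _ => and_comm)
    fun _ _ => rfl)) ?_
  have hκw : 0 ≤ κ * w := by positivity
  refine (sum_le_of_le_cutoff (w := κ * w) (B := (2 * Real.pi * (κ * w)) ^ 2) hκw (by positivity)
    (fun k hk => ?_) fun k hk => (not_le.1 (Finset.mem_filter.1 hk).2).le).trans (le_of_eq (by ring))
  have hk' := (not_le.1 (Finset.mem_filter.1 hk).2).le
  refine (mul_le_of_le_one_right (sq_nonneg _) (pinskerWeight_le_one hw)).trans ?_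
  gcongr

/-- The prior variances. -/
def sieveVar (g ε β w : ℝ) (k : ℕ+) : ℝ≥0 :=
  Real.toNNReal ((1 - g) * ε ^ 2 * (pinskerWeight β w k / pinskerRatio β w k))

variable {g ε κ : ℝ}

theorem coe_sieveVar (hg : g ≤ 1) (hw : 0 < w) (k : ℕ+) : (sieveVar g ε β w k : ℝ) =
    (1 - g) * ε ^ 2 * (pinskerWeight β w k / pinskerRatio β w k) :=
  Real.coe_toNNReal _ (mul_nonneg (mul_nonneg (by linarith) (sq_nonneg _))
    (div_nonneg pinskerWeight_nonneg (pinskerRatio_pos hw).le))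

theorem sieveVar_ne_zero (hg : g < 1) (hε : 0 < ε) (hβ : 1 < β) (hw : 0 < w) {k : ℕ+}
    (hk : k ∈ sieveFreq κ w n) : sieveVar g ε β w k ≠ 0 := by
  have h1 := pinskerWeight_pos hβ hw (mem_sieveFreq hk).2
  have h2 := pinskerRatio_pos (β := β) (k := k) hw
  have h3 : 0 < 1 - g := by linarith
  exact (Real.toNNReal_pos.2 (by positivity)).ne'

/-- Summed over the frequencies, the right-hand side is controlled by the equation for w, so the
prior mean lies in the ellipsoid with slack factor 1 - g. -/
theorem rpow_mul_sieveVar (hg : g ≤ 1) (hw : 0 < w) (k : ℕ+) :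
    (2 * Real.pi * (k : ℕ)) ^ (2 * β) * sieveVar g ε β w k = (1 - g) * (ε ^ 2 *
      ((2 * Real.pi * (k : ℕ)) ^ 2 *
        (pinskerScale β w * (pinskerRatio β w k * pinskerWeight β w k)))) := by
  have h2 := (pinskerRatio_pos (β := β) (k := k) hw).ne'
  rw [coe_sieveVar hg hw, rpow_two_mul_eq hw]
  field_simp

theorem sieveVar_le (hg0 : 0 ≤ g) (hg : g ≤ 1) (hβ : 1 ≤ β) (hw : 0 < w) (hκ : 0 < κ) {k : ℕ+}
    (hk : k ∈ sieveFreq κ w n) : (sieveVar g ε β w k : ℝ) ≤ ε ^ 2 / κ ^ (β - 1) := by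
  have h1 := le_pinskerRatio hβ hw hκ.le (mem_sieveFreq hk).1
  have h2 : 0 < κ ^ (β - 1) := Real.rpow_pos_of_pos hκ _
  rw [coe_sieveVar hg hw]
  calc (1 - g) * ε ^ 2 * (pinskerWeight β w k / pinskerRatio β w k)
      ≤ 1 * ε ^ 2 * (1 / κ ^ (β - 1)) := by
        have := pinskerWeight_le_one (β := β) (k := k) hw
        have := pinskerWeight_nonneg (β := β) (k := k) (w := w)
        have := pinskerRatio_pos (β := β) (k := k) hw
        gcongr
        linarith
    _ = _ := by ring

/-- For g = 0 the shrinkage factor s/(s + ε²) equals h/(h + u) = h. In general the denominator (1 -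
g)h + u is at most 1. -/
theorem le_posterior_sieveVar (hg0 : 0 ≤ g) (hg : g < 1) (hε : 0 < ε) (hβ : 1 ≤ β) (hw : 0 < w)
    {k : ℕ+} (hk : k ∈ sieveFreq κ w n) : (1 - g) * (ε ^ 2 * pinskerWeight β w k) ≤
      ε ^ 2 * (sieveVar g ε β w k / (sieveVar g ε β w k + ε ^ 2)) := by
  have hu := pinskerRatio_pos (β := β) (k := k) hw
  have hh := pinskerWeight_eq hβ hw (mem_sieveFreq hk).2.le
  have hh0 : 0 ≤ pinskerWeight β w k := pinskerWeight_nonneg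
  have h1g : 0 < 1 - g := by linarith
  rw [coe_sieveVar hg.le hw]
  set h := pinskerWeight β w k
  set u := pinskerRatio β w k
  have e : (1 - g) * ε ^ 2 * (h / u) / ((1 - g) * ε ^ 2 * (h / u) + ε ^ 2) =
      (1 - g) * h / ((1 - g) * h + u) := by
    field_simp
  rw [e, mul_left_comm]
  refine mul_le_mul_of_nonneg_left ?_ (sq_nonneg ε)
  have h3 : 0 ≤ (1 - g) * h := by positivity
  rw [le_div_iff₀ (by positivity)]
  refine mul_le_of_le_one_right h3 ?_
  nlinarith

end Orders

/-! ### Lower bound at a fixed noise level -/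

theorem sobolevSq_cosSeries_extendCoef {K : Finset ℕ+} (v : K → ℝ) (r : ℝ) :
    sobolevSq (cosSeries (extendCoef v)) r =
      ENNReal.ofReal (∑ k : K, (2 * Real.pi * (k : ℕ)) ^ (2 * r) * v k ^ 2) := by
  have hs : Summable fun k => |extendCoef v k| :=
    summable_extendCoef (g := fun _ x => |x|) (fun _ => abs_zero) v
  rw [sobolevSq, tsum_eq_sum (s := K) fun k hk => by
    rw [cosCoeff_cosSeries hs, extendCoef_of_notMem v hk]; simp, ← Finset.sum_coe_sort,
    ENNReal.ofReal_sum_of_nonneg fun k _ => by positivity]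
  exact Finset.sum_congr rfl fun k _ => by rw [cosCoeff_cosSeries hs, extendCoef_coe]

theorem cosSeries_add_extendCoef_mem_vicinity {K : Finset ℕ+} {b : ℕ+ → ℝ}
    (hb : Summable fun k => |b k|) {β L δ : ℝ} {v : K → ℝ}
    (hv1 : ∑ k : K, (2 * Real.pi * (k : ℕ)) ^ (2 * β) * v k ^ 2 ≤ L) (hv2 : ∑ k : K, v k ^ 2 ≤ δ ^ 2) :
    cosSeries (b + extendCoef v) ∈ vicinity β L (cosSeries b) δ := by
  have hs : Summable fun k => |extendCoef v k| :=
    summable_extendCoef (g := fun _ x => |x|) (fun _ => abs_zero) v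
  refine ⟨cosSeries (extendCoef v), ⟨hasCosineExpansion_cosSeries hs, ?_⟩, ?_, ?_⟩
  · rw [sobolevSq_cosSeries_extendCoef]
    exact ENNReal.ofReal_le_ofReal hv1
  · rw [sobolevSq_cosSeries_extendCoef]
    refine ENNReal.ofReal_le_ofReal (le_trans (le_of_eq ?_) hv2)
    simp
  · funext t
    rw [Pi.add_apply, cosSeries, cosSeries, cosSeries,
      ← (summable_cosSeries hb t).tsum_add (summable_cosSeries hs t)]
    exact tsum_congr fun k => by rw [Pi.add_apply, add_mul]

section Lower

variable {β w L ε g κ δ : ℝ} {n : ℕ+}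

/-- The coefficient vectors of the admissible perturbations. -/
def sieveSet (K : Finset ℕ+) (β L δ : ℝ) : Set (K → ℝ) :=
  {v | ∑ k : K, (2 * Real.pi * (k : ℕ)) ^ (2 * β) * v k ^ 2 ≤ L} ∩ {v | ∑ k : K, v k ^ 2 ≤ δ ^ 2}

theorem measurableSet_sieveSet (K : Finset ℕ+) (β L δ : ℝ) : MeasurableSet (sieveSet K β L δ) :=
  (measurableSet_le (by fun_prop) measurable_const).inter
    (measurableSet_le (by fun_prop) measurable_const)

/-- The first term is Chebyshev's bound for the ellipsoid, where the largest summand is of order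
L/w. The second is Markov's bound for the ball, with at most w variances bounded by ε²/κ^(β-1). -/
theorem gaussianPrior_sieveSet_compl_le (hβ : 2 ≤ β) (hw : 8 ≤ w) (hwn : w ≤ (n : ℕ)) (hL0 : 0 < L)
    (hε : 0 < ε) (hL : ε ^ 2 * pinskerSum β w n = L) (hg0 : 0 < g) (hg : g < 1) (hκ : 0 < κ)
    (hδ : 0 < δ) :
    gaussianPrior (fun k : sieveFreq κ w n => sieveVar g ε β w k)
        (sieveSet (sieveFreq κ w n) β L δ)ᶜ ≤
      ENNReal.ofReal (80 * 256 / (g ^ 2 * (1 / 4) ^ (β - 1) * w) +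
        ε ^ 2 * w / (κ ^ (β - 1) * δ ^ 2)) := by
  have hw0 : 0 < w := by linarith
  have hG := pinskerScale_pos (β := β) hw0
  have hμ : 0 < κ ^ (β - 1) := Real.rpow_pos_of_pos hκ _
  set x : ℝ := (1 / 4) ^ (β - 1) with hx
  have hx0 : 0 < x := by positivity
  have hs : ∀ k : sieveFreq κ w n, sieveVar g ε β w k ≠ 0 := fun k =>
    sieveVar_ne_zero hg hε (by linarith) hw0 k.2
  have h1 := gaussianPrior_ellipsoid_compl_le hs
    (a := fun k : sieveFreq κ w n => (2 * Real.pi * (k : ℕ)) ^ (2 * β)) (fun k => by positivity)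
    hL0 hg0 (M := ε ^ 2 * ((2 * Real.pi * w) ^ 2 * pinskerScale β w)) (by positivity)
    (fun k => by
      rw [rpow_mul_sieveVar hg.le hw0]
      refine (mul_le_of_le_one_left (mul_nonneg (sq_nonneg _) (mul_nonneg (sq_nonneg _)
        (mul_nonneg hG.le (mul_nonneg (pinskerRatio_pos hw0).le pinskerWeight_nonneg))))
        (by linarith)).trans ?_
      exact mul_le_mul_of_nonneg_left (pinskerTerm_le (by linarith) hw0 (mem_sieveFreq k.2).2.le)
        (sq_nonneg _))
    (by
      simp_rw [rpow_mul_sieveVar hg.le hw0]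
      rw [← Finset.mul_sum, ← Finset.mul_sum]
      refine mul_le_mul_of_nonneg_left ?_ (by linarith)
      rw [← hL, Finset.sum_coe_sort (sieveFreq κ w n) fun k => (2 * Real.pi * (k : ℕ)) ^ 2 *
        (pinskerScale β w * (pinskerRatio β w k * pinskerWeight β w k))]
      refine mul_le_mul_of_nonneg_left ?_ (sq_nonneg _)
      exact Finset.sum_le_sum_of_subset_of_nonneg (Finset.filter_subset _ _) fun k _ _ =>
        mul_nonneg (sq_nonneg _) (mul_nonneg hG.le
          (mul_nonneg (pinskerRatio_pos hw0).le pinskerWeight_nonneg)))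
  have h2 := gaussianPrior_ball_compl_le hs hδ
  have hsub : (sieveSet (sieveFreq κ w n) β L δ)ᶜ ⊆
      {v | L < ∑ k : sieveFreq κ w n, (2 * Real.pi * (k : ℕ)) ^ (2 * β) * v k ^ 2} ∪
        {v | δ ^ 2 < ∑ k : sieveFreq κ w n, v k ^ 2} := by
    intro v hv
    by_contra h
    rw [Set.mem_union, not_or] at h
    have h1 : v ∉ {v | L < ∑ k : sieveFreq κ w n, (2 * Real.pi * (k : ℕ)) ^ (2 * β) * v k ^ 2} := h.1
    have h2 : v ∉ {v | δ ^ 2 < ∑ k : sieveFreq κ w n, v k ^ 2} := h.2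
    rw [Set.mem_ofPred_eq, not_lt] at h1 h2
    exact hv ⟨h1, h2⟩
  refine (measure_mono hsub).trans ((measure_union_le _ _).trans ?_)
  rw [ENNReal.ofReal_add (by positivity) (by positivity)]
  refine add_le_add (h1.trans (ENNReal.ofReal_le_ofReal ?_))
    (h2.trans (ENNReal.ofReal_le_ofReal ?_))
  · have h3 : ε ^ 2 * ((2 * Real.pi) ^ 2 / 256 * x * (pinskerScale β w * w ^ 3)) ≤ L := by
      rw [← hL]
      exact mul_le_mul_of_nonneg_left (le_pinskerSum hβ hw hwn) (sq_nonneg _)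
    rw [div_le_div_iff₀ (by positivity) (by positivity)]
    have h4 : 0 ≤ 80 * 256 * g ^ 2 := by positivity
    nlinarith [mul_le_mul_of_nonneg_left h3 h4]
  · rw [Finset.sum_coe_sort (sieveFreq κ w n) fun k => (sieveVar g ε β w k : ℝ)]
    have h3 := sum_le_of_le_cutoff (K := sieveFreq κ w n) hw0.le (B := ε ^ 2 / κ ^ (β - 1)) (by positivity)
      (fun k hk => sieveVar_le hg0.le hg.le (by linarith) hw0 hκ hk)
      (fun k hk => (mem_sieveFreq hk).2.le)
    calc (∑ k ∈ sieveFreq κ w n, (sieveVar g ε β w k : ℝ)) / δ ^ 2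
        ≤ w * (ε ^ 2 / κ ^ (β - 1)) / δ ^ 2 := by gcongr
      _ = _ := by field_simp

/-- Above the lower cutoff κw the ellipsoid weight exceeds (2πk)² by the factor scale·κ^(2β-2), so
the ellipsoid constraint bounds the derivative of the perturbation. -/
theorem sum_sq_le_of_mem_sieveSet (hβ : 2 ≤ β) (hw : 0 < w) (hκ : 0 < κ)
    {v : sieveFreq κ w n → ℝ} (hv : v ∈ sieveSet (sieveFreq κ w n) β L δ) :
    ∑ k : sieveFreq κ w n, (2 * Real.pi * (k : ℕ)) ^ 2 * v k ^ 2 ≤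
      L / (pinskerScale β w * (κ ^ (β - 1)) ^ 2) := by
  have hG := pinskerScale_pos (β := β) hw
  have hμ : 0 < κ ^ (β - 1) := Real.rpow_pos_of_pos hκ _
  rw [le_div_iff₀ (by positivity), Finset.sum_mul]
  refine (Finset.sum_le_sum fun k _ => ?_).trans hv.1
  rw [rpow_two_mul_eq hw]
  have h1 := le_pinskerRatio (β := β) (by linarith) hw hκ.le (mem_sieveFreq k.2).1
  have h2 : (κ ^ (β - 1)) ^ 2 ≤ pinskerRatio β w k ^ 2 := by gcongr
  calc _ = (2 * Real.pi * (k : ℕ)) ^ 2 * (pinskerScale β w * (κ ^ (β - 1)) ^ 2) * v k ^ 2 := by ring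
    _ ≤ _ := by gcongr

theorem sum_sq_mul_sieveVar_le (hβ : 2 ≤ β) (hw0 : 0 < w) (hg0 : 0 ≤ g) (hg : g ≤ 1) (hκ : 0 < κ) :
    ∑ k : sieveFreq κ w n, (2 * Real.pi * (k : ℕ)) ^ 2 * (sieveVar g ε β w k : ℝ) ≤
      (2 * Real.pi) ^ 2 * (ε ^ 2 * w ^ 3) / κ ^ (β - 1) := by
  have hμ : 0 < κ ^ (β - 1) := Real.rpow_pos_of_pos hκ _
  rw [Finset.sum_coe_sort (sieveFreq κ w n) fun k => (2 * Real.pi * (k : ℕ)) ^ 2 * (sieveVar g ε β w k : ℝ)]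
  refine (sum_le_of_le_cutoff hw0.le (B := (2 * Real.pi * w) ^ 2 * (ε ^ 2 / κ ^ (β - 1))) (by positivity)
    (fun k hk => ?_) (fun k hk => (mem_sieveFreq hk).2.le)).trans (le_of_eq (by ring))
  have h1 := (mem_sieveFreq hk).2.le
  have h2 := sieveVar_le (ε := ε) hg0 hg (by linarith : 1 ≤ β) hw0 hκ hk
  gcongr

/-- All losses are measured in the unit (2π)²ε²w³, of which the main term is at least 1/256. Losses
below g/256 therefore cost a fraction g, in addition to the g from the shrunk variances. -/
theorem le_sum_posterior_sieveVar (hβ : 2 ≤ β) (hw : 8 ≤ w) (hwn : w ≤ (n : ℕ)) (hε : 0 < ε)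
    (hg0 : 0 < g) (hg : g < 1) (hκ : 0 < κ) {μ p l D V : ℝ} (hp0 : 0 ≤ p) (hl : 0 < l)
    (hDQ : D ≤ (2 * Real.pi) ^ 2 * (ε ^ 2 * w ^ 3) / μ ^ 2)
    (hVQ : V ≤ (2 * Real.pi) ^ 2 * (ε ^ 2 * w ^ 3) / μ)
    (hq : 2 * p / μ ^ 2 + 2 * (80 * l + p / (4 * l)) / μ + κ ^ 3 ≤ g / 256) :
    (1 - 2 * g) * (ε ^ 2 * pinskerInfo β w n) ≤
      ∑ k : sieveFreq κ w n, (2 * Real.pi * (k : ℕ)) ^ 2 *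
        (ε ^ 2 * (sieveVar g ε β w k / (sieveVar g ε β w k + ε ^ 2))) -
        (2 * D * p + 2 * V * (80 * l + p / (4 * l))) := by
  have hw0 : 0 < w := by linarith
  have hInfo := le_pinskerInfo hβ hw hwn
  have hBQ : (2 * Real.pi) ^ 2 / 256 * (ε ^ 2 * w ^ 3) ≤ ε ^ 2 * pinskerInfo β w n := by
    have := mul_le_mul_of_nonneg_left hInfo (sq_nonneg ε)
    linarith
  have hl0 : 0 ≤ 80 * l + p / (4 * l) := by positivity
  have h1 : (1 - g) * (ε ^ 2 * ∑ k ∈ sieveFreq κ w n, (2 * Real.pi * (k : ℕ)) ^ 2 * pinskerWeight β w k) ≤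
      ∑ k : sieveFreq κ w n, (2 * Real.pi * (k : ℕ)) ^ 2 * (ε ^ 2 * (sieveVar g ε β w k / (sieveVar g ε β w k + ε ^ 2))) := by
    rw [← Finset.sum_coe_sort, Finset.mul_sum, Finset.mul_sum]
    refine Finset.sum_le_sum fun k _ => ?_
    have h2 := mul_le_mul_of_nonneg_left
      (le_posterior_sieveVar hg0.le (by linarith) hε (by linarith : 1 ≤ β) hw0 k.2)
      (sq_nonneg (2 * Real.pi * ((k : ℕ+) : ℕ)))
    refine le_trans (le_of_eq ?_) h2
    ring
  have h2 := mul_le_mul_of_nonneg_left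
    (pinskerInfo_le_sum_sieveFreq (β := β) (n := n) (by linarith) hw0 hκ.le) (sq_nonneg ε)
  have h3 : 2 * D * p + 2 * V * (80 * l + p / (4 * l)) + (2 * Real.pi) ^ 2 * κ ^ 3 * (ε ^ 2 * w ^ 3) ≤
      (2 * Real.pi) ^ 2 * (ε ^ 2 * w ^ 3) * (g / 256) := by
    refine le_trans ?_ (mul_le_mul_of_nonneg_left hq
      (show 0 ≤ (2 * Real.pi) ^ 2 * (ε ^ 2 * w ^ 3) by positivity))
    have h4 : 2 * D * p ≤ 2 * ((2 * Real.pi) ^ 2 * (ε ^ 2 * w ^ 3) / μ ^ 2) * p := by gcongr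
    have h5 : 2 * V * (80 * l + p / (4 * l)) ≤
        2 * ((2 * Real.pi) ^ 2 * (ε ^ 2 * w ^ 3) / μ) * (80 * l + p / (4 * l)) := by gcongr
    refine (add_le_add (add_le_add h4 h5) le_rfl).trans (le_of_eq ?_)
    ring
  have h4 : (1 - g) * (ε ^ 2 * pinskerInfo β w n - (2 * Real.pi) ^ 2 * κ ^ 3 * (ε ^ 2 * w ^ 3)) ≤
      (1 - g) * (ε ^ 2 * ∑ k ∈ sieveFreq κ w n, (2 * Real.pi * (k : ℕ)) ^ 2 * pinskerWeight β w k) := by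
    refine mul_le_mul_of_nonneg_left ?_ (by linarith)
    linarith
  have h5 : 0 ≤ g * ((2 * Real.pi) ^ 2 * κ ^ 3 * (ε ^ 2 * w ^ 3)) := by positivity
  have h6 := mul_le_mul_of_nonneg_left hBQ hg0.le
  linarith

/-- Since (1 - 4g)(1 + 2g) ≤ 1 - 2g, the quotient loses 4g; the fifth g absorbs `J`. -/
theorem ratio_lower_bound {g S B D J : ℝ} (hg0 : 0 < g) (hg : g < 1 / 5) (hS : 0 < S) (hB : 0 ≤ B)
    (hD : 0 ≤ D) (hmax : (1 + g⁻¹) * D ≤ g * S) (hmin : J ≤ g * (B / S)) :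
    (1 - 5 * g) * (B / S) ≤ (1 - 2 * g) * B / ((1 + g) * S + (1 + g⁻¹) * D) - J := by
  have h1 : (1 - 4 * g) * (B / S) ≤ (1 - 2 * g) * B / ((1 + g) * S + (1 + g⁻¹) * D) := by
    calc (1 - 4 * g) * (B / S) ≤ (1 - 2 * g) * B / ((1 + 2 * g) * S) := by
          rw [mul_div_assoc', div_le_div_iff₀ hS (by positivity)]
          have h1 : 0 ≤ 8 * g ^ 2 * (B * S) := by positivity
          linarith
      _ ≤ _ := div_le_div_of_nonneg_left (mul_nonneg (by linarith) hB) (by positivity) (by linarith)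
  linarith

/-- Outside the set the sieve returns the unperturbed signal, which corresponds to the admissible
perturbation 0. -/
theorem exists_mem_sieveSet {K : Finset ℕ+} (hL : 0 ≤ L) (b : ℕ+ → ℝ) (v : K → ℝ) :
    ∃ v' ∈ sieveSet K β L δ, sieve b (sieveSet K β L δ) v = b + extendCoef v' := by
  by_cases hv : v ∈ sieveSet K β L δ
  · exact ⟨v, hv, sieve_of_mem hv⟩
  · refine ⟨0, ⟨?_, ?_⟩, ?_⟩
    · simpa using hL
    · simpa using sq_nonneg δ
    · rw [sieve_of_notMem hv]
      funext k
      rw [Pi.add_apply, extendCoef]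
      simp

variable {Ω : Type*} [MeasurableSpace Ω] {P : Measure Ω} [IsProbabilityMeasure P]
  {N : TestFun → Ω → ℝ} {b : ℕ+ → ℝ}

/-- The lower bound at a fixed noise level, under explicit smallness conditions. -/
theorem IsWhiteNoise.le_minimaxShiftRisk (hN : IsWhiteNoise N P)
    (hb : Summable fun k : ℕ+ => (k : ℝ) * |b k|) {ρ : ℝ} (hρ : 0 < ρ) (hb1 : ρ ≤ b 1 ^ 2)
    (hS : 0 < derivSq b)
    (hβ : 2 ≤ β) (hw : 8 ≤ w) (hwn : w ≤ (n : ℕ)) (hL0 : 0 < L)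
    (hε : 0 < ε) (hL : ε ^ 2 * pinskerSum β w n = L) (hg0 : 0 < g) (hg : g < 1 / 5) (hκ : 0 < κ)
    (hκw : 1 < κ * w) (hδ : 0 < δ) {l : ℝ} (hl : 0 < l) {τ : ℝ} (hτ : 0 < τ) {p : ℝ} (hp1 : p < 1)
    (hp : 80 * 256 / (g ^ 2 * (1 / 4) ^ (β - 1) * w) + ε ^ 2 * w / (κ ^ (β - 1) * δ ^ 2) ≤ p)
    (hq : 2 * p / (κ ^ (β - 1)) ^ 2 + 2 * (80 * l + p / (4 * l)) / κ ^ (β - 1) + κ ^ 3 ≤ g / 256)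
    (hmax : (1 + g⁻¹) * ((2 * Real.pi) ^ 2 * (ε ^ 2 * w ^ 3) / (κ ^ (β - 1)) ^ 2) ≤ g * derivSq b)
    (hmin : ε ^ 2 * priorInfo τ / ((2 * Real.pi) ^ 2 * ρ) ≤
      g * (ε ^ 2 * pinskerInfo β w n / derivSq b)) :
    1 + ENNReal.ofReal ((1 - 5 * g) * (ε ^ 2 * pinskerInfo β w n / derivSq b)) ≤
      minimaxShiftRisk P N ε (Icc (-τ) τ) (vicinity β L (cosSeries b) δ) := by
  have hw0 : 0 < w := by linarith
  have hG := pinskerScale_pos (β := β) hw0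
  have hp0 : 0 ≤ p := le_trans (by positivity) hp
  have hμ : 0 < κ ^ (β - 1) := Real.rpow_pos_of_pos hκ _
  have hB0 : 0 ≤ ε ^ 2 * pinskerInfo β w n :=
    mul_nonneg (sq_nonneg _) (le_trans (by positivity) (le_pinskerInfo hβ hw hwn))
  have hs : ∀ k : sieveFreq κ w n, sieveVar g ε β w k ≠ 0 := fun k =>
    sieveVar_ne_zero (by linarith) hε (by linarith) hw0 k.2
  have hAc := (gaussianPrior_sieveSet_compl_le hβ hw hwn hL0 hε hL hg0 (by linarith) hκ hδ).trans
      (ENNReal.ofReal_le_ofReal hp)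
  have hAm : MeasurableSet (sieveSet (sieveFreq κ w n) β L δ) := measurableSet_sieveSet _ β L δ
  have hA0 : gaussianPrior (fun k : sieveFreq κ w n => sieveVar g ε β w k)
      (sieveSet (sieveFreq κ w n) β L δ) ≠ 0 := by
    intro h
    rw [(prob_compl_eq_one_iff hAm).2 h, ENNReal.one_le_ofReal] at hAc
    linarith
  have hAδ : ∀ v ∈ sieveSet (sieveFreq κ w n) β L δ, ∀ k, |v k| ≤ δ := fun v hv k =>
    abs_le_of_sq_le_sq ((Finset.single_le_sum (f := fun k => v k ^ 2)
      (fun k _ => sq_nonneg _) (Finset.mem_univ k)).trans hv.2) hδ.le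
  have hAD : ∀ v ∈ sieveSet (sieveFreq κ w n) β L δ,
      ∑ k : sieveFreq κ w n, (2 * Real.pi * (k : ℕ)) ^ 2 * v k ^ 2 ≤
        L / (pinskerScale β w * (κ ^ (β - 1)) ^ 2) := fun v hv =>
    sum_sq_le_of_mem_sieveSet hβ hw0 hκ hv
  have hD0 : 0 ≤ L / (pinskerScale β w * (κ ^ (β - 1)) ^ 2) := by positivity
  have hDQ : L / (pinskerScale β w * (κ ^ (β - 1)) ^ 2) ≤
      (2 * Real.pi) ^ 2 * (ε ^ 2 * w ^ 3) / (κ ^ (β - 1)) ^ 2 := by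
    have h1 := mul_le_mul_of_nonneg_left (pinskerSum_le (β := β) (n := n) (by linarith) hw0)
      (sq_nonneg ε)
    rw [hL] at h1
    rw [div_le_div_iff₀ (by positivity) (by positivity)]
    have h2 := mul_le_mul_of_nonneg_right h1 (sq_nonneg (κ ^ (β - 1)))
    linarith
  have hmax' := (mul_le_mul_of_nonneg_left hDQ (show 0 ≤ 1 + g⁻¹ by positivity)).trans hmax
  generalize L / (pinskerScale β w * (κ ^ (β - 1)) ^ 2) = D at hAD hD0 hDQ hmax'
  -- The lower cutoff lies above 1, which protects the first coefficient.
  have h1K : (1 : ℕ+) ∉ sieveFreq κ w n := fun h => by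
    have := (mem_sieveFreq h).1
    simp only [PNat.one_coe, Nat.cast_one] at this
    linarith
  have hqint := setLIntegral_quadratic_prior_le hs hAc hp0 hl hD0
    (a := fun k : sieveFreq κ w n => (2 * Real.pi * (k : ℕ)) ^ 2) fun k => sq_nonneg _
  have hVQ := sum_sq_mul_sieveVar_le (n := n) (ε := ε) hβ hw0 hg0.le (by linarith) hκ
  have hE := le_sum_posterior_sieveVar hβ hw hwn hε hg0 (by linarith) hκ hp0 hl hDQ hVQ hq
  have hV0 : 0 ≤ ∑ k : sieveFreq κ w n, (2 * Real.pi * (k : ℕ)) ^ 2 * (sieveVar g ε β w k : ℝ) :=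
    Finset.sum_nonneg fun k _ => mul_nonneg (sq_nonneg _) NNReal.zero_le_coe
  have hq0 : 0 ≤ 2 * D * p + 2 * (∑ k : sieveFreq κ w n, (2 * Real.pi * (k : ℕ)) ^ 2 *
      (sieveVar g ε β w k : ℝ)) * (80 * l + p / (4 * l)) := by positivity
  have hfinal := ratio_lower_bound hg0 hg hS hB0 hD0 hmax' hmin
  have hBS : 0 ≤ ε ^ 2 * pinskerInfo β w n / derivSq b := div_nonneg hB0 hS.le
  refine le_iInf₂ fun T hT => ?_
  have hrisk := hN.le_risk_sieve (s := fun k : sieveFreq κ w n => sieveVar g ε β w k)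
    hb hρ hb1 h1K hs hAm hA0 hδ hAδ hD0 hAD hq0 hqint hε
    (mul_nonneg (by linarith) hB0) hE hg0 hτ hT (R := ⨆ θ ∈ Icc (-τ) τ,
      ⨆ f ∈ vicinity β L (cosSeries b) δ, normalizedRisk P N T ε θ f) fun θ hθ v => by
      obtain ⟨v', hv', he⟩ := exists_mem_sieveSet (β := β) (δ := δ) hL0.le b v
      rw [he]
      exact le_iSup₂_of_le θ hθ (le_iSup₂_of_le (cosSeries (b + extendCoef v'))
        (cosSeries_add_extendCoef_mem_vicinity (summable_abs_of_weighted hb) hv'.1 hv'.2) le_rfl)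
  refine le_trans ?_ hrisk
  rw [← ENNReal.ofReal_one, ← ENNReal.ofReal_add zero_le_one (mul_nonneg (by linarith) hBS)]
  refine ENNReal.ofReal_le_ofReal ?_
  linarith

end Lower

/-! ### Asymptotics of the cutoff frequency -/

section Limits

variable {β L : ℝ} {w : ℝ → ℝ} {n : ℝ → ℕ+}

theorem pinskerScale_mono (hβ : 1 ≤ β) {x y : ℝ} (hx : 0 < x) (hxy : x ≤ y) :
    pinskerScale β x ≤ pinskerScale β y := by
  have : 0 ≤ β - 1 := by linarith
  unfold pinskerScale
  gcongr

theorem sq_le_pinskerScale (hβ : 2 ≤ β) {x : ℝ} (hx : 1 ≤ x) : x ^ 2 ≤ pinskerScale β x := by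
  have h1 : x ≤ 2 * Real.pi * x := by nlinarith [Real.pi_gt_three]
  have h2 : 2 * Real.pi * x ≤ (2 * Real.pi * x) ^ (β - 1) :=
    Real.self_le_rpow_of_one_le (hx.trans h1) (by linarith)
  exact pow_le_pow_left₀ (by linarith) (h1.trans h2) 2

theorem pinskerScale_mul_cube {x : ℝ} (hx : 0 < x) :
    pinskerScale β x * x ^ 3 = (2 * Real.pi) ^ (2 * β - 2) * x ^ (2 * β + 1) := by
  rw [pinskerScale, Real.mul_rpow (by positivity) hx.le, mul_pow, ← Real.rpow_natCast _ 2,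
    ← Real.rpow_natCast _ 2, ← Real.rpow_natCast _ 3, ← Real.rpow_mul (by positivity),
    ← Real.rpow_mul hx.le, mul_assoc, ← Real.rpow_add hx]
  push_cast
  ring_nf

/-- If w stayed below a constant along ε → 0, the Pinsker sum would be bounded and ε² times it could
not remain equal to L. -/
theorem tendsto_cutoff (hβ : 1 ≤ β) (hL : 0 < L) (hw : ∀ ε, 1 ≤ w ε)
    (hsum : ∀ ε, 0 < ε → ε ^ 2 * pinskerSum β (w ε) (n ε) = L) :
    Tendsto w (𝓝[>] 0) atTop := by
  rw [tendsto_atTop]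
  intro M
  set Φ := (2 * Real.pi) ^ 2 * (pinskerScale β (max M 1) * max M 1 ^ 3) with hΦ
  have h0 : Tendsto (fun ε : ℝ => ε ^ 2 * Φ) (𝓝[>] 0) (𝓝 0) := by
    have : Tendsto (fun ε : ℝ => ε ^ 2 * Φ) (𝓝 0) (𝓝 (0 ^ 2 * Φ)) :=
      Continuous.tendsto (by fun_prop) 0
    rw [zero_pow two_ne_zero, zero_mul] at this
    exact this.mono_left nhdsWithin_le_nhds
  filter_upwards [h0.eventually_lt_const hL, self_mem_nhdsWithin] with ε h1 hε
  by_contra! hM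
  have hw0 : 0 < w ε := by linarith [hw ε]
  have h2 := pinskerSum_le (n := n ε) hβ hw0
  have h3 : w ε ≤ max M 1 := hM.le.trans (le_max_left _ _)
  have h4 : pinskerSum β (w ε) (n ε) ≤ Φ := by
    refine h2.trans ?_
    have h5 := pinskerScale_mono hβ hw0 h3
    have h6 := (pinskerScale_pos (β := β) hw0).le.trans h5
    rw [hΦ]
    gcongr
  have h5 := mul_le_mul_of_nonneg_left h4 (sq_nonneg ε)
  rw [hsum ε hε] at h5
  linarith

theorem sq_mul_scale_cube_le (hβ : 2 ≤ β) {x ε : ℝ} {m : ℕ+} (hx : 8 ≤ x) (hxm : x ≤ (m : ℕ))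
    (hsum : ε ^ 2 * pinskerSum β x m = L) :
    ε ^ 2 * (pinskerScale β x * x ^ 3) ≤ L / ((2 * Real.pi) ^ 2 / 256 * (1 / 4) ^ (β - 1)) := by
  rw [le_div_iff₀ (by positivity), ← hsum]
  have := mul_le_mul_of_nonneg_left (le_pinskerSum hβ hx hxm) (sq_nonneg ε)
  linarith

/-- The product of ε²w³ with the scale is bounded, and the scale is at least w² because β ≥ 2. -/
theorem tendsto_sq_mul_cutoff_cube (hβ : 2 ≤ β) (hw : Tendsto w (𝓝[>] 0) atTop)
    (hwn : ∀ ε, w ε ≤ (n ε : ℕ)) (hsum : ∀ ε, 0 < ε → ε ^ 2 * pinskerSum β (w ε) (n ε) = L) :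
    Tendsto (fun ε : ℝ => ε ^ 2 * w ε ^ 3) (𝓝[>] 0) (𝓝 0) := by
  set C := L / ((2 * Real.pi) ^ 2 / 256 * (1 / 4) ^ (β - 1)) with hC
  have h1 : Tendsto (fun ε : ℝ => C / w ε ^ 2) (𝓝[>] 0) (𝓝 0) :=
    Tendsto.const_div_atTop ((tendsto_pow_atTop two_ne_zero).comp hw) C
  refine tendsto_of_tendsto_of_tendsto_of_le_of_le' tendsto_const_nhds h1 ?_ ?_
  · filter_upwards [hw.eventually_ge_atTop 8] with ε h8
    have : 0 ≤ w ε := by linarith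
    positivity
  · filter_upwards [hw.eventually_ge_atTop 8, self_mem_nhdsWithin] with ε h8 hε
    have hw0 : 0 < w ε := by linarith
    have h2 := sq_mul_scale_cube_le hβ h8 (hwn ε) (hsum ε hε)
    have h3 := sq_le_pinskerScale (x := w ε) hβ (by linarith)
    rw [le_div_iff₀ (by positivity)]
    refine le_trans ?_ h2
    have h4 : 0 ≤ ε ^ 2 * w ε ^ 3 := by positivity
    nlinarith [mul_le_mul_of_nonneg_left h3 h4]

/-- Only w = O(W) is used, obtained by comparing powers 2β + 1; the exact constant in W plays no
role. Then W ≥ 1 gives W ≤ W^(1+α), and the growth condition on δ applies. -/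
theorem tendsto_sq_mul_cutoff_div (hβ : 2 ≤ β) (hL : 0 < L) (hw : Tendsto w (𝓝[>] 0) atTop)
    (hwn : ∀ ε, w ε ≤ (n ε : ℕ)) (hsum : ∀ ε, 0 < ε → ε ^ 2 * pinskerSum β (w ε) (n ε) = L)
    {W : ℝ → ℝ}
    (hW : Asymptotics.IsEquivalent (𝓝[>] 0) W (fun ε : ℝ =>
      (L * (β + 2) * (2 * β + 1) / (ε ^ 2 * (2 * Real.pi) ^ (2 * β) * (β - 1)))
        ^ (1 / (2 * β + 1))))
    {δ : ℝ → ℝ} {α : ℝ} (hα : 0 < α)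
    (hδ_large : Tendsto (fun ε : ℝ => δ ε ^ 2 / (ε ^ 2 * W ε ^ (1 + α))) (𝓝[>] 0) atTop) :
    Tendsto (fun ε : ℝ => ε ^ 2 * w ε / δ ε ^ 2) (𝓝[>] 0) (𝓝 0) := by
  set base : ℝ → ℝ := fun ε =>
    L * (β + 2) * (2 * β + 1) / (ε ^ 2 * (2 * Real.pi) ^ (2 * β) * (β - 1)) with hbase
  have hβ1 : 0 < β - 1 := by linarith
  set C := L / ((2 * Real.pi) ^ 2 / 256 * (1 / 4) ^ (β - 1)) with hC
  have hC0 : 0 < C := by positivity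
  set A := L * (β + 2) * (2 * β + 1) / ((2 * Real.pi) ^ (2 * β) * (β - 1)) with hA
  have hA0 : 0 < A := by positivity
  set C' := C / (2 * Real.pi) ^ (2 * β - 2) / A with hC'
  have hC'0 : 0 < C' := by positivity
  have he : 0 < 1 / (2 * β + 1) := by positivity
  have hbaseA : ∀ ε, 0 < ε → base ε = A / ε ^ 2 := fun ε hε => by
    simp only [hbase, hA]
    field_simp
  have hW0 : Tendsto (fun ε => base ε ^ (1 / (2 * β + 1))) (𝓝[>] 0) atTop := by
    refine (tendsto_rpow_atTop he).comp ?_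
    have h1 : Tendsto (fun ε : ℝ => A * (ε⁻¹ ^ 2)) (𝓝[>] 0) atTop :=
      (((tendsto_pow_atTop two_ne_zero).comp tendsto_inv_nhdsGT_zero)).const_mul_atTop hA0
    refine h1.congr' ?_
    filter_upwards [self_mem_nhdsWithin] with ε hε
    rw [hbaseA ε hε, inv_pow, div_eq_mul_inv]
  have hhalf : ∀ᶠ ε in 𝓝[>] 0, base ε ^ (1 / (2 * β + 1)) ≤ 2 * W ε := by
    have h1 := hW.isLittleO.def (show (0 : ℝ) < 1 / 2 by norm_num)
    filter_upwards [h1, hW0.eventually_gt_atTop 0] with ε h2 h3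
    rw [Pi.sub_apply, Real.norm_eq_abs, Real.norm_eq_abs, abs_of_pos h3] at h2
    have := (abs_le.1 h2).1
    linarith
  have hbound : ∀ᶠ ε in 𝓝[>] 0, ε ^ 2 * w ε / δ ε ^ 2 ≤
      2 * C' ^ (1 / (2 * β + 1)) * (δ ε ^ 2 / (ε ^ 2 * W ε ^ (1 + α)))⁻¹ := by
    filter_upwards [hw.eventually_ge_atTop 8, self_mem_nhdsWithin, hhalf,
      hW0.eventually_ge_atTop 2] with ε h8 hε h2 h3
    have hε' : (0 : ℝ) < ε := hε
    have hw0 : 0 < w ε := by linarith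
    have h4 := sq_mul_scale_cube_le hβ h8 (hwn ε) (hsum ε hε)
    rw [pinskerScale_mul_cube hw0] at h4
    have h5 : w ε ^ (2 * β + 1) ≤ C' * base ε := by
      rw [hbaseA ε hε, hC', div_mul_div_cancel₀ hA0.ne', div_div, le_div_iff₀ (by positivity)]
      linarith
    have h6 : w ε ≤ C' ^ (1 / (2 * β + 1)) * base ε ^ (1 / (2 * β + 1)) := by
      have hb0 : 0 ≤ base ε := by
        rw [hbaseA ε hε]
        positivity
      rw [← Real.mul_rpow hC'0.le hb0]
      have h7 := Real.rpow_le_rpow (by positivity) h5 he.le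
      rwa [← Real.rpow_mul hw0.le, mul_one_div_cancel (by positivity), Real.rpow_one] at h7
    have hW1 : 1 ≤ W ε := by linarith
    have h7 : W ε ≤ W ε ^ (1 + α) := Real.self_le_rpow_of_one_le hW1 (by linarith)
    have h8 : w ε ≤ 2 * C' ^ (1 / (2 * β + 1)) * W ε ^ (1 + α) := by
      refine h6.trans ?_
      calc _ ≤ C' ^ (1 / (2 * β + 1)) * (2 * W ε ^ (1 + α)) := by
            gcongr
            linarith
        _ = _ := by ring
    rw [inv_div]
    calc ε ^ 2 * w ε / δ ε ^ 2
        ≤ ε ^ 2 * (2 * C' ^ (1 / (2 * β + 1)) * W ε ^ (1 + α)) / δ ε ^ 2 := by gcongr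
      _ = _ := by ring
  have hlim : Tendsto (fun ε => 2 * C' ^ (1 / (2 * β + 1)) *
      (δ ε ^ 2 / (ε ^ 2 * W ε ^ (1 + α)))⁻¹) (𝓝[>] 0) (𝓝 0) := by
    have := hδ_large.inv_tendsto_atTop.const_mul (2 * C' ^ (1 / (2 * β + 1)))
    rwa [mul_zero] at this
  refine tendsto_of_tendsto_of_tendsto_of_le_of_le' tendsto_const_nhds hlim ?_ hbound
  filter_upwards [hw.eventually_ge_atTop 0] with ε h0
  positivity

end Limits

/-! ### Passage to a vanishing relative loss -/

/-- From a family of eventual inequalities to a single one with a vanishing error. -/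
theorem exists_tendsto_zero_of_forall_eventually {Q : ℝ → ℝ → Prop}
    (hmono : ∀ ε x y, x ≤ y → Q x ε → Q y ε)
    (h : ∀ x ∈ Ioo (0 : ℝ) 1, ∀ᶠ ε in 𝓝[>] 0, Q x ε) :
    ∃ η : ℝ → ℝ, Tendsto η (𝓝[>] 0) (𝓝 0) ∧ ∀ᶠ ε in 𝓝[>] 0, Q (-η ε) ε := by
  set S : ℝ → Set ℝ := fun ε => {x | 0 ≤ x ∧ Q x ε} with hS
  have hbdd : ∀ ε, BddBelow (S ε) := fun ε => ⟨0, fun x hx => hx.1⟩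
  have hnn : ∀ ε, 0 ≤ sInf (S ε) := fun ε => Real.sInf_nonneg fun x hx => hx.1
  have hid : Tendsto (fun ε : ℝ => ε) (𝓝[>] 0) (𝓝 0) := nhdsWithin_le_nhds
  have hle : ∀ x ∈ Ioo (0 : ℝ) 1, ∀ᶠ ε in 𝓝[>] 0, sInf (S ε) ≤ x := fun x hx => by
    filter_upwards [h x hx] with ε hε
    exact csInf_le (hbdd ε) ⟨hx.1.le, hε⟩
  have hlim : Tendsto (fun ε => sInf (S ε)) (𝓝[>] 0) (𝓝 0) := by
    rw [Metric.tendsto_nhds]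
    intro r hr
    have hx : min (r / 2) (1 / 2) ∈ Ioo (0 : ℝ) 1 :=
      ⟨by positivity, (min_le_right _ _).trans_lt (by norm_num)⟩
    filter_upwards [hle _ hx] with ε hε
    rw [Real.dist_0_eq_abs, abs_of_nonneg (hnn ε)]
    exact (hε.trans (min_le_left _ _)).trans_lt (by linarith)
  -- The infimum of admissible losses need not be attained; the extra ε puts a genuine admissible
  -- value below the chosen one.
  refine ⟨fun ε => -(sInf (S ε) + ε), ?_, ?_⟩
  · simpa using (hlim.add hid).neg
  · filter_upwards [h (1 / 2) ⟨by norm_num, by norm_num⟩, self_mem_nhdsWithin] with ε hε hpos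
    have hpos' : (0 : ℝ) < ε := hpos
    have hne : (S ε).Nonempty := ⟨1 / 2, by norm_num, hε⟩
    obtain ⟨x, hx, hxlt⟩ := exists_lt_of_csInf_lt hne (show sInf (S ε) < sInf (S ε) + ε by linarith)
    rw [neg_neg]
    exact hmono ε _ _ hxlt.le hx.2

theorem sobolevSq_cosSeries_one {b : ℕ+ → ℝ} (hb : Summable fun k : ℕ+ => (k : ℝ) * |b k|) :
    sobolevSq (cosSeries b) 1 = ENNReal.ofReal (derivSq b) := by
  have hbd : Summable fun k : ℕ+ => (2 * Real.pi * (k : ℕ)) ^ 2 * b k ^ 2 := by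
    have := (summable_sq_of_summable (fun k : ℕ+ => mul_nonneg (by positivity) (abs_nonneg (b k)))
      hb).mul_left ((2 * Real.pi) ^ 2)
    refine this.congr fun k => ?_
    rw [← sq_abs (b k)]
    ring
  have h := sobolevSq_eq (cosSeries b) 1
  rw [Nat.cast_one] at h
  rw [h, derivSq, ENNReal.ofReal_tsum_of_nonneg (fun k => by positivity) hbd]
  refine tsum_congr fun k => ?_
  rw [cosCoeff_cosSeries (summable_abs_of_weighted hb)]

/-- The lower bound with an arbitrarily small relative loss. -/
theorem IsWhiteNoise.eventually_le_minimaxShiftRisk {Ω : Type*} [MeasurableSpace Ω] {P : Measure Ω}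
    [IsProbabilityMeasure P] {N : TestFun → Ω → ℝ} (hN : IsWhiteNoise N P) {τ : ℝ} (hτ : 0 < τ)
    {b : ℕ+ → ℝ} (hb : Summable fun k : ℕ+ => (k : ℝ) * |b k|) {ρ : ℝ} (hρ : 0 < ρ)
    (hb1 : ρ ≤ b 1 ^ 2) (hS : 0 < derivSq b) {β L : ℝ} (hβ : 2 ≤ β) (hL : 0 < L) {W : ℝ → ℝ}
    (hW : Asymptotics.IsEquivalent (𝓝[>] 0) W (fun ε : ℝ =>
      (L * (β + 2) * (2 * β + 1) / (ε ^ 2 * (2 * Real.pi) ^ (2 * β) * (β - 1)))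
        ^ (1 / (2 * β + 1))))
    {δ : ℝ → ℝ} (hδ_pos : ∀ᶠ ε in 𝓝[>] 0, 0 < δ ε) {α : ℝ} (hα : 0 < α)
    (hδ_large : Tendsto (fun ε : ℝ => δ ε ^ 2 / (ε ^ 2 * W ε ^ (1 + α))) (𝓝[>] 0) atTop)
    {x : ℝ} (hx : x ∈ Ioo (0 : ℝ) 1) :
    ∀ᶠ ε in 𝓝[>] 0, 1 + ENNReal.ofReal (1 - x) *
        (pinskerValue β L ε / sobolevSq (cosSeries b) 1) ≤
      minimaxShiftRisk P N ε (Icc (-τ) τ) (vicinity β L (cosSeries b) (δ ε)) := by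
  choose n w hw1 hwn hsum' using fun ε : ℝ =>
    exists_pinskerSum_eq hβ (y := L / ε ^ 2) (by positivity)
  have hsum : ∀ ε, 0 < ε → ε ^ 2 * pinskerSum β (w ε) (n ε) = L := fun ε hε => by
    rw [hsum' ε, mul_div_cancel₀ _ (by positivity)]
  have hw := tendsto_cutoff (by linarith : 1 ≤ β) hL hw1 hsum
  have hQ := tendsto_sq_mul_cutoff_cube hβ hw hwn hsum
  have hδw := tendsto_sq_mul_cutoff_div hβ hL hw hwn hsum hW hα hδ_large
  -- The fixed-level bound loses the factor 1 - 5g.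
  obtain ⟨g, hgx⟩ : ∃ g, g = x / 5 := ⟨_, rfl⟩
  have hg0 : 0 < g := by linarith [hx.1]
  have hg : g < 1 / 5 := by linarith [hx.2]
  obtain ⟨κ, hκ⟩ : ∃ κ, κ = g / 8 := ⟨_, rfl⟩
  have hκ0 : 0 < κ := by linarith
  obtain ⟨μ, hμ⟩ : ∃ μ, μ = κ ^ (β - 1) := ⟨_, rfl⟩
  have hμ0 : 0 < μ := hμ ▸ Real.rpow_pos_of_pos hκ0 _
  obtain ⟨y, hy⟩ : ∃ y : ℝ, y = (1 / 4) ^ (β - 1) := ⟨_, rfl⟩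
  -- With this value 160·l/μ equals g/1024, and κ³ = g³/512 ≤ g/512; together they stay below the
  -- budget g/256.
  obtain ⟨l, hl⟩ : ∃ l, l = g * μ / (160 * 1024) := ⟨_, rfl⟩
  have hl0 : 0 < l := by rw [hl]; positivity
  have hplim : Tendsto (fun ε => 80 * 256 / (g ^ 2 * y * w ε) + ε ^ 2 * w ε / (μ * δ ε ^ 2))
      (𝓝[>] 0) (𝓝 0) := by
    have hy0 : 0 < y := by rw [hy]; positivity
    have h1 : Tendsto (fun ε => 80 * 256 / (g ^ 2 * y * w ε)) (𝓝[>] 0) (𝓝 0) :=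
      Tendsto.const_div_atTop (hw.const_mul_atTop (by positivity)) _
    have h2 := hδw.const_mul μ⁻¹
    rw [mul_zero] at h2
    have h3 := h1.add h2
    rw [add_zero] at h3
    refine h3.congr fun ε => ?_
    congr 1
    rw [inv_mul_eq_div, div_div, mul_comm μ]
  obtain ⟨p, hpdef⟩ : ∃ p : ℝ → ℝ, p = fun ε =>
    80 * 256 / (g ^ 2 * y * w ε) + ε ^ 2 * w ε / (μ * δ ε ^ 2) := ⟨_, rfl⟩
  rw [← hpdef] at hplim
  have hqlim : Tendsto (fun ε => 2 * p ε / μ ^ 2 + 2 * (80 * l + p ε / (4 * l)) / μ + κ ^ 3)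
      (𝓝[>] 0) (𝓝 (2 * 0 / μ ^ 2 + 2 * (80 * l + 0 / (4 * l)) / μ + κ ^ 3)) :=
    (((hplim.const_mul 2).div_const _).add
      ((((hplim.div_const _).const_add _).const_mul 2).div_const _)).add_const _
  have hqlt : 2 * 0 / μ ^ 2 + 2 * (80 * l + 0 / (4 * l)) / μ + κ ^ 3 < g / 256 := by
    have h1 : 2 * 0 / μ ^ 2 + 2 * (80 * l + 0 / (4 * l)) / μ = g / 1024 := by
      rw [hl]
      field_simp
      ring
    have h2 : κ ^ 3 ≤ g / 512 := by
      rw [hκ]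
      have : g ^ 2 ≤ 1 := by nlinarith
      nlinarith
    rw [h1]
    linarith
  have hmaxlim : Tendsto (fun ε => (1 + g⁻¹) * ((2 * Real.pi) ^ 2 * (ε ^ 2 * w ε ^ 3) / μ ^ 2))
      (𝓝[>] 0) (𝓝 0) := by
    have := ((hQ.const_mul ((2 * Real.pi) ^ 2)).div_const (μ ^ 2)).const_mul (1 + g⁻¹)
    simpa using this
  -- The information of the shift prior is of order ε², while the gain is at least of order ε²w³;
  -- divergence of w makes the former negligible.
  have hw3 : Tendsto (fun ε => g * ((2 * Real.pi) ^ 2 / 256 * w ε ^ 3 / derivSq b)) (𝓝[>] 0)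
      atTop :=
    ((((tendsto_pow_atTop three_ne_zero).comp hw).const_mul_atTop
      (by positivity : 0 < (2 * Real.pi) ^ 2 / 256)).atTop_div_const hS).const_mul_atTop hg0
  filter_upwards [self_mem_nhdsWithin, hδ_pos, hw.eventually_ge_atTop 8,
    hw.eventually_gt_atTop (1 / κ), hplim.eventually_lt_const one_pos,
    hqlim.eventually_lt_const hqlt, hmaxlim.eventually_lt_const (mul_pos hg0 hS),
    hw3.eventually_ge_atTop (priorInfo τ / ((2 * Real.pi) ^ 2 * ρ))]
    with ε hε hδ h8 hκw hp1 hq hmax hmin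
  have hε' : (0 : ℝ) < ε := hε
  have hInfo := le_pinskerInfo hβ h8 (hwn ε)
  have hmain := hN.le_minimaxShiftRisk hb hρ hb1 hS hβ h8 (hwn ε) hL hε' (hsum ε hε') hg0 hg hκ0
    (by rwa [div_lt_iff₀ hκ0, mul_comm] at hκw) hδ hl0 hτ hp1
    (by rw [hpdef, hy, hμ]) (by rw [← hμ]; exact hq.le) (by rw [← hμ]; exact hmax.le) (by
      rw [mul_div_assoc, mul_div_assoc, mul_left_comm]
      refine mul_le_mul_of_nonneg_left (hmin.trans ?_) (sq_nonneg ε)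
      gcongr)
  refine le_trans ?_ hmain
  gcongr
  have hp := pinskerValue_le (by linarith : 1 ≤ β) (by linarith : 0 < w ε) (hwn ε) (hsum ε hε')
  rw [sobolevSq_cosSeries_one hb, hgx]
  calc ENNReal.ofReal (1 - x) * (pinskerValue β L ε / ENNReal.ofReal (derivSq b))
      ≤ ENNReal.ofReal (1 - x) * (ENNReal.ofReal (ε ^ 2 * pinskerInfo β (w ε) (n ε)) /
          ENNReal.ofReal (derivSq b)) := by gcongr
    _ = _ := by
        rw [← ENNReal.ofReal_div_of_pos hS, ← ENNReal.ofReal_mul (by linarith [hx.2])]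
        congr 2
        ring

end

theorem theorem2
    {Ω : Type*} [MeasurableSpace Ω] (P : Measure Ω) [IsProbabilityMeasure P]
    (N : TestFun → Ω → ℝ) (hN : IsWhiteNoise N P)
    (τ₀ : ℝ) (hτ₀ : 0 < τ₀) (hτ₀' : τ₀ < 1 / 4)
    (ρ C₀ : ℝ) (hρ : 0 < ρ) (hC₀ : 0 < C₀)
    (β L : ℝ) (hβ : 2 ≤ β) (hL : 0 < L)
    (fbar : ℝ → ℝ) (hfbar : fbar ∈ signalClass ρ C₀)
    (W : ℝ → ℝ)
    (hW : Asymptotics.IsEquivalent (𝓝[>] 0) W (fun ε : ℝ =>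
      (L * (β + 2) * (2 * β + 1) / (ε ^ 2 * (2 * Real.pi) ^ (2 * β) * (β - 1)))
        ^ (1 / (2 * β + 1))))
    (δ : ℝ → ℝ) (hδ_pos : ∀ᶠ ε in 𝓝[>] 0, 0 < δ ε)
    (hδ_zero : Tendsto δ (𝓝[>] 0) (𝓝 0))
    (α : ℝ) (hα : 0 < α)
    (hδ_large : Tendsto (fun ε : ℝ => δ ε ^ 2 / (ε ^ 2 * W ε ^ (1 + α))) (𝓝[>] 0) atTop) :
    ∃ η : ℝ → ℝ, Tendsto η (𝓝[>] 0) (𝓝 0) ∧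
      ∀ᶠ ε in 𝓝[>] 0,
        1 + ENNReal.ofReal (1 + η ε) * (pinskerValue β L ε / sobolevSq fbar 1) ≤
          minimaxShiftRisk P N ε (Icc (-τ₀) τ₀) (vicinity β L fbar (δ ε)) := by
  obtain ⟨hexp, hf1, hf2⟩ := hfbar
  have hb := summable_weighted_of_sobolevSq (ne_top_of_le_ne_top ENNReal.ofReal_ne_top hf2)
  have hfb := hexp.eq_cosSeries (summable_abs_of_weighted hb)
  set b : ℕ+ → ℝ := fun k => cosCoeff fbar k with hbdef
  have hb1 : ρ ≤ b 1 ^ 2 := by simpa [hbdef] using hf1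
  have hS : 0 < derivSq b := by
    have h := sobolevSq_cosSeries_one hb
    rw [← ENNReal.ofReal_pos, ← h]
    refine lt_of_lt_of_le ?_ (ENNReal.le_tsum 1)
    rw [cosCoeff_cosSeries (summable_abs_of_weighted hb), ENNReal.ofReal_pos]
    have : 0 < b 1 ^ 2 := hρ.trans_le hb1
    positivity
  rw [hfb]
  -- A larger loss gives a weaker bound, which is the monotonicity that the diagonal argument
  -- requires.
  have key := exists_tendsto_zero_of_forall_eventually
    (Q := fun x ε => 1 + ENNReal.ofReal (1 - x) *
      (pinskerValue β L ε / sobolevSq (cosSeries b) 1) ≤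
        minimaxShiftRisk P N ε (Icc (-τ₀) τ₀) (vicinity β L (cosSeries b) (δ ε)))
    (fun ε x y hxy h => le_trans (by gcongr) h)
    (fun x hx => hN.eventually_le_minimaxShiftRisk hτ₀ hb hρ hb1 hS hβ hL hW hδ_pos hα hδ_large hx)
  simpa only [sub_neg_eq_add] using key
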